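/- Let $(\Omega,\mathcal F,(\mathcal F_t)_{t\ge 0},\mathbb P)$ be a filtered probability space satisfying the usual hypotheses, $(\mathbf E,\mathcal E,m)$ a $\sigma$-finite measure space, and $N(dz,dt)$ an $(\mathcal F_t)$-Poisson random measure on $[0,\infty)\times\mathbf E$ with intensity $m(dz)\,dt$; put $\tilde N(dz,dt)=N(dz,dt)-m(dz)\,dt$. Let $d\ge 1$, $T>0$, $\Pi_T=[0,T)\times\mathbb R^d$, and assume: 1. $f:\mathbb R\to\mathbb R$ is $C^2$, nondecreasing, Lipschitz with constant $c_f$, and $f(0)=0$. 2. $\vec v:[0,T]\times\mathbb R^d\to\mathbb R^d$ is $C^1$, $\operatorname{div}_x\vec v=0$ and $|\vec v|\le V<\infty$ on $\Pi_T$. 3. $\eta:\mathbb R\times\mathbf E\to\mathbb R$ is measurable in $z$, and there are $0<\lambda^*<1$, $C^*>0$ and $h_1\in L^2(\mathbf E,m)$ with $0\le h_1\le 1$ such that $|\eta(a;z)-\eta(b;z)|\le\lambda^*|a-b|h_1(z)$, $|\eta(a;z)|\le C^*h_1(z)$ and $\eta(0;z)=0$ for all $a,b\in\mathbb R$, $z\in\mathbf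 E$. Put $c_\eta=\int_{\mathbf E}h_1^2\,dm$. 4. $u_0$ is an $\mathcal F_0$-measurable $L^2(\mathbb R^d)$-valued random variable with $\mathbb E\|u_0\|_{2}^2<\infty$. Let $\mathcal T$ be an admissible mesh of $\mathbb R^d$: a family of pairwise disjoint connected polygonal sets $K$ (each contained in the closure of its interior and with boundary contained in finitely many hyperplanes) whose closures cover $\mathbb R^d$, with $h=\sup_{K\in\mathcal T}\operatorname{diam}K<\infty$, such that for some constant $\alpha>0$ one has $\alpha h^d\le|K|$ and $|\partial K|\le\alpha^{-1}h^{d-1}$ for all $K\in\mathcal T$, and such that the interface $\sigma=K|L=\overline K\cap\overline L$ of any two neighbours (distinct $K,L\in\mathcal T$ with $|K|L|>0$) is contained in a hyperplane, with a unit normal $n_{K,\sigma}$ that is outward to $K$ at almost every point of $\sigma$. Here $|K|$ is $d$-dimensional and $|\partial K|$, $|\sigma|$ are $(d-1)$-dimensional Lebesgue measure. Let $\Delta t=T/N$ with $N\in\mathbb N$, $N\ge 1$, let $t_n=n\Delta t$, and assume the CFL condition $$\Delta t\le\frac{\alpha^2h}{c_fV}\qquad(\text{no restriction if } c_fV=0).$$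 Let $(u_K^n)_{K\in\mathcal T,\,0\le n\le N}$ be given by the upwind finite volume scheme: almost surely, $u_K^0=\frac1{|K|}\int_Ku_0\,dx$ and, for $0\le n<N$, $$\frac{|K|}{\Delta t}(u_K^{n+1}-u_K^n)+\sum_{\sigma=K|L}|\sigma|\,(\vec v\cdot n_{K,\sigma})\,f(u_\sigma^n)=\frac{|K|}{\Delta t}\int_{t_n}^{t_{n+1}}\!\!\int_{\mathbf E}\eta(u_K^n;z)\,\tilde N(dz,dt),$$ the sum being over the interfaces of $K$ with its neighbours $L$, where $\vec v\cdot n_{K,\sigma}=\frac1{\Delta t|\sigma|}\int_{t_n}^{t_{n+1}}\int_\sigma\vec v(t,x)\cdot n_{K,\sigma}\,d\nu(x)\,dt$, $\nu$ is $(d-1)$-dimensional Lebesgue measure, and $u_\sigma^n=u_K^n$ if $\vec v\cdot n_{K,\sigma}\ge0$, $u_\sigma^n=u_L^n$ otherwise. Alternatively, let upwinding be done pointwise on $\sigma$, that is, let the flux term be $|\sigma|\{(\vec v\cdot n_{K,\sigma})^+f(u_K^n)-(\vec v\cdot n_{K,\sigma})^-f(u_L^n)\}$ (for all $n$, $K$,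 $\sigma$), where $(\vec v\cdot n_{K,\sigma})^\pm=\frac1{\Delta t|\sigma|}\int_{t_n}^{t_{n+1}}\int_\sigma(\vec v(t,x)\cdot n_{K,\sigma})^\pm\,d\nu(x)\,dt$. In either case the approximate solution $u^h(t,x)=u_K^n$ for $x\in K$, $t\in[t_n,t_{n+1})$ satisfies $$\|u^h\|^2_{L^\infty(0,T;L^2(\Omega\times\mathbb R^d))}\le e^{c_\eta T}\,\mathbb E\big[\|u_0\|_2^2\big]\qquad\text{and}\qquad\|u^h\|^2_{L^2(\Omega\times\Pi_T)}\le T\,e^{c_\eta T}\,\mathbb E\big[\|u_0\|_2^2\big].$$ -/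

import Mathlib

open MeasureTheory ProbabilityTheory Filter Topology
open scoped NNReal ENNReal

namespace UpwindFV

noncomputable section

/-! ### Poisson random measures and the stochastic integral -/

/-- `Nm` is a Poisson random measure on `Θ` with intensity measure `ρ`. A Poisson variable with
infinite mean is, as usual, one that is almost surely infinite. -/
structure IsPoissonRandomMeasure {Ω Θ : Type*} [MeasurableSpace Ω] [MeasurableSpace Θ]
    (P : Measure Ω) (ρ : Measure Θ) (Nm : Ω → Measure Θ) : Prop where
  measurable : ∀ B, MeasurableSet B → Measurable (fun ω => Nm ω B)
  law : ∀ B, MeasurableSet B → ρ B ≠ ∞ →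
    P.map (fun ω => Nm ω B) = (poissonMeasure (ρ B).toNNReal).map (fun k : ℕ => (k : ℝ≥0∞))
  law_top : ∀ B, MeasurableSet B → ρ B = ∞ → ∀ᵐ ω ∂P, Nm ω B = ∞
  indep : ∀ (k : ℕ) (B : Fin k → Set Θ), (∀ i, MeasurableSet (B i)) →
    Pairwise (Function.onFun Disjoint B) → iIndepFun (fun i ω => Nm ω (B i)) P

/-- `Nm` is a Poisson random measure on `[0,∞) × E` (time and mark) with intensity `dt ⊗ m`,
relative to the filtration `ℱ`: its restriction to `[0,t] × E` is `ℱ t`-measurable and its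
restriction to `(t,∞) × E` is independent of `ℱ t`. -/
structure IsFiltrationPoisson {Ω E : Type*} {mΩ : MeasurableSpace Ω} [MeasurableSpace E]
    (P : Measure Ω) (ℱ : Filtration ℝ≥0 mΩ) (m : Measure E) (Nm : Ω → Measure (ℝ × E)) :
    Prop where
  poisson : IsPoissonRandomMeasure P ((volume.restrict (Set.Ici (0 : ℝ))).prod m) Nm
  adapted : ∀ (t : ℝ≥0) (B : Set (ℝ × E)), MeasurableSet B →
    B ⊆ Set.Icc (0 : ℝ) t ×ˢ Set.univ → Measurable[ℱ t] (fun ω => Nm ω B)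
  indep_future : ∀ t : ℝ≥0,
    Indep (⨆ B : {B : Set (ℝ × E) // MeasurableSet B ∧ B ⊆ Set.Ioi (t : ℝ) ×ˢ Set.univ},
      MeasurableSpace.comap (fun ω => Nm ω B.1) inferInstance) (ℱ t) P

/-- The usual hypotheses on a filtered probability space. -/
structure UsualHypotheses {Ω : Type*} {mΩ : MeasurableSpace Ω} (P : Measure Ω)
    (ℱ : Filtration ℝ≥0 mΩ) : Prop where
  rightContinuous : ℱ.IsRightContinuous
  null_mem : ∀ s : Set Ω, P s = 0 → MeasurableSet[ℱ 0] s

/-- A simple predictable function on `(a,b]`: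
`∑ i j, ξ i j · 1_{(τ i, τ (i+1)]}(t) · 1_{A j}(z)`, where `a = τ 0 ≤ ⋯ ≤ τ p = b`, each `ξ i j` is
bounded and `ℱ (τ i)`-measurable, and the `A j` are disjoint sets of finite measure. -/
structure SimplePredictable {Ω E : Type*} {mΩ : MeasurableSpace Ω} [MeasurableSpace E]
    (ℱ : Filtration ℝ≥0 mΩ) (m : Measure E) (a b : ℝ≥0) where
  p : ℕ
  q : ℕ
  τ : ℕ → ℝ≥0
  τ_mono : Monotone τ
  τ_zero : τ 0 = a
  τ_last : τ p = b
  A : Fin q → Set E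
  A_meas : ∀ j, MeasurableSet (A j)
  A_disj : Pairwise (Function.onFun Disjoint A)
  A_fin : ∀ j, m (A j) ≠ ∞
  ξ : Fin p → Fin q → Ω → ℝ
  ξ_meas : ∀ (i : Fin p) (j : Fin q), Measurable[ℱ (τ i)] (ξ i j)
  ξ_bdd : ∃ C : ℝ, ∀ i j ω, |ξ i j ω| ≤ C

namespace SimplePredictable

variable {Ω E : Type*} {mΩ : MeasurableSpace Ω} [MeasurableSpace E]
  {ℱ : Filtration ℝ≥0 mΩ} {m : Measure E} {a b : ℝ≥0}

/-- The simple function itself. -/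
def toFun (S : SimplePredictable ℱ m a b) (ω : Ω) (t : ℝ) (z : E) : ℝ :=
  ∑ i : Fin S.p, ∑ j : Fin S.q,
    S.ξ i j ω * (Set.Ioc (S.τ i : ℝ) (S.τ (i + 1))).indicator 1 t * (S.A j).indicator 1 z

/-- Its integral with respect to the compensated measure `Nm(dz,dt) - m(dz) dt`. -/
def integral (S : SimplePredictable ℱ m a b) (Nm : Ω → Measure (ℝ × E)) (ω : Ω) : ℝ :=
  ∑ i : Fin S.p, ∑ j : Fin S.q,
    S.ξ i j ω * ((Nm ω (Set.Ioc (S.τ i : ℝ) (S.τ (i + 1)) ×ˢ S.A j)).toReal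
      - ((S.τ (i + 1) : ℝ) - S.τ i) * (m (S.A j)).toReal)

end SimplePredictable

/-- `I` is (a version of) the stochastic integral `∫_a^b ∫_E ζ(t,z) Ñ(dz,dt)` with respect to the
compensated measure: `ζ` is an `L²(Ω × (a,b] × E)`-limit of simple predictable functions whose
integrals converge to `I` in `L²(Ω)`. -/
def IsStochIntegral {Ω E : Type*} {mΩ : MeasurableSpace Ω} [MeasurableSpace E]
    (P : Measure Ω) (ℱ : Filtration ℝ≥0 mΩ) (m : Measure E) (Nm : Ω → Measure (ℝ × E))
    (a b : ℝ≥0) (ζ : Ω → ℝ → E → ℝ) (I : Ω → ℝ) : Prop :=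
  MemLp I 2 P ∧ ∃ S : ℕ → SimplePredictable ℱ m a b,
    Tendsto (fun k => eLpNorm (fun y : Ω × (ℝ × E) =>
        (S k).toFun y.1 y.2.1 y.2.2 - ζ y.1 y.2.1 y.2.2) 2
        (P.prod ((volume.restrict (Set.Ioc (a : ℝ) b)).prod m))) atTop (𝓝 0) ∧
    Tendsto (fun k => eLpNorm (fun ω => (S k).integral Nm ω - I ω) 2 P) atTop (𝓝 0)

/-! ### Admissible meshes -/

/-- A (not necessarily convex, open or closed) polygonal set: it has no lower-dimensional parts,
and its boundary lies in finitely many hyperplanes. -/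
def IsPolygonal {d : ℕ} (K : Set (EuclideanSpace ℝ (Fin d))) : Prop :=
  K ⊆ closure (interior K) ∧
  ∃ S : Finset (EuclideanSpace ℝ (Fin d) × ℝ), (∀ p ∈ S, p.1 ≠ 0) ∧
    frontier K ⊆ ⋃ p ∈ S, {x | inner ℝ p.1 x = p.2}

/-- The common interface `K|L` of two control volumes. -/
def interface {d : ℕ} (K L : Set (EuclideanSpace ℝ (Fin d))) : Set (EuclideanSpace ℝ (Fin d)) :=
  closure K ∩ closure L

/-- The `(d-1)`-dimensional Lebesgue measure on subsets of `ℝ^d`. -/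
def surface (d : ℕ) : Measure (EuclideanSpace ℝ (Fin d)) :=
  Measure.euclideanHausdorffMeasure (d - 1)

/-- `n` is the unit normal to the flat interface of `K` and `L` (which lies in a hyperplane),
outward to `K`. -/
def IsOutwardNormal {d : ℕ} (K L : Set (EuclideanSpace ℝ (Fin d)))
    (n : EuclideanSpace ℝ (Fin d)) : Prop :=
  ‖n‖ = 1 ∧ (∃ c : ℝ, ∀ x ∈ interface K L, inner ℝ n x = c) ∧
  ∀ᵐ x ∂((surface d).restrict (interface K L)), ∀ᶠ ε : ℝ in 𝓝[>] 0,
    x - ε • n ∈ K ∧ x + ε • n ∉ K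

/-- An admissible mesh of `ℝ^d`, with control volumes indexed by `ι`. -/
structure AdmissibleMesh (d : ℕ) (ι : Type*) where
  /-- the control volumes -/
  cell : ι → Set (EuclideanSpace ℝ (Fin d))
  /-- the constant in the regularity condition -/
  α : ℝ
  /-- `normal K L` is the unit normal to the interface of `K` and `L`, outward to `K` -/
  normal : ι → ι → EuclideanSpace ℝ (Fin d)
  disjoint : Pairwise (Function.onFun Disjoint cell)
  polygonal : ∀ K, IsPolygonal (cell K)
  connected : ∀ K, IsConnected (cell K)
  cover : ⋃ K, closure (cell K) = Set.univ
  flat : ∀ K L, K ≠ L → 0 < surface d (interface (cell K) (cell L)) →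
    IsOutwardNormal (cell K) (cell L) (normal K L)
  size_finite : ⨆ K, Metric.ediam (cell K) ≠ ∞
  α_pos : 0 < α
  volume_ge : ∀ K,
    ENNReal.ofReal (α * (⨆ K, Metric.ediam (cell K)).toReal ^ d) ≤ volume (cell K)
  boundary_le : ∀ K, surface d (frontier (cell K)) ≤
    ENNReal.ofReal (1 / α * (⨆ K, Metric.ediam (cell K)).toReal ^ (d - 1))

namespace AdmissibleMesh

variable {d : ℕ} {ι : Type*} (𝒯 : AdmissibleMesh d ι)

/-- The size `h = sup {diam K}` of the mesh. -/
def size : ℝ := (⨆ K, Metric.ediam (𝒯.cell K)).toReal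

/-- The set `𝒩(K)` of neighbours of `K`. -/
def neighbors (K : ι) : Set ι :=
  {L | L ≠ K ∧ 0 < surface d (interface (𝒯.cell K) (𝒯.cell L))}

/-- `|K|`. -/
def vol (K : ι) : ℝ := volume.real (𝒯.cell K)

/-- `|σ|` for the interface `σ = K|L`. -/
def area (K L : ι) : ℝ := (surface d).real (interface (𝒯.cell K) (𝒯.cell L))

/-- The mean of `g (v(t,x)·n_{K,σ})` over `[n Δt, (n+1) Δt] × σ`, for `σ = K|L`. -/
def normalMean (v : ℝ → EuclideanSpace ℝ (Fin d) → EuclideanSpace ℝ (Fin d)) (Δt : ℝ)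
    (g : ℝ → ℝ) (n : ℕ) (K L : ι) : ℝ :=
  1 / (Δt * 𝒯.area K L) * ∫ t in (n * Δt)..((n + 1) * Δt),
    ∫ x in interface (𝒯.cell K) (𝒯.cell L), g (inner ℝ (v t x) (𝒯.normal K L)) ∂(surface d)

/-- The upwind flux `|σ| (v·n_{K,σ}) f(u_σ)` through `σ = K|L`, where `v·n_{K,σ}` is the mean normal
velocity on `σ` over the time step and `u_σ` is the upstream value: `u_K` if `v·n_{K,σ} ≥ 0` and
`u_L` otherwise. -/
def upwindFlux (v : ℝ → EuclideanSpace ℝ (Fin d) → EuclideanSpace ℝ (Fin d)) (Δt : ℝ)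
    (f : ℝ → ℝ) (n : ℕ) (K L : ι) (uK uL : ℝ) : ℝ :=
  𝒯.area K L * 𝒯.normalMean v Δt id n K L *
    f (if 0 ≤ 𝒯.normalMean v Δt id n K L then uK else uL)

/-- The variant in which upwinding is done pointwise on `σ`:
`|σ| ((v·n_{K,σ})⁺ f(u_K) - (v·n_{K,σ})⁻ f(u_L))`, where `(v·n_{K,σ})^±` are the means of the positive
and negative parts of the normal velocity. -/
def splitUpwindFlux (v : ℝ → EuclideanSpace ℝ (Fin d) → EuclideanSpace ℝ (Fin d)) (Δt : ℝ)
    (f : ℝ → ℝ) (n : ℕ) (K L : ι) (uK uL : ℝ) : ℝ :=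
  𝒯.area K L * (𝒯.normalMean v Δt (fun s => max s 0) n K L * f uK
    - 𝒯.normalMean v Δt (fun s => max (-s) 0) n K L * f uL)

/-- The piecewise constant function equal to `u n K` on `[n Δt, (n+1) Δt) × K`. -/
def approx {Ω : Type*} (Δt : ℝ) (u : ℕ → ι → Ω → ℝ) (t : ℝ) (x : EuclideanSpace ℝ (Fin d))
    (ω : Ω) : ℝ :=
  ∑ᶠ K, (𝒯.cell K).indicator (fun _ => u ⌊t / Δt⌋₊ K ω) x

end AdmissibleMesh

/-- The random variables `u n K` (`n ≤ N`) satisfy the finite volume scheme with numerical flux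
`F n K L (u_K) (u_L)`, initial value `u₀`, time step `Δt` and noise coefficient `η`. -/
structure IsSchemeSolution {Ω E ι : Type*} {mΩ : MeasurableSpace Ω} [MeasurableSpace E] {d : ℕ}
    (P : Measure Ω) (ℱ : Filtration ℝ≥0 mΩ) (m : Measure E) (Nm : Ω → Measure (ℝ × E))
    (𝒯 : AdmissibleMesh d ι) (Δt : ℝ≥0) (N : ℕ) (F : ℕ → ι → ι → ℝ → ℝ → ℝ)
    (η : ℝ → E → ℝ) (u₀ : Ω → Lp ℝ 2 (volume : Measure (EuclideanSpace ℝ (Fin d))))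
    (u : ℕ → ι → Ω → ℝ) : Prop where
  initial : ∀ K, ∀ᵐ ω ∂P, u 0 K ω = 1 / 𝒯.vol K * ∫ x in 𝒯.cell K, u₀ ω x
  step : ∀ n < N, ∀ K, ∃ I : Ω → ℝ,
    IsStochIntegral P ℱ m Nm (n * Δt) ((n + 1) * Δt) (fun ω _ z => η (u n K ω) z) I ∧
    ∀ᵐ ω ∂P, 𝒯.vol K / Δt * (u (n + 1) K ω - u n K ω)
        + ∑ᶠ L ∈ 𝒯.neighbors K, F n K L (u n K ω) (u n L ω)
      = 𝒯.vol K / Δt * I ω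

/-- The divergence of a vector field on `ℝ^d`. -/
def divergence {d : ℕ} (w : EuclideanSpace ℝ (Fin d) → EuclideanSpace ℝ (Fin d))
    (x : EuclideanSpace ℝ (Fin d)) : ℝ :=
  ∑ i, fderiv ℝ w x (EuclideanSpace.single i 1) i

/-- The norm of `L^∞(0,T; L²(Ω × ℝ^d))`, as an extended real. -/
def normLinftyL2 {Ω : Type*} [MeasurableSpace Ω] {d : ℕ} (P : Measure Ω) (T : ℝ)
    (w : ℝ → EuclideanSpace ℝ (Fin d) → Ω → ℝ) : ℝ≥0∞ :=
  essSup (fun t => eLpNorm (fun y : Ω × EuclideanSpace ℝ (Fin d) => w t y.2 y.1) 2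
    (P.prod volume)) (volume.restrict (Set.Ioo 0 T))

end

end UpwindFV

/-!
One step of the scheme is a deterministic transport step followed by the addition of a stochastic
increment. Since `div v = 0`, the divergence theorem on a control volume shows that the fluxes out
of it balance the fluxes into it. The upwind transport step can therefore be written as
`u_K - (Δt / |K|) ∑ b_{KL} (f(u_K) - f(u_L))`, summed over the inflow interfaces with weights
`b_{KL} ≥ 0`. Multiplying by `u_K` produces a telescoping entropy flux and, because `f` is monotone
and `c`-Lipschitz, a dissipation that dominates the square of the flux differences under the CFL
condition; hence the transport step does not increase `∑ |K| u_K²`. The stochastic increment over a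
time step is orthogonal to the past, and by the Itô isometry its second moment is at most
`Δt c_η E[u_K²]`. So `E‖u^{n+1}‖² ≤ (1 + c_η Δt) E‖u^n‖²`, and `(1 + x)ⁿ ≤ e^{nx}` concludes.

The divergence theorem on a polyhedral set is obtained by differentiating the integral over the
translates of the set, whose increments are concentrated on thin prisms over the faces.
-/

namespace UpwindFV

/-! ### Hyperplanes and prisms -/

section Hyperplane

variable {H : Type*} [NormedAddCommGroup H] [InnerProductSpace ℝ H]

/-- The hyperplane `{x | ⟪n, x⟫ = c}`. -/
def hyperplane (n : H) (c : ℝ) : Set H :=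
  {x | inner ℝ n x = c}

theorem mem_hyperplane {n : H} {c : ℝ} {x : H} : x ∈ hyperplane n c ↔ inner ℝ n x = c :=
  Iff.rfl

theorem isClosed_hyperplane (n : H) (c : ℝ) : IsClosed (hyperplane n c) :=
  isClosed_eq (by fun_prop) continuous_const

theorem hyperplane_neg_neg (n : H) (c : ℝ) : hyperplane (-n) (-c) = hyperplane n c := by
  ext x
  simp only [mem_hyperplane, inner_neg_left, neg_inj]

theorem add_smul_mem_hyperplane {n : H} {c : ℝ} {e : H} (he : inner ℝ n e = 0) (r : ℝ) {x : H} :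
    x + r • e ∈ hyperplane n c ↔ x ∈ hyperplane n c := by
  simp only [mem_hyperplane, inner_add_right, inner_smul_right, he, mul_zero, add_zero]

theorem hyperplane_eq_mk' {n p : H} {c : ℝ} (hp : p ∈ hyperplane n c) :
    hyperplane n c = AffineSubspace.mk' p (ℝ ∙ n)ᗮ := by
  ext x
  rw [SetLike.mem_coe, AffineSubspace.mem_mk', Submodule.mem_orthogonal_singleton_iff_inner_right,
    vsub_eq_sub, inner_sub_right, mem_hyperplane.1 hp, sub_eq_zero, mem_hyperplane]

theorem smul_mem_hyperplane {n : H} (hn : n ≠ 0) (c : ℝ) : (c / ‖n‖ ^ 2) • n ∈ hyperplane n c := by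
  rw [mem_hyperplane, inner_smul_right, real_inner_self_eq_norm_sq,
    div_mul_cancel₀ _ (pow_ne_zero 2 (norm_ne_zero_iff.2 hn))]

theorem addHaar_hyperplane [FiniteDimensional ℝ H] [MeasurableSpace H] [BorelSpace H]
    (μ : Measure H) [μ.IsAddHaarMeasure] {n : H} (hn : n ≠ 0) (c : ℝ) :
    μ (hyperplane n c) = 0 := by
  rw [hyperplane_eq_mk' (smul_mem_hyperplane hn c)]
  refine Measure.addHaar_affineSubspace μ _ fun htop => hn ?_
  have hmem : n ∈ (ℝ ∙ n)ᗮ := by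
    rw [← AffineSubspace.direction_mk' ((c / ‖n‖ ^ 2) • n) (ℝ ∙ n)ᗮ, htop,
      AffineSubspace.direction_top]
    exact Submodule.mem_top
  exact inner_self_eq_zero.1 (Submodule.mem_orthogonal_singleton_iff_inner_right.1 hmem)

end Hyperplane

section Prism

variable {H : Type*} [AddCommGroup H] [Module ℝ H]

/-- The prism with base `A` spanned by the vector `e`. -/
def prism (A : Set H) (e : H) : Set H :=
  {x | ∃ y ∈ A, ∃ r ∈ Set.Icc (0 : ℝ) 1, y + r • e = x}

theorem add_smul_mem_prism {A : Set H} {e y : H} (hy : y ∈ A) {r : ℝ} (hr : r ∈ Set.Icc (0 : ℝ) 1) :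
    y + r • e ∈ prism A e :=
  ⟨y, hy, r, hr, rfl⟩

variable [TopologicalSpace H] [ContinuousAdd H] [ContinuousSMul ℝ H]

theorem isCompact_prism {A : Set H} (hA : IsCompact A) (e : H) : IsCompact (prism A e) := by
  have himage : prism A e = (fun p : H × ℝ => p.1 + p.2 • e) '' (A ×ˢ Set.Icc (0 : ℝ) 1) := by
    ext x
    simp only [prism, Set.mem_ofPred_eq, Set.mem_image, Set.mem_prod, Prod.exists, and_assoc,
      exists_and_left]
  rw [himage]
  exact (hA.prod isCompact_Icc).image (by fun_prop)

end Prism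

section Slicing

variable {d : ℕ} {n n' e : EuclideanSpace ℝ (Fin d)}

theorem surface_preimage_add_right (A : Set (EuclideanSpace ℝ (Fin d)))
    (w : EuclideanSpace ℝ (Fin d)) : surface d ((fun y => y + w) ⁻¹' A) = surface d A :=
  measure_preimage_add_right (Measure.euclideanHausdorffMeasure (d - 1)) w A

theorem volume_eq_lintegral_surface_hyperplane (hn : ‖n‖ = 1)
    {B : Set (EuclideanSpace ℝ (Fin d))} (hB : MeasurableSet B) (c : ℝ) :
    volume B = ∫⁻ s : ℝ, surface d (B ∩ hyperplane n (s + c)) := by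
  have hn0 : n ≠ 0 := norm_ne_zero_iff.1 (hn ▸ one_ne_zero)
  have h := EuclideanGeometry.euclideanHausdorffMeasure_eq_lintegral (c • n) hn0 hB
  rw [InnerProductSpace.euclideanHausdorffMeasure_eq_volume, finrank_euclideanSpace_fin,
    ← ofReal_norm, hn, ENNReal.ofReal_one, one_mul] at h
  rw [h]
  refine lintegral_congr fun s => ?_
  rw [hyperplane_eq_mk' (p := s • n +ᵥ c • n), surface]
  simp only [mem_hyperplane, vadd_eq_add, inner_add_right, inner_smul_right,
    real_inner_self_eq_norm_sq, hn, one_pow, mul_one]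

theorem lintegral_comp_inv_mul {a : ℝ} (ha : a ≠ 0) (φ : ℝ → ℝ≥0∞) :
    ∫⁻ s, φ (a⁻¹ * s) = ENNReal.ofReal |a| * ∫⁻ r, φ r := by
  let Φ : ℝ ≃ᵐ ℝ := (Homeomorph.mulLeft₀ _ (inv_ne_zero ha)).toMeasurableEquiv
  have hΦ : Measure.map Φ volume = ENNReal.ofReal |a| • (volume : Measure ℝ) := by
    have hcoe : (Φ : ℝ → ℝ) = (a⁻¹ * ·) := rfl
    rw [hcoe, Real.map_volume_mul_left (inv_ne_zero ha), inv_inv]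
  rw [← smul_eq_mul, ← lintegral_smul_measure, ← hΦ, lintegral_map_equiv]
  rfl

/-- Unlike the coarea formula for the unit normal, the slices are pushed back to one hyperplane
along a direction `e` which need not be orthogonal to it. -/
theorem volume_eq_lintegral_slice (hn : ‖n‖ = 1) (c : ℝ) (he : inner ℝ n e ≠ 0)
    {B : Set (EuclideanSpace ℝ (Fin d))} (hB : MeasurableSet B) :
    volume B = ENNReal.ofReal |inner ℝ n e| *
      ∫⁻ r : ℝ, surface d (hyperplane n c ∩ {y | y + r • e ∈ B}) := by
  rw [← lintegral_comp_inv_mul he, volume_eq_lintegral_surface_hyperplane hn hB c]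
  refine lintegral_congr fun s => ?_
  rw [← surface_preimage_add_right _ (((inner ℝ n e)⁻¹ * s) • e)]
  congr 1
  ext y
  have hs : (inner ℝ n e)⁻¹ * s * inner ℝ n e = s := by field_simp
  simp only [Set.mem_preimage, Set.mem_inter_iff, mem_hyperplane, Set.mem_ofPred_eq,
    inner_add_right, inner_smul_right, hs, and_comm (b := y + _ ∈ B)]
  exact and_congr_right' ⟨fun h => by linarith, fun h => by linarith⟩

/-- A direction in the second hyperplane that is transversal to the first one makes the intersection
a slice, of constant measure, of the second hyperplane, which is Lebesgue null. -/
theorem surface_hyperplane_inter_hyperplane (hn : ‖n‖ = 1) (hn' : ‖n'‖ = 1) (hne : n ≠ n')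
    (hne_neg : n ≠ -n') (c c' : ℝ) :
    surface d (hyperplane n c ∩ hyperplane n' c') = 0 := by
  have hn'0 : n' ≠ 0 := norm_ne_zero_iff.1 (hn' ▸ one_ne_zero)
  set a := inner ℝ n n' with ha
  have hn'e : inner ℝ n' (n - a • n') = 0 := by
    rw [inner_sub_right, inner_smul_right, real_inner_self_eq_norm_sq, hn', real_inner_comm, ha]
    ring
  have hcos : inner ℝ n (n - a • n') = 1 - a ^ 2 := by
    rw [inner_sub_right, inner_smul_right, real_inner_self_eq_norm_sq, hn, ← ha]
    ring
  have ha_one : a ≠ 1 := fun h => hne ((inner_eq_one_iff_of_norm_eq_one (𝕜 := ℝ) hn hn').1 h)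
  have ha_neg : a ≠ -1 := fun h => hne_neg ((inner_eq_one_iff_of_norm_eq_one (𝕜 := ℝ) hn
    (by rwa [norm_neg])).1 (by rw [inner_neg_right, ← ha, h, neg_neg]))
  have htrans : inner ℝ n (n - a • n') ≠ 0 := by
    rw [hcos, sub_ne_zero]
    exact (sq_ne_one_iff.2 ⟨ha_one, ha_neg⟩).symm
  have hslice := volume_eq_lintegral_slice hn c htrans (isClosed_hyperplane n' c').measurableSet
  simp only [add_smul_mem_hyperplane hn'e, Set.ofPred_mem_eq, lintegral_const, Real.volume_univ,
    addHaar_hyperplane volume hn'0] at hslice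
  simpa [htrans] using hslice.symm

theorem hyperplane_inter_add_smul_mem_inter_prism {c : ℝ} (he : inner ℝ n e ≠ 0)
    {A B : Set (EuclideanSpace ℝ (Fin d))} (hAH : A ⊆ hyperplane n c) (r : ℝ) :
    hyperplane n c ∩ {y | y + r • e ∈ B ∩ prism A e} =
      {y | r ∈ Set.Icc (0 : ℝ) 1 ∧ y ∈ A ∧ y + r • e ∈ B} := by
  ext y
  constructor
  · rintro ⟨hy, hyB, y', hy', r', hr', hyy'⟩
    have hinner : inner ℝ n (y' + r' • e) = inner ℝ n (y + r • e) := by rw [hyy']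
    simp only [inner_add_right, inner_smul_right, mem_hyperplane.1 (hAH hy'),
      mem_hyperplane.1 hy] at hinner
    obtain rfl : r' = r := mul_right_cancel₀ he (by linarith)
    obtain rfl : y' = y := by simpa using hyy'
    exact ⟨hr', hy', hyB⟩
  · rintro ⟨hr, hy, hyB⟩
    exact ⟨hAH hy, hyB, add_smul_mem_prism hy hr⟩

theorem volume_restrict_prism (hn : ‖n‖ = 1) {c : ℝ} (he : inner ℝ n e ≠ 0)
    {A : Set (EuclideanSpace ℝ (Fin d))} (hA : IsCompact A) (hAH : A ⊆ hyperplane n c)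
    (hAfin : surface d A ≠ ∞) :
    volume.restrict (prism A e) = ENNReal.ofReal |inner ℝ n e| •
      Measure.map (fun p : EuclideanSpace ℝ (Fin d) × ℝ => p.1 + p.2 • e)
        (((surface d).restrict A).prod (volume.restrict (Set.Icc (0 : ℝ) 1))) := by
  have : IsFiniteMeasure ((surface d).restrict A) := ⟨by simpa using hAfin.lt_top⟩
  have hΦ : Measurable fun p : EuclideanSpace ℝ (Fin d) × ℝ => p.1 + p.2 • e := by fun_prop
  ext B hB
  rw [Measure.restrict_apply hB, Measure.smul_apply, Measure.map_apply hΦ hB,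
    Measure.prod_apply_symm (hΦ hB), smul_eq_mul,
    volume_eq_lintegral_slice hn c he (hB.inter (isCompact_prism hA e).measurableSet),
    ← lintegral_indicator measurableSet_Icc]
  congr 1
  refine lintegral_congr fun r => ?_
  rw [hyperplane_inter_add_smul_mem_inter_prism he hAH]
  by_cases hr : r ∈ Set.Icc (0 : ℝ) 1
  · rw [Set.indicator_of_mem hr, Measure.restrict_apply (by exact hB.preimage (by fun_prop))]
    congr 1
    ext y
    simp only [hr, true_and, Set.mem_ofPred_eq, Set.mem_inter_iff, Set.mem_preimage, and_comm]
  · rw [Set.indicator_of_notMem hr]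
    simp only [hr, false_and, Set.ofPred_false, measure_empty]

theorem volume_prism_eq_zero {c : ℝ} (hn : n ≠ 0) (he : inner ℝ n e = 0)
    {A : Set (EuclideanSpace ℝ (Fin d))} (hAH : A ⊆ hyperplane n c) : volume (prism A e) = 0 := by
  refine measure_mono_null ?_ (addHaar_hyperplane volume hn c)
  rintro x ⟨y, hy, r, -, rfl⟩
  exact (add_smul_mem_hyperplane he r).2 (hAH hy)

end Slicing

/-! ### The divergence theorem on polyhedra -/

section Jump

variable {H : Type*} [NormedAddCommGroup H] [InnerProductSpace ℝ H] {O : Set H} {n y w : H}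

/-- The open half-space into which `n` points from `y`. -/
def halfSpace (n y : H) : Set H :=
  {x | 0 < inner ℝ n (x - y)}

open Classical in
/-- The value at `y` of the indicator function of `O`, seen from the side into which `n` points.
It is meaningful where `O` is, near `y`, either all or nothing of that side. -/
noncomputable def sideTrace (O : Set H) (n y : H) : ℝ :=
  if ∀ᶠ x in 𝓝[halfSpace n y] y, x ∈ O then 1 else 0

/-- The jump at `y` of the indicator function of `O` against the direction `n`: it is `1` where `n`
is an outward normal, `-1` where `n` is an inward normal. -/
noncomputable def jump (O : Set H) (n y : H) : ℝ :=
  sideTrace O (-n) y - sideTrace O n y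

theorem jump_neg (O : Set H) (n y : H) : jump O (-n) y = -jump O n y := by
  rw [jump, jump, neg_neg, neg_sub]

theorem sideTrace_eq_one (h : ∀ᶠ x in 𝓝[halfSpace n y] y, x ∈ O) : sideTrace O n y = 1 :=
  if_pos h

theorem tendsto_add_smul_nhdsWithin_halfSpace (hw : 0 < inner ℝ n w) :
    Tendsto (fun ε : ℝ => y + ε • w) (𝓝[>] 0) (𝓝[halfSpace n y] y) := by
  refine tendsto_nhdsWithin_iff.2 ⟨?_, ?_⟩
  · have hcont : Continuous fun ε : ℝ => y + ε • w := by fun_prop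
    simpa using (hcont.tendsto 0).mono_left nhdsWithin_le_nhds
  · filter_upwards [self_mem_nhdsWithin] with ε hε
    simpa [halfSpace, inner_smul_right] using mul_pos hε hw

theorem tendsto_sub_smul_nhdsWithin_halfSpace (hw : 0 < inner ℝ n w) :
    Tendsto (fun ε : ℝ => y - ε • w) (𝓝[>] 0) (𝓝[halfSpace (-n) y] y) := by
  simpa [sub_eq_add_neg] using
    tendsto_add_smul_nhdsWithin_halfSpace (n := -n) (y := y) (w := -w) (by simpa using hw)

theorem nhdsWithin_halfSpace_neBot (hn : n ≠ 0) : (𝓝[halfSpace n y] y).NeBot :=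
  (tendsto_add_smul_nhdsWithin_halfSpace (real_inner_self_pos.2 hn)).neBot

theorem sideTrace_eq_zero (hn : n ≠ 0) (h : ∀ᶠ x in 𝓝[halfSpace n y] y, x ∉ O) :
    sideTrace O n y = 0 := by
  have := nhdsWithin_halfSpace_neBot (y := y) hn
  refine if_neg fun hO => ?_
  obtain ⟨x, hx, hxO⟩ := (h.and hO).exists
  exact hx hxO

theorem subset_interior_or_subset_compl_closure {X : Type*} [TopologicalSpace X] {s O : Set X}
    (hs : IsPreconnected s) (h : Disjoint s (frontier O)) :
    s ⊆ interior O ∨ s ⊆ (closure O)ᶜ := by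
  refine hs.subset_or_subset isOpen_interior isClosed_closure.isOpen_compl ?_ ?_
  · exact Set.disjoint_compl_right_iff_subset.2 interior_subset_closure
  · intro x hx
    by_contra hcon
    simp only [Set.mem_union, Set.mem_compl_iff, not_or, not_not] at hcon
    exact Set.disjoint_left.1 h hx ⟨hcon.2, hcon.1⟩

theorem eventually_mem_interior_or_eventually_notMem_closure
    (hflat : ∀ᶠ x in 𝓝 y, x ∈ frontier O → inner ℝ n (x - y) = 0) :
    (∀ᶠ x in 𝓝[halfSpace n y] y, x ∈ interior O) ∨
      ∀ᶠ x in 𝓝[halfSpace n y] y, x ∉ closure O := by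
  obtain ⟨δ, hδ, hball⟩ := Metric.eventually_nhds_iff_ball.1 hflat
  have hconvex : Convex ℝ (halfSpace n y ∩ Metric.ball y δ) := by
    refine Convex.inter ?_ (convex_ball y δ)
    simp only [halfSpace, inner_sub_right, sub_pos]
    exact convex_halfSpace_gt (innerSL ℝ n).toLinearMap.isLinear (inner ℝ n y)
  have hdisj : Disjoint (halfSpace n y ∩ Metric.ball y δ) (frontier O) :=
    Set.disjoint_left.2 fun x hx hxO => hx.1.ne' (hball x hx.2 hxO)
  have hmem : halfSpace n y ∩ Metric.ball y δ ∈ 𝓝[halfSpace n y] y :=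
    inter_mem_nhdsWithin _ (Metric.ball_mem_nhds y hδ)
  exact (subset_interior_or_subset_compl_closure hconvex.isPreconnected hdisj).imp
    (mem_of_superset hmem) (mem_of_superset hmem)

theorem eventually_indicator_eq_sideTrace
    (hflat : ∀ᶠ x in 𝓝 y, x ∈ frontier O → inner ℝ n (x - y) = 0) :
    ∀ᶠ x in 𝓝[halfSpace n y] y, O.indicator (1 : H → ℝ) x = sideTrace O n y := by
  by_cases hO : ∀ᶠ x in 𝓝[halfSpace n y] y, x ∈ O
  · filter_upwards [hO] with x hx
    rw [sideTrace, if_pos hO, Set.indicator_of_mem hx, Pi.one_apply]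
  · have hout := (eventually_mem_interior_or_eventually_notMem_closure hflat).resolve_left
      fun h => hO (h.mono fun _ hx => interior_subset hx)
    filter_upwards [hout] with x hx
    rw [sideTrace, if_neg hO, Set.indicator_of_notMem fun h => hx (subset_closure h)]

theorem jump_eq_one (hn : n ≠ 0)
    (hflat : ∀ᶠ x in 𝓝 y, x ∈ frontier O → inner ℝ n (x - y) = 0)
    (hout : ∀ᶠ ε : ℝ in 𝓝[>] 0, y - ε • n ∈ closure O ∧ y + ε • n ∉ interior O) :
    jump O n y = 1 := by
  have hnn : 0 < inner ℝ n n := real_inner_self_pos.2 hn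
  have hbehind : ∀ᶠ x in 𝓝[halfSpace (-n) y] y, x ∈ interior O := by
    refine (eventually_mem_interior_or_eventually_notMem_closure
      (by simpa using hflat)).resolve_right fun h => ?_
    obtain ⟨ε, hε, hεO⟩ :=
      (((tendsto_sub_smul_nhdsWithin_halfSpace hnn).eventually h).and hout).exists
    exact hε hεO.1
  have hahead : ∀ᶠ x in 𝓝[halfSpace n y] y, x ∉ closure O := by
    refine (eventually_mem_interior_or_eventually_notMem_closure hflat).resolve_left fun h => ?_
    obtain ⟨ε, hε, hεO⟩ :=
      (((tendsto_add_smul_nhdsWithin_halfSpace hnn).eventually h).and hout).exists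
    exact hεO.2 hε
  rw [jump, sideTrace_eq_one (hbehind.mono fun _ hx => interior_subset hx),
    sideTrace_eq_zero hn (hahead.mono fun _ hx => notMem_of_notMem_closure hx), sub_zero]

theorem sideTrace_eq_one_of_mem_interior_closure (hn : n ≠ 0)
    (hflat : ∀ᶠ x in 𝓝 y, x ∈ frontier O → inner ℝ n (x - y) = 0)
    (hy : y ∈ interior (closure O)) : sideTrace O n y = 1 := by
  have := nhdsWithin_halfSpace_neBot (y := y) hn
  have hclosure : ∀ᶠ x in 𝓝[halfSpace n y] y, x ∈ closure O :=
    nhdsWithin_le_nhds (mem_interior_iff_mem_nhds.1 hy)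
  refine sideTrace_eq_one (((eventually_mem_interior_or_eventually_notMem_closure
    hflat).resolve_right fun h => ?_).mono fun _ hx => interior_subset hx)
  obtain ⟨x, hx, hxO⟩ := (h.and hclosure).exists
  exact hx hxO

theorem jump_eq_zero_of_mem_interior_closure (hn : n ≠ 0)
    (hflat : ∀ᶠ x in 𝓝 y, x ∈ frontier O → inner ℝ n (x - y) = 0)
    (hy : y ∈ interior (closure O)) : jump O n y = 0 := by
  rw [jump, sideTrace_eq_one_of_mem_interior_closure hn hflat hy,
    sideTrace_eq_one_of_mem_interior_closure (neg_ne_zero.2 hn) (by simpa using hflat) hy, sub_self]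

end Jump

section Translate

variable {E : Type*} [NormedAddCommGroup E] [ProperSpace E] [MeasurableSpace E] [BorelSpace E]
  (μ : Measure E) [IsFiniteMeasureOnCompacts μ] {O : Set E} {g : E → ℝ}

theorem setIntegral_comp_add_sub_setIntegral [μ.IsAddRightInvariant] (hO : MeasurableSet O)
    (hOb : Bornology.IsBounded O) (hg : Continuous g) (v : E) :
    ∫ x in O, g (x + v) ∂μ - ∫ x in O, g x ∂μ =
      ∫ x, g x * (O.indicator 1 (x - v) - O.indicator 1 x) ∂μ := by
  have hint : ∀ w : E, Integrable (O.indicator fun x => g (x + w)) μ := fun w =>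
    (integrable_indicator_iff hO).2 (((hg.comp (by fun_prop)).continuousOn.integrableOn_compact
      hOb.isCompact_closure).mono_set subset_closure)
  have hshift : (fun x => g x * O.indicator 1 (x - v)) =
      fun x => O.indicator (fun x => g (x + v)) (x - v) := by
    ext x
    by_cases hx : x - v ∈ O <;> simp [hx]
  have hself : (fun x => g x * O.indicator 1 x) = O.indicator fun x => g (x + 0) := by
    ext x
    by_cases hx : x ∈ O <;> simp [hx]
  have hint_shift : Integrable (fun x => g x * O.indicator 1 (x - v)) μ :=
    hshift ▸ (hint v).comp_sub_right v
  have hint_self : Integrable (fun x => g x * O.indicator 1 x) μ := hself ▸ hint 0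
  simp only [mul_sub]
  rw [integral_sub hint_shift hint_self, hshift, hself, integral_sub_right_eq_self
    (O.indicator fun x => g (x + v)) v, integral_indicator hO, integral_indicator hO]
  simp only [add_zero]

variable [NormedSpace ℝ E]

theorem hasDerivAt_setIntegral_comp_add_smul (hO : MeasurableSet O) (hOb : Bornology.IsBounded O)
    (hg : ContDiff ℝ 1 g) (e : E) :
    HasDerivAt (fun t : ℝ => ∫ x in O, g (x + t • e) ∂μ) (∫ x in O, fderiv ℝ g x e ∂μ) 0 := by
  have hOfin : μ O ≠ ∞ := hOb.measure_lt_top.ne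
  have hderiv_cont : Continuous fun x => fderiv ℝ g x e :=
    (hg.continuous_fderiv one_ne_zero).clm_apply continuous_const
  have hcompact : IsCompact (Metric.cthickening ‖e‖ (closure O)) :=
    hOb.isCompact_closure.cthickening
  have hmem : ∀ x ∈ O, ∀ t ∈ Metric.ball (0 : ℝ) 1,
      x + t • e ∈ Metric.cthickening ‖e‖ (closure O) := by
    intro x hx t ht
    refine Metric.mem_cthickening_of_dist_le _ x _ _ (subset_closure hx) ?_
    rw [dist_eq_norm, add_sub_cancel_left, norm_smul]
    exact mul_le_of_le_one_left (norm_nonneg _) (mem_ball_zero_iff.1 ht).le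
  obtain ⟨M, hM⟩ := hcompact.exists_bound_of_continuousOn hderiv_cont.continuousOn
  have hint : IntegrableOn (fun x => g (x + (0 : ℝ) • e)) O μ := by
    simp only [zero_smul, add_zero]
    exact (hg.continuous.continuousOn.integrableOn_compact hOb.isCompact_closure).mono_set
      subset_closure
  have h := (hasDerivAt_integral_of_dominated_loc_of_deriv_le (𝕜 := ℝ) (μ := μ.restrict O)
    (F := fun t x => g (x + t • e)) (F' := fun t x => fderiv ℝ g (x + t • e) e)
    (bound := fun _ => M) (Metric.ball_mem_nhds (0 : ℝ) one_pos)
    (.of_forall fun t => (hg.continuous.comp (by fun_prop)).aestronglyMeasurable) hint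
    (hderiv_cont.comp (by fun_prop)).aestronglyMeasurable
    ((ae_restrict_iff' hO).2 (.of_forall fun x hx t ht => hM _ (hmem x hx t ht)))
    (integrableOn_const hOfin) (.of_forall fun x t _ => ?_)).2
  · simpa only [zero_smul, add_zero] using h
  · have hline : HasDerivAt (fun t : ℝ => x + t • e) e t := by
      simpa using ((hasDerivAt_id t).smul_const e).const_add x
    exact (hg.differentiable one_ne_zero _).hasFDerivAt.comp_hasDerivAt t hline

theorem tendsto_integral_mul_indicator_sub [μ.IsAddRightInvariant] (hO : MeasurableSet O)
    (hOb : Bornology.IsBounded O) (hg : ContDiff ℝ 1 g) (e : E) :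
    Tendsto (fun t : ℝ =>
      t⁻¹ * ∫ x, g x * (O.indicator 1 (x - t • e) - O.indicator 1 x) ∂μ)
      (𝓝[>] 0) (𝓝 (∫ x in O, fderiv ℝ g x e ∂μ)) := by
  have h := (hasDerivAt_setIntegral_comp_add_smul μ hO hOb hg e).tendsto_slope_zero_right
  simpa only [zero_add, zero_smul, add_zero, smul_eq_mul,
    setIntegral_comp_add_sub_setIntegral μ hO hOb hg.continuous] using h

end Translate

section PrismCover

variable {H : Type*} [AddCommGroup H] [Module ℝ H] {κ : Type*} {O : Set H} {A : κ → Set H}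
  {e x y : H}

section Count

variable [Fintype κ]

/-- The number of prisms spanned by `e` over the members of the family `A` which contain `x`. -/
noncomputable def prismCount (A : κ → Set H) (e x : H) : ℝ :=
  ∑ i, (prism (A i) e).indicator 1 x

/-- The increment `1_O(x - e) - 1_O(x)`, weighted by `g` and shared between the prisms that contain
`x`, so that its integrals over the prisms add up to the whole. -/
noncomputable def sharedIncrement (O : Set H) (A : κ → Set H) (g : H → ℝ) (e x : H) : ℝ :=
  g x * ((O.indicator 1 (x - e) - O.indicator 1 x) / prismCount A e x)

theorem one_le_prismCount {i : κ} (hx : x ∈ prism (A i) e) : 1 ≤ prismCount A e x := by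
  have hle := Finset.single_le_sum (f := fun i => (prism (A i) e).indicator (1 : H → ℝ) x)
    (fun _ _ => Set.indicator_nonneg (fun _ _ => zero_le_one) x) (Finset.mem_univ i)
  rwa [Set.indicator_of_mem hx, Pi.one_apply] at hle

theorem prismCount_eq_one {i : κ} (hx : x ∈ prism (A i) e)
    (hne : ∀ j ≠ i, x ∉ prism (A j) e) : prismCount A e x = 1 := by
  rw [prismCount, Finset.sum_eq_single i (fun j _ hj => Set.indicator_of_notMem (hne j hj) _)
    (fun h => absurd (Finset.mem_univ i) h), Set.indicator_of_mem hx, Pi.one_apply]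

theorem abs_sharedIncrement_le (g : H → ℝ) {i : κ} (hx : x ∈ prism (A i) e) :
    |sharedIncrement O A g e x| ≤ |g x| := by
  have hcount := one_le_prismCount hx
  rw [sharedIncrement, abs_mul, abs_div, abs_of_pos (zero_lt_one.trans_le hcount)]
  refine mul_le_of_le_one_right (abs_nonneg _) ((div_le_one (by linarith)).2 (le_trans ?_ hcount))
  by_cases h₁ : x - e ∈ O <;> by_cases h₂ : x ∈ O <;> simp [h₁, h₂]

end Count

variable [TopologicalSpace H] [ContinuousAdd H] [ContinuousSMul ℝ H]

theorem segment_inter_frontier_nonempty (hx : ¬(y ∈ O ↔ x ∈ O)) :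
    (segment ℝ y x ∩ frontier O).Nonempty := by
  rw [← Set.not_disjoint_iff_nonempty_inter]
  intro hdisj
  rcases subset_interior_or_subset_compl_closure (convex_segment y x).isPreconnected hdisj with
    hin | hout
  · exact hx (iff_of_true (interior_subset (hin (left_mem_segment ℝ _ _)))
      (interior_subset (hin (right_mem_segment ℝ _ _))))
  · exact hx (iff_of_false (fun h => hout (left_mem_segment ℝ _ _) (subset_closure h))
      (fun h => hout (right_mem_segment ℝ _ _) (subset_closure h)))

theorem exists_mem_prism (hO : frontier O ⊆ ⋃ i, A i) (hx : ¬(x - e ∈ O ↔ x ∈ O)) :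
    ∃ i, x ∈ prism (A i) e := by
  obtain ⟨y, hy, hyO⟩ := segment_inter_frontier_nonempty hx
  rw [segment_symm, segment_eq_image'] at hy
  obtain ⟨r, hr, rfl⟩ := hy
  obtain ⟨i, hi⟩ := Set.mem_iUnion.1 (hO hyO)
  exact ⟨i, _, hi, r, hr, by module⟩

theorem eventually_notMem_prism {B : Set H} (hB : IsClosed B) (hy : y ∉ B) {r : ℝ}
    (hr : r ∈ Set.Icc (0 : ℝ) 1) : ∀ᶠ t in 𝓝 (0 : ℝ), y + r • t • e ∉ prism B (t • e) := by
  have hcont : Continuous fun u : ℝ => y + u • e := by fun_prop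
  have hline : ∀ᶠ u in 𝓝 (0 : ℝ), y + u • e ∉ B :=
    (hcont.tendsto 0).eventually (hB.isOpen_compl.mem_nhds (by simpa using hy))
  obtain ⟨δ, hδ, hball⟩ := Metric.eventually_nhds_iff_ball.1 hline
  filter_upwards [Metric.ball_mem_nhds (0 : ℝ) hδ] with t ht
  rintro ⟨y', hy', s, hs, heq⟩
  obtain rfl : y' = y + ((r - s) * t) • e := by
    rw [eq_sub_of_add_eq heq]
    module
  refine hball _ (mem_ball_zero_iff.2 ?_) hy'
  rw [norm_mul]
  refine (mul_le_of_le_one_left (norm_nonneg t) ?_).trans_lt (mem_ball_zero_iff.1 ht)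
  rw [Real.norm_eq_abs, abs_le]
  constructor <;> linarith [hr.1, hr.2, hs.1, hs.2]

theorem sum_indicator_prism_sharedIncrement [Fintype κ] (hO : frontier O ⊆ ⋃ i, A i)
    (g : H → ℝ) (e x : H) :
    ∑ i, (prism (A i) e).indicator (sharedIncrement O A g e) x =
      g x * (O.indicator 1 (x - e) - O.indicator 1 x) := by
  have hmul : ∀ i, (prism (A i) e).indicator (sharedIncrement O A g e) x =
      sharedIncrement O A g e x * (prism (A i) e).indicator 1 x := fun i => by
    by_cases hx : x ∈ prism (A i) e <;> simp [hx]
  simp only [hmul, ← Finset.mul_sum]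
  by_cases hx : x - e ∈ O ↔ x ∈ O
  · by_cases hxO : x ∈ O
    · simp [sharedIncrement, hxO, hx.2 hxO]
    · simp [sharedIncrement, hxO, mt hx.1 hxO]
  · obtain ⟨i, hi⟩ := exists_mem_prism hO hx
    have hcount : prismCount A e x ≠ 0 := (zero_lt_one.trans_le (one_le_prismCount hi)).ne'
    rw [← prismCount, sharedIncrement, mul_assoc, div_mul_cancel₀ _ hcount]

end PrismCover

section SharedIncrement

variable {H : Type*} [NormedAddCommGroup H] [InnerProductSpace ℝ H] {κ : Type*} [Fintype κ]
  {O : Set H} {A : κ → Set H} {g : H → ℝ} {n e y : H}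

theorem tendsto_sharedIncrement (hA : ∀ j, IsClosed (A j)) (hg : Continuous g)
    (he : 0 < inner ℝ n e) {i : κ} (hyA : y ∈ A i) (hy_ne : ∀ j ≠ i, y ∉ A j)
    (hflat : ∀ᶠ x in 𝓝 y, x ∈ frontier O → inner ℝ n (x - y) = 0) {r : ℝ}
    (hr : r ∈ Set.Ioo (0 : ℝ) 1) :
    Tendsto (fun t : ℝ => sharedIncrement O A g (t • e) (y + r • t • e)) (𝓝[>] 0)
      (𝓝 (g y * jump O n y)) := by
  have hcont : Continuous fun t : ℝ => g (y + r • t • e) := by fun_prop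
  have hlim : Tendsto (fun t : ℝ => g (y + r • t • e) * jump O n y) (𝓝[>] 0)
      (𝓝 (g y * jump O n y)) := by
    simpa using ((hcont.tendsto 0).mono_left nhdsWithin_le_nhds).mul_const (jump O n y)
  have hscale : ∀ {q : ℝ}, 0 < q → Tendsto (q * ·) (𝓝[>] (0 : ℝ)) (𝓝[>] 0) := fun hq =>
    tendsto_iff_eventually.2 fun _ h => eventually_nhdsGT_zero_mul_left hq h
  have hahead := ((tendsto_add_smul_nhdsWithin_halfSpace he).comp (hscale hr.1)).eventually
    (eventually_indicator_eq_sideTrace hflat)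
  have hbehind := ((tendsto_sub_smul_nhdsWithin_halfSpace he).comp
    (hscale (sub_pos.2 hr.2))).eventually
    (eventually_indicator_eq_sideTrace (n := -n) (by simpa using hflat))
  have hother : ∀ᶠ t in 𝓝[>] (0 : ℝ), ∀ j ≠ i, y + r • t • e ∉ prism (A j) (t • e) :=
    eventually_all.2 fun j => eventually_imp_distrib_left.2 fun hj =>
      (eventually_notMem_prism (hA j) (hy_ne j hj) ⟨hr.1.le, hr.2.le⟩).filter_mono
        nhdsWithin_le_nhds
  refine hlim.congr' ?_
  filter_upwards [hahead, hbehind, hother] with t hahead hbehind hother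
  have hshift : y + r • t • e - t • e = y - ((1 - r) * t) • e := by module
  rw [sharedIncrement, prismCount_eq_one (add_smul_mem_prism hyA ⟨hr.1.le, hr.2.le⟩) hother,
    div_one, hshift, smul_smul, jump]
  exact congrArg _ (congrArg₂ _ hbehind hahead).symm

end SharedIncrement

section SharedIncrementIntegral

variable {H : Type*} [NormedAddCommGroup H] [NormedSpace ℝ H] [MeasurableSpace H] [BorelSpace H]
  {κ : Type*} [Fintype κ] {O : Set H} {A : κ → Set H} {g : H → ℝ}

theorem measurable_sharedIncrement (hO : MeasurableSet O) (hA : ∀ i, IsCompact (A i))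
    (hg : Continuous g) (e : H) : Measurable (sharedIncrement O A g e) := by
  have hone : Measurable (O.indicator (1 : H → ℝ)) := measurable_one.indicator hO
  have hcount : Measurable (prismCount A e) := Finset.measurable_sum _ fun i _ =>
    measurable_one.indicator (isCompact_prism (hA i) e).measurableSet
  exact hg.measurable.mul (((hone.comp (by fun_prop)).sub hone).div hcount)

theorem sum_integral_prism_sharedIncrement (μ : Measure H) [IsFiniteMeasureOnCompacts μ]
    (hO : MeasurableSet O) (hA : ∀ i, IsCompact (A i)) (hOA : frontier O ⊆ ⋃ i, A i)
    (hg : Continuous g) (e : H) :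
    ∑ i, ∫ x in prism (A i) e, sharedIncrement O A g e x ∂μ =
      ∫ x, g x * (O.indicator 1 (x - e) - O.indicator 1 x) ∂μ := by
  have hprism : ∀ i, IsCompact (prism (A i) e) := fun i => isCompact_prism (hA i) e
  have hint : ∀ i, IntegrableOn (sharedIncrement O A g e) (prism (A i) e) μ := fun i =>
    Integrable.mono (hg.continuousOn.integrableOn_compact (hprism i))
      (measurable_sharedIncrement hO hA hg e).aestronglyMeasurable
      ((ae_restrict_iff' (hprism i).measurableSet).2
        (.of_forall fun _ hx => abs_sharedIncrement_le g hx))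
  simp only [← sum_indicator_prism_sharedIncrement hOA, ← integral_indicator
    (hprism _).measurableSet]
  exact (integral_finsetSum _ fun i _ =>
    (integrable_indicator_iff (hprism i).measurableSet).2 (hint i)).symm

end SharedIncrementIntegral

section Divergence

variable {d : ℕ} {κ : Type*} {O : Set (EuclideanSpace ℝ (Fin d))}

theorem ae_notMem_hyperplane {n : κ → EuclideanSpace ℝ (Fin d)} {c : κ → ℝ}
    [Countable κ]
    (hdisj : Pairwise (Function.onFun (AEDisjoint (surface d)) fun i => hyperplane (n i) (c i)))
    (i : κ) :
    ∀ᵐ y ∂surface d, y ∈ hyperplane (n i) (c i) → ∀ j ≠ i, y ∉ hyperplane (n j) (c j) := by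
  have hpair : ∀ j, j ≠ i → ∀ᵐ y ∂surface d,
      y ∉ hyperplane (n i) (c i) ∩ hyperplane (n j) (c j) := fun j hj =>
    measure_eq_zero_iff_ae_notMem.1 (hdisj hj.symm)
  filter_upwards [ae_all_iff.2 fun j => eventually_imp_distrib_left.2 (hpair j)] with y hy hyi j hj
  exact fun hyj => hy j hj ⟨hyi, hyj⟩

theorem eventually_frontier_inner_eq_zero {n : κ → EuclideanSpace ℝ (Fin d)} {c : κ → ℝ}
    [Finite κ]
    (hfr : frontier O ⊆ ⋃ i, hyperplane (n i) (c i)) {i : κ} {y : EuclideanSpace ℝ (Fin d)}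
    (hy : y ∈ hyperplane (n i) (c i)) (hne : ∀ j ≠ i, y ∉ hyperplane (n j) (c j)) :
    ∀ᶠ x in 𝓝 y, x ∈ frontier O → inner ℝ (n i) (x - y) = 0 := by
  have hoff : ∀ᶠ x in 𝓝 y, ∀ j ≠ i, x ∉ hyperplane (n j) (c j) :=
    eventually_all.2 fun j => eventually_imp_distrib_left.2 fun hj =>
      (isClosed_hyperplane _ _).isOpen_compl.mem_nhds (hne j hj)
  filter_upwards [hoff] with x hx hxO
  obtain ⟨j, hj⟩ := Set.mem_iUnion.1 (hfr hxO)
  obtain rfl : j = i := by_contra fun hji => hx j hji hj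
  rw [inner_sub_right, mem_hyperplane.1 hj, mem_hyperplane.1 hy, sub_self]

variable [Fintype κ] {g : EuclideanSpace ℝ (Fin d) → ℝ}

theorem inv_mul_integral_prism {n e : EuclideanSpace ℝ (Fin d)} (hn : ‖n‖ = 1) {c : ℝ}
    (he : 0 < inner ℝ n e) {A : Set (EuclideanSpace ℝ (Fin d))} (hA : IsCompact A)
    (hAH : A ⊆ hyperplane n c) (hAfin : surface d A ≠ ∞) {t : ℝ} (ht : 0 < t)
    {F : EuclideanSpace ℝ (Fin d) → ℝ} (hF : Measurable F) :
    t⁻¹ * ∫ x in prism A (t • e), F x = ∫ p : EuclideanSpace ℝ (Fin d) × ℝ,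
      inner ℝ n e * F (p.1 + p.2 • t • e)
        ∂((surface d).restrict A).prod (volume.restrict (Set.Icc 0 1)) := by
  have hte : 0 < inner ℝ n (t • e) := by
    rw [inner_smul_right]
    exact mul_pos ht he
  rw [volume_restrict_prism hn hte.ne' hA hAH hAfin, integral_smul_measure,
    integral_map (by fun_prop) hF.aestronglyMeasurable, integral_const_mul,
    ENNReal.toReal_ofReal (abs_nonneg _), abs_of_pos hte, inner_smul_right, smul_eq_mul,
    mul_assoc, inv_mul_cancel_left₀ ht.ne']

theorem tendsto_integral_prism_sharedIncrement {n e : EuclideanSpace ℝ (Fin d)} (hn : ‖n‖ = 1)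
    {c : ℝ} (he : 0 < inner ℝ n e) {A : κ → Set (EuclideanSpace ℝ (Fin d))}
    (hA : ∀ j, IsCompact (A j)) (hO : MeasurableSet O) (hg : Continuous g) {i : κ}
    (hAH : A i ⊆ hyperplane n c) (hAfin : surface d (A i) ≠ ∞)
    (hgood : ∀ᵐ y ∂(surface d).restrict (A i), (∀ j ≠ i, y ∉ A j) ∧
      ∀ᶠ x in 𝓝 y, x ∈ frontier O → inner ℝ n (x - y) = 0) :
    Tendsto (fun t : ℝ => t⁻¹ * ∫ x in prism (A i) (t • e), sharedIncrement O A g (t • e) x)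
      (𝓝[>] 0) (𝓝 (∫ y in A i, g y * (inner ℝ n e * jump O n y) ∂(surface d))) := by
  have : IsFiniteMeasure ((surface d).restrict (A i)) := ⟨by simpa using hAfin.lt_top⟩
  have hmeas := fun t : ℝ => measurable_sharedIncrement hO hA hg (t • e)
  obtain ⟨M, hM⟩ := (isCompact_prism (hA i) e).exists_bound_of_continuousOn hg.continuousOn
  have hrhs : ∫ y in A i, g y * (inner ℝ n e * jump O n y) ∂(surface d) =
      ∫ p : EuclideanSpace ℝ (Fin d) × ℝ, inner ℝ n e * (g p.1 * jump O n p.1)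
        ∂((surface d).restrict (A i)).prod (volume.restrict (Set.Icc 0 1)) := by
    rw [integral_fun_fst fun y => inner ℝ n e * (g y * jump O n y)]
    simp [mul_left_comm]
  have hIoo : ∀ᵐ r ∂volume.restrict (Set.Icc (0 : ℝ) 1), r ∈ Set.Ioo (0 : ℝ) 1 := by
    rw [← restrict_Ioo_eq_restrict_Icc]
    exact ae_restrict_mem measurableSet_Ioo
  have hprod := (Measure.quasiMeasurePreserving_fst.ae
    ((ae_restrict_mem (hA i).measurableSet).and hgood)).and
      (Measure.quasiMeasurePreserving_snd (μ := (surface d).restrict (A i)).ae hIoo)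
  rw [hrhs]
  refine (tendsto_integral_filter_of_dominated_convergence (fun _ => inner ℝ n e * M)
    (.of_forall fun t => (((hmeas t).comp (by fun_prop)).const_mul _).aestronglyMeasurable)
    ?_ (integrable_const _) ?_).congr' (eventually_nhdsWithin_of_forall fun t ht =>
      (inv_mul_integral_prism hn he (hA i) hAH hAfin ht (hmeas t)).symm)
  · filter_upwards [Ioo_mem_nhdsGT one_pos] with t ht
    filter_upwards [hprod] with p ⟨⟨hpA, _⟩, hr⟩
    rw [norm_mul, Real.norm_of_nonneg he.le]
    refine mul_le_mul_of_nonneg_left ((abs_sharedIncrement_le g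
      (add_smul_mem_prism hpA ⟨hr.1.le, hr.2.le⟩)).trans ?_) he.le
    rw [smul_smul]
    exact hM _ (add_smul_mem_prism hpA
      ⟨mul_nonneg hr.1.le ht.1.le, mul_le_one₀ hr.2.le ht.1.le ht.2.le⟩)
  · filter_upwards [hprod] with p ⟨⟨hpA, hne, hflat⟩, hr⟩
    exact (tendsto_sharedIncrement (fun j => (hA j).isClosed) hg he hpA hne hflat hr).const_mul _

theorem tendsto_integral_prism_sharedIncrement_of_norm_eq_one {n : EuclideanSpace ℝ (Fin d)}
    (hn : ‖n‖ = 1) {c : ℝ} (e : EuclideanSpace ℝ (Fin d))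
    {A : κ → Set (EuclideanSpace ℝ (Fin d))}
    (hA : ∀ j, IsCompact (A j)) (hO : MeasurableSet O) (hg : Continuous g) {i : κ}
    (hAH : A i ⊆ hyperplane n c) (hAfin : surface d (A i) ≠ ∞)
    (hgood : ∀ᵐ y ∂(surface d).restrict (A i), (∀ j ≠ i, y ∉ A j) ∧
      ∀ᶠ x in 𝓝 y, x ∈ frontier O → inner ℝ n (x - y) = 0) :
    Tendsto (fun t : ℝ => t⁻¹ * ∫ x in prism (A i) (t • e), sharedIncrement O A g (t • e) x)
      (𝓝[>] 0) (𝓝 (∫ y in A i, g y * (inner ℝ n e * jump O n y) ∂(surface d))) := by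
  rcases lt_trichotomy (inner ℝ n e) 0 with hneg | hzero | hpos
  · have h := tendsto_integral_prism_sharedIncrement (n := -n) (c := -c) (e := e)
      (by rwa [norm_neg]) (by simpa using hneg) hA hO hg (by rwa [hyperplane_neg_neg]) hAfin
      (by simpa using hgood)
    simpa only [jump_neg, inner_neg_left, neg_mul_neg] using h
  · have hn0 : n ≠ 0 := norm_ne_zero_iff.1 (hn ▸ one_ne_zero)
    have hnull : ∀ t : ℝ, volume (prism (A i) (t • e)) = 0 := fun t =>
      volume_prism_eq_zero hn0 (by rw [inner_smul_right, hzero, mul_zero]) hAH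
    simp [hzero, Measure.restrict_eq_zero.2 (hnull _)]
  · exact tendsto_integral_prism_sharedIncrement hn hpos hA hO hg hAH hAfin hgood

/-- Both sides are the limit of the difference quotient `t⁻¹ ∫ g (1_O(· - t e) - 1_O)`: shifting the
integral onto `g` gives the derivative, while the increment itself is carried by the prisms over the
flat pieces of the frontier. -/
theorem integral_fderiv_eq_sum_integral_jump {n : κ → EuclideanSpace ℝ (Fin d)} {c : κ → ℝ}
    (hn : ∀ i, ‖n i‖ = 1)
    (hdisj : Pairwise (Function.onFun (AEDisjoint (surface d)) fun i => hyperplane (n i) (c i)))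
    (hO : MeasurableSet O) (hOb : Bornology.IsBounded O)
    (hfr : frontier O ⊆ ⋃ i, hyperplane (n i) (c i)) (hfin : surface d (frontier O) ≠ ∞)
    (hg : ContDiff ℝ 1 g) (e : EuclideanSpace ℝ (Fin d)) :
    ∫ x in O, fderiv ℝ g x e = ∑ i, ∫ y in frontier O ∩ hyperplane (n i) (c i),
      g y * (inner ℝ (n i) e * jump O (n i) y) ∂(surface d) := by
  have hA : ∀ i, IsCompact (frontier O ∩ hyperplane (n i) (c i)) := fun i =>
    (hOb.isCompact_closure.of_isClosed_subset isClosed_frontier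
      frontier_subset_closure).inter_right (isClosed_hyperplane _ _)
  have hcover : frontier O ⊆ ⋃ i, frontier O ∩ hyperplane (n i) (c i) := by
    rw [← Set.inter_iUnion]
    exact Set.subset_inter subset_rfl hfr
  have hgood : ∀ i, ∀ᵐ y ∂(surface d).restrict (frontier O ∩ hyperplane (n i) (c i)),
      (∀ j ≠ i, y ∉ frontier O ∩ hyperplane (n j) (c j)) ∧
        ∀ᶠ x in 𝓝 y, x ∈ frontier O → inner ℝ (n i) (x - y) = 0 := fun i => by
    filter_upwards [ae_restrict_mem (hA i).measurableSet,
      ae_restrict_of_ae (ae_notMem_hyperplane hdisj i)] with y hy hne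
    exact ⟨fun j hj hyj => hne hy.2 j hj hyj.2,
      eventually_frontier_inner_eq_zero hfr hy.2 (hne hy.2)⟩
  refine tendsto_nhds_unique (tendsto_integral_mul_indicator_sub volume hO hOb hg e) ?_
  simp only [← sum_integral_prism_sharedIncrement volume hO hA hcover hg.continuous,
    Finset.mul_sum]
  exact tendsto_finsetSum _ fun i _ => tendsto_integral_prism_sharedIncrement_of_norm_eq_one
    (hn i) e hA hO hg.continuous Set.inter_subset_right
    (measure_ne_top_of_subset Set.inter_subset_left hfin) (hgood i)

end Divergence

/-! ### Geometry of admissible meshes -/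

section UnitNormal

variable {H : Type*} [NormedAddCommGroup H] [InnerProductSpace ℝ H]

theorem disjoint_hyperplane {c c' : ℝ} (h : c ≠ c') (n : H) :
    Disjoint (hyperplane n c) (hyperplane n c') :=
  Set.disjoint_left.2 fun _ hx hx' => h ((mem_hyperplane.1 hx).symm.trans (mem_hyperplane.1 hx'))

theorem exists_norm_eq_one_hyperplane_eq {n : H} (hn : n ≠ 0) (c : ℝ) :
    ∃ n' c', ‖n'‖ = 1 ∧ hyperplane n' c' = hyperplane n c := by
  have hnorm : ‖n‖⁻¹ ≠ 0 := inv_ne_zero (norm_ne_zero_iff.2 hn)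
  refine ⟨‖n‖⁻¹ • n, ‖n‖⁻¹ * c, norm_smul_inv_norm hn, ?_⟩
  ext x
  rw [mem_hyperplane, mem_hyperplane, real_inner_smul_left, mul_right_inj' hnorm]

end UnitNormal

section Mesh

variable {d : ℕ}

theorem eq_or_eq_neg_of_surface_ne_zero {n n' : EuclideanSpace ℝ (Fin d)} (hn : ‖n‖ = 1)
    (hn' : ‖n'‖ = 1) {c c' : ℝ} {A : Set (EuclideanSpace ℝ (Fin d))} (hA : A ⊆ hyperplane n c)
    (hA' : A ⊆ hyperplane n' c') (hpos : surface d A ≠ 0) : n = n' ∨ n = -n' := by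
  by_contra! hne
  exact hpos (measure_mono_null (Set.subset_inter hA hA')
    (surface_hyperplane_inter_hyperplane hn hn' hne.1 hne.2 c c'))

theorem aedisjoint_hyperplane {n n' : EuclideanSpace ℝ (Fin d)} (hn : ‖n‖ = 1) (hn' : ‖n'‖ = 1)
    {c c' : ℝ} (hne : hyperplane n c ≠ hyperplane n' c') :
    AEDisjoint (surface d) (hyperplane n c) (hyperplane n' c') := by
  by_contra hpos
  rcases eq_or_eq_neg_of_surface_ne_zero hn hn' Set.inter_subset_left Set.inter_subset_right
    hpos with rfl | rfl
  · exact hpos (disjoint_hyperplane (fun h => hne (congrArg _ h)) n).aedisjoint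
  · rw [← neg_neg c, hyperplane_neg_neg] at hne hpos
    exact hpos (disjoint_hyperplane (fun h => hne (congrArg _ h)) n').aedisjoint

theorem IsPolygonal.exists_hyperplanes {K : Set (EuclideanSpace ℝ (Fin d))}
    (hK : IsPolygonal K) :
    ∃ (κ : Type) (_ : Fintype κ) (n : κ → EuclideanSpace ℝ (Fin d)) (c : κ → ℝ),
      (∀ i, ‖n i‖ = 1) ∧
      Pairwise (Function.onFun (AEDisjoint (surface d)) fun i => hyperplane (n i) (c i)) ∧
      frontier K ⊆ ⋃ i, hyperplane (n i) (c i) := by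
  classical
  obtain ⟨-, S, hS, hfr⟩ := hK
  have hunit : ∀ B : S.image fun p => hyperplane p.1 p.2, ∃ n c, ‖n‖ = 1 ∧
      hyperplane n c = B.1 := by
    rintro ⟨B, hB⟩
    obtain ⟨p, hp, rfl⟩ := Finset.mem_image.1 hB
    exact exists_norm_eq_one_hyperplane_eq (hS p hp) p.2
  choose n c hn hnc using hunit
  refine ⟨_, inferInstance, n, c, hn, fun i j hij => aedisjoint_hyperplane (hn i) (hn j) ?_, ?_⟩
  · rw [hnc, hnc]
    exact fun h => hij (Subtype.ext h)
  · intro x hx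
    obtain ⟨p, hp, hpx⟩ := Set.mem_iUnion₂.1 (hfr hx)
    refine Set.mem_iUnion.2 ⟨⟨hyperplane p.1 p.2, Finset.mem_image_of_mem _ hp⟩, ?_⟩
    rw [hnc]
    exact hpx

theorem IsPolygonal.volume_frontier {K : Set (EuclideanSpace ℝ (Fin d))} (hK : IsPolygonal K) :
    volume (frontier K) = 0 := by
  obtain ⟨-, S, hS, hfr⟩ := hK
  exact measure_mono_null hfr ((measure_biUnion_null_iff S.countable_toSet).2 fun p hp =>
    addHaar_hyperplane volume (hS p hp) p.2)

theorem interface_comm (K L : Set (EuclideanSpace ℝ (Fin d))) : interface K L = interface L K :=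
  Set.inter_comm _ _

theorem isClosed_interface (K L : Set (EuclideanSpace ℝ (Fin d))) : IsClosed (interface K L) :=
  isClosed_closure.inter isClosed_closure

namespace AdmissibleMesh

variable {ι : Type*} (𝒯 : AdmissibleMesh d ι) {K L M : ι}

theorem size_nonneg : 0 ≤ 𝒯.size :=
  ENNReal.toReal_nonneg

theorem ediam_le (K : ι) : Metric.ediam (𝒯.cell K) ≤ ENNReal.ofReal 𝒯.size := by
  rw [size, ENNReal.ofReal_toReal 𝒯.size_finite]
  exact le_iSup (fun K => Metric.ediam (𝒯.cell K)) K

theorem isBounded_cell (K : ι) : Bornology.IsBounded (𝒯.cell K) :=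
  Metric.isBounded_iff_ediam_ne_top.2 ((𝒯.ediam_le K).trans_lt ENNReal.ofReal_lt_top).ne

theorem isCompact_closure_cell (K : ι) : IsCompact (closure (𝒯.cell K)) :=
  (𝒯.isBounded_cell K).isCompact_closure

theorem surface_frontier_ne_top (K : ι) : surface d (frontier (𝒯.cell K)) ≠ ∞ :=
  ((𝒯.boundary_le K).trans_lt ENNReal.ofReal_lt_top).ne

theorem closure_interior_cell (K : ι) : closure (interior (𝒯.cell K)) = closure (𝒯.cell K) :=
  (closure_mono interior_subset).antisymm (closure_minimal (𝒯.polygonal K).1 isClosed_closure)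

theorem frontier_interior_cell (K : ι) : frontier (interior (𝒯.cell K)) = frontier (𝒯.cell K) := by
  rw [frontier, frontier, interior_interior, closure_interior_cell]

theorem interior_cell_nonempty (K : ι) : (interior (𝒯.cell K)).Nonempty := by
  rw [← closure_nonempty_iff, closure_interior_cell]
  exact (𝒯.connected K).nonempty.closure

theorem interior_cell_ae_eq (K : ι) :
    (interior (𝒯.cell K) : Set (EuclideanSpace ℝ (Fin d))) =ᵐ[volume] 𝒯.cell K :=
  interior_ae_eq_of_null_frontier (𝒯.polygonal K).volume_frontier

theorem nullMeasurableSet_cell (K : ι) : NullMeasurableSet (𝒯.cell K) :=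
  isOpen_interior.measurableSet.nullMeasurableSet.congr (𝒯.interior_cell_ae_eq K)

theorem volume_cell_ne_top (K : ι) : volume (𝒯.cell K) ≠ ∞ :=
  (𝒯.isBounded_cell K).measure_lt_top.ne

theorem volume_cell_ne_zero (K : ι) : volume (𝒯.cell K) ≠ 0 := by
  rw [← measure_congr (𝒯.interior_cell_ae_eq K)]
  exact (isOpen_interior.measure_pos _ (𝒯.interior_cell_nonempty K)).ne'

theorem vol_pos (K : ι) : 0 < 𝒯.vol K :=
  ENNReal.toReal_pos (𝒯.volume_cell_ne_zero K) (𝒯.volume_cell_ne_top K)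

theorem size_pos (hd : 1 ≤ d) (K : ι) : 0 < 𝒯.size := by
  have : Nonempty (Fin d) := ⟨⟨0, hd⟩⟩
  refine ENNReal.ofReal_pos.1 (lt_of_lt_of_le (pos_iff_ne_zero.2 fun h => ?_) (𝒯.ediam_le K))
  exact 𝒯.volume_cell_ne_zero K ((Metric.ediam_eq_zero_iff.1 h).measure_zero volume)

theorem cell_subset_ball (K : ι) {x : EuclideanSpace ℝ (Fin d)} {r : ℝ}
    (h : (closure (𝒯.cell K) ∩ Metric.ball x r).Nonempty) :
    𝒯.cell K ⊆ Metric.ball x (r + 𝒯.size) := by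
  obtain ⟨y, hy, hyx⟩ := h
  intro z hz
  have hzy : edist z y ≤ ENNReal.ofReal 𝒯.size := by
    refine (Metric.edist_le_ediam_of_mem (subset_closure hz) hy).trans ?_
    rw [Metric.ediam_closure]
    exact 𝒯.ediam_le K
  rw [edist_dist, ENNReal.ofReal_le_ofReal_iff 𝒯.size_nonneg] at hzy
  rw [Metric.mem_ball] at hyx ⊢
  linarith [dist_triangle z y x]

theorem pairwise_disjoint_interior :
    Pairwise (Function.onFun Disjoint fun K => interior (𝒯.cell K)) :=
  fun _ _ h => (𝒯.disjoint h).mono interior_subset interior_subset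

theorem finite_inter_ball (hd : 1 ≤ d) (x : EuclideanSpace ℝ (Fin d)) (r : ℝ) :
    {K | (closure (𝒯.cell K) ∩ Metric.ball x r).Nonempty}.Finite := by
  rcases isEmpty_or_nonempty ι with h | ⟨⟨K₀⟩⟩
  · exact Set.toFinite _
  have hfin := Measure.finite_const_le_meas_of_disjoint_iUnion
    (volume.restrict (Metric.ball x (r + 𝒯.size))) (As := fun K => interior (𝒯.cell K))
    (ε := ENNReal.ofReal (𝒯.α * 𝒯.size ^ d))
    (ENNReal.ofReal_pos.2 (mul_pos 𝒯.α_pos (pow_pos (𝒯.size_pos hd K₀) _)))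
    (fun K => isOpen_interior.measurableSet) 𝒯.pairwise_disjoint_interior
    ((measure_mono (Set.subset_univ _)).trans_lt
      (by simpa using Metric.isBounded_ball.measure_lt_top)).ne
  refine hfin.subset fun K hK => ?_
  rw [Set.mem_ofPred_eq, Measure.restrict_apply isOpen_interior.measurableSet,
    Set.inter_eq_left.2 (interior_subset.trans (𝒯.cell_subset_ball K hK)),
    measure_congr (𝒯.interior_cell_ae_eq K)]
  exact 𝒯.volume_ge K

theorem locallyFinite_closure_cell (hd : 1 ≤ d) :
    LocallyFinite fun K => closure (𝒯.cell K) := fun x =>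
  ⟨Metric.ball x 1, Metric.ball_mem_nhds x one_pos, 𝒯.finite_inter_ball hd x 1⟩

theorem countable_index (𝒯 : AdmissibleMesh d ι) (hd : 1 ≤ d) : Countable ι := by
  rw [← Set.countable_univ_iff]
  exact (𝒯.locallyFinite_closure_cell hd).countable_univ fun K =>
    (𝒯.connected K).nonempty.closure

theorem mem_neighbors_symm (h : L ∈ 𝒯.neighbors K) : K ∈ 𝒯.neighbors L :=
  ⟨h.1.symm, by rw [interface_comm]; exact h.2⟩

theorem finite_neighbors (hd : 1 ≤ d) (K : ι) : (𝒯.neighbors K).Finite := by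
  refine ((𝒯.locallyFinite_closure_cell hd).finite_nonempty_inter_compact
    (𝒯.isCompact_closure_cell K)).subset fun L hL => ?_
  rw [Set.mem_ofPred_eq, Set.inter_comm]
  exact nonempty_of_measure_ne_zero hL.2.ne'

/-- The neighbours of a control volume, as a finite set. -/
noncomputable def neighborFinset (hd : 1 ≤ d) (K : ι) : Finset ι :=
  (𝒯.finite_neighbors hd K).toFinset

theorem mem_neighborFinset (hd : 1 ≤ d) : L ∈ 𝒯.neighborFinset hd K ↔ L ∈ 𝒯.neighbors K :=
  Set.Finite.mem_toFinset _

theorem interface_subset_frontier (h : L ≠ K) :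
    interface (𝒯.cell K) (𝒯.cell L) ⊆ frontier (𝒯.cell K) := fun _ hx =>
  ⟨hx.1, Set.disjoint_left.1 (((𝒯.disjoint h).mono_right interior_subset).closure_left
    isOpen_interior) hx.2⟩

theorem isCompact_interface (K L : ι) : IsCompact (interface (𝒯.cell K) (𝒯.cell L)) :=
  (𝒯.isCompact_closure_cell K).inter_right isClosed_closure

theorem surface_interface_ne_top (h : L ≠ K) :
    surface d (interface (𝒯.cell K) (𝒯.cell L)) ≠ ∞ :=
  measure_ne_top_of_subset (𝒯.interface_subset_frontier h) (𝒯.surface_frontier_ne_top K)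

theorem area_pos (h : L ∈ 𝒯.neighbors K) : 0 < 𝒯.area K L :=
  ENNReal.toReal_pos h.2.ne' (𝒯.surface_interface_ne_top h.1)

theorem area_comm (K L : ι) : 𝒯.area K L = 𝒯.area L K := by
  rw [area, area, interface_comm]

theorem isOutwardNormal (h : L ∈ 𝒯.neighbors K) :
    IsOutwardNormal (𝒯.cell K) (𝒯.cell L) (𝒯.normal K L) :=
  𝒯.flat K L h.1.symm h.2

theorem norm_normal (h : L ∈ 𝒯.neighbors K) : ‖𝒯.normal K L‖ = 1 :=
  (𝒯.isOutwardNormal h).1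

theorem exists_interface_subset_hyperplane (h : L ∈ 𝒯.neighbors K) :
    ∃ c, interface (𝒯.cell K) (𝒯.cell L) ⊆ hyperplane (𝒯.normal K L) c :=
  (𝒯.isOutwardNormal h).2.1

theorem ae_eventually_sub_mem_cell (h : L ∈ 𝒯.neighbors K) :
    ∀ᵐ x ∂(surface d), x ∈ interface (𝒯.cell K) (𝒯.cell L) → ∀ᶠ ε : ℝ in 𝓝[>] 0,
      x - ε • 𝒯.normal K L ∈ 𝒯.cell K :=
  ((ae_restrict_iff' (isClosed_interface _ _).measurableSet).1 (𝒯.isOutwardNormal h).2.2).mono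
    fun _ hx hxI => (hx hxI).mono fun _ => And.left

theorem normal_symm (h : L ∈ 𝒯.neighbors K) : 𝒯.normal L K = -𝒯.normal K L := by
  have h' := 𝒯.mem_neighbors_symm h
  obtain ⟨c, hc⟩ := 𝒯.exists_interface_subset_hyperplane h
  obtain ⟨c', hc'⟩ := 𝒯.exists_interface_subset_hyperplane h'
  rw [interface_comm] at hc'
  refine (eq_or_eq_neg_of_surface_ne_zero (𝒯.norm_normal h') (𝒯.norm_normal h) hc' hc
    h.2.ne').resolve_left fun heq => ?_
  obtain ⟨x, hx, hxK, hxL⟩ := ((frequently_ae_mem_iff.2 h.2.ne').and_eventually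
    ((𝒯.ae_eventually_sub_mem_cell h).and (𝒯.ae_eventually_sub_mem_cell h'))).exists
  rw [interface_comm, heq] at hxL
  obtain ⟨ε, hεK, hεL⟩ := ((hxK hx).and (hxL hx)).exists
  exact Set.disjoint_left.1 (𝒯.disjoint h.1) hεL hεK

theorem ae_eventually_mem_cell (h : L ∈ 𝒯.neighbors K) :
    ∀ᵐ x ∂(surface d), x ∈ interface (𝒯.cell K) (𝒯.cell L) → ∀ᶠ ε : ℝ in 𝓝[>] 0,
      x - ε • 𝒯.normal K L ∈ 𝒯.cell K ∧ x + ε • 𝒯.normal K L ∈ 𝒯.cell L := by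
  filter_upwards [𝒯.ae_eventually_sub_mem_cell h,
    𝒯.ae_eventually_sub_mem_cell (𝒯.mem_neighbors_symm h)] with x hxK hxL hx
  simp only [𝒯.normal_symm h, smul_neg, sub_neg_eq_add, interface_comm (𝒯.cell L)] at hxL
  exact (hxK hx).and (hxL hx)

theorem aedisjoint_interface (hL : L ∈ 𝒯.neighbors K) (hM : M ∈ 𝒯.neighbors K) (hne : L ≠ M) :
    AEDisjoint (surface d) (interface (𝒯.cell K) (𝒯.cell L))
      (interface (𝒯.cell K) (𝒯.cell M)) := by
  obtain ⟨c, hc⟩ := 𝒯.exists_interface_subset_hyperplane hL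
  obtain ⟨c', hc'⟩ := 𝒯.exists_interface_subset_hyperplane hM
  by_contra hpos
  obtain ⟨x, hx, hxL, hxM⟩ := ((frequently_ae_mem_iff.2 hpos).and_eventually
    ((𝒯.ae_eventually_mem_cell hL).and (𝒯.ae_eventually_mem_cell hM))).exists
  obtain ⟨ε, hεL, hεM⟩ := ((hxL hx.1).and (hxM hx.2)).exists
  rcases eq_or_eq_neg_of_surface_ne_zero (𝒯.norm_normal hL) (𝒯.norm_normal hM)
    (Set.inter_subset_left.trans hc) (Set.inter_subset_right.trans hc') hpos with heq | heq
  · exact Set.disjoint_left.1 (𝒯.disjoint hne) hεL.2 (heq ▸ hεM.2)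
  · rw [heq, smul_neg, ← sub_eq_add_neg] at hεL
    exact Set.disjoint_left.1 (𝒯.disjoint hL.1) hεL.2 hεM.1

end AdmissibleMesh

end Mesh

theorem divergence_eq_sum_fderiv {d : ℕ}
    {w : EuclideanSpace ℝ (Fin d) → EuclideanSpace ℝ (Fin d)} {x : EuclideanSpace ℝ (Fin d)}
    (hw : DifferentiableAt ℝ w x) :
    divergence w x = ∑ i, fderiv ℝ (fun x => w x i) x (EuclideanSpace.single i 1) :=
  Finset.sum_congr rfl fun i _ => by
    rw [show (fun x => w x i) = EuclideanSpace.proj (𝕜 := ℝ) i ∘ w from rfl,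
      ((EuclideanSpace.proj (𝕜 := ℝ) i).hasFDerivAt.comp x hw.hasFDerivAt).fderiv]
    rfl

section CellDivergence

variable {d : ℕ} {ι : Type*} (𝒯 : AdmissibleMesh d ι) {K L : ι}

namespace AdmissibleMesh

/-- The outward unit normal on the boundary of `K`, read off the interface of `K` which contains
the given point; almost every boundary point lies on at most one. -/
noncomputable def outwardNormal (hd : 1 ≤ d) (K : ι) (y : EuclideanSpace ℝ (Fin d)) :
    EuclideanSpace ℝ (Fin d) :=
  ∑ L ∈ 𝒯.neighborFinset hd K,
    (interface (𝒯.cell K) (𝒯.cell L)).indicator (fun _ => 𝒯.normal K L) y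

theorem ae_mem_neighbors_of_mem_interface (hd : 1 ≤ d) (K : ι) :
    ∀ᵐ y ∂(surface d), ∀ L, L ≠ K → y ∈ interface (𝒯.cell K) (𝒯.cell L) → L ∈ 𝒯.neighbors K := by
  have := 𝒯.countable_index hd
  refine ae_all_iff.2 fun L => ?_
  by_cases hnull : surface d (interface (𝒯.cell K) (𝒯.cell L)) = 0
  · filter_upwards [measure_eq_zero_iff_ae_notMem.1 hnull] with y hy _ hyI
    exact absurd hyI hy
  · exact ae_of_all _ fun y hL _ => ⟨hL, pos_iff_ne_zero.2 hnull⟩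

theorem ae_forall_neighbors_eventually_mem_cell (hd : 1 ≤ d) (K : ι) :
    ∀ᵐ y ∂(surface d), ∀ L ∈ 𝒯.neighbors K, y ∈ interface (𝒯.cell K) (𝒯.cell L) →
      ∀ᶠ ε : ℝ in 𝓝[>] 0,
        y - ε • 𝒯.normal K L ∈ 𝒯.cell K ∧ y + ε • 𝒯.normal K L ∈ 𝒯.cell L :=
  (ae_ball_iff (𝒯.finite_neighbors hd K).countable).2 fun _ hL => 𝒯.ae_eventually_mem_cell hL

theorem ae_normal_eq_or_eq_neg (hd : 1 ≤ d) (K : ι) {n : EuclideanSpace ℝ (Fin d)}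
    (hn : ‖n‖ = 1) (c : ℝ) :
    ∀ᵐ y ∂(surface d), ∀ L ∈ 𝒯.neighbors K, y ∈ interface (𝒯.cell K) (𝒯.cell L) →
      y ∈ hyperplane n c → 𝒯.normal K L = n ∨ 𝒯.normal K L = -n := by
  refine (ae_ball_iff (𝒯.finite_neighbors hd K).countable).2 fun L hL => ?_
  obtain ⟨c', hc'⟩ := 𝒯.exists_interface_subset_hyperplane hL
  by_cases hnull : surface d (interface (𝒯.cell K) (𝒯.cell L) ∩ hyperplane n c) = 0
  · filter_upwards [measure_eq_zero_iff_ae_notMem.1 hnull] with y hy hyI hyH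
    exact absurd ⟨hyI, hyH⟩ hy
  · exact ae_of_all _ fun _ _ _ => eq_or_eq_neg_of_surface_ne_zero (𝒯.norm_normal hL) hn
      (Set.inter_subset_left.trans hc') Set.inter_subset_right hnull

theorem ae_outwardNormal_eq (hd : 1 ≤ d) (K : ι) :
    ∀ᵐ y ∂(surface d), ∀ L ∈ 𝒯.neighbors K, y ∈ interface (𝒯.cell K) (𝒯.cell L) →
      𝒯.outwardNormal hd K y = 𝒯.normal K L := by
  have hcount := (𝒯.finite_neighbors hd K).countable
  have hunique : ∀ᵐ y ∂(surface d), ∀ L ∈ 𝒯.neighbors K, ∀ M ∈ 𝒯.neighbors K, M ≠ L →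
      y ∉ interface (𝒯.cell K) (𝒯.cell L) ∩ interface (𝒯.cell K) (𝒯.cell M) :=
    (ae_ball_iff hcount).2 fun L hL => (ae_ball_iff hcount).2 fun M hM =>
      eventually_imp_distrib_left.2 fun hne =>
        measure_eq_zero_iff_ae_notMem.1 (𝒯.aedisjoint_interface hL hM hne.symm)
  filter_upwards [hunique] with y hy L hL hyL
  rw [outwardNormal, Finset.sum_eq_single L, Set.indicator_of_mem hyL]
  · exact fun M hM hne => Set.indicator_of_notMem
      (fun hyM => hy L hL M ((𝒯.mem_neighborFinset hd).1 hM) hne ⟨hyL, hyM⟩) _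
  · exact fun h => absurd ((𝒯.mem_neighborFinset hd).2 hL) h

theorem outwardNormal_eq_zero (hd : 1 ≤ d) {y : EuclideanSpace ℝ (Fin d)}
    (hy : ∀ L ∈ 𝒯.neighbors K, y ∉ interface (𝒯.cell K) (𝒯.cell L)) :
    𝒯.outwardNormal hd K y = 0 :=
  Finset.sum_eq_zero fun L hL =>
    Set.indicator_of_notMem (hy L ((𝒯.mem_neighborFinset hd).1 hL)) _

theorem mem_interior_closure_cell (hd : 1 ≤ d) {y : EuclideanSpace ℝ (Fin d)}
    (hy : ∀ L, L ≠ K → y ∉ closure (𝒯.cell L)) : y ∈ interior (closure (𝒯.cell K)) := by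
  have hclosed : IsClosed (⋃ L : {L // L ≠ K}, closure (𝒯.cell L)) :=
    ((𝒯.locallyFinite_closure_cell hd).comp_injective Subtype.val_injective).isClosed_iUnion
      fun _ => isClosed_closure
  refine mem_interior.2 ⟨_, fun x hx => ?_, hclosed.isOpen_compl,
    by simpa [Set.mem_iUnion] using hy⟩
  obtain ⟨L, hxL⟩ := Set.mem_iUnion.1 (𝒯.cover.symm ▸ Set.mem_univ x)
  obtain rfl | hL := eq_or_ne L K
  · exact hxL
  · exact absurd (Set.mem_iUnion.2 ⟨⟨L, hL⟩, hxL⟩) hx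

theorem ae_jump_smul_eq_outwardNormal (hd : 1 ≤ d) (K : ι) {n : EuclideanSpace ℝ (Fin d)}
    (hn : ‖n‖ = 1) (c : ℝ) :
    ∀ᵐ y ∂(surface d), y ∈ frontier (𝒯.cell K) ∩ hyperplane n c →
      (∀ᶠ x in 𝓝 y, x ∈ frontier (𝒯.cell K) → inner ℝ n (x - y) = 0) →
      jump (interior (𝒯.cell K)) n y • n = 𝒯.outwardNormal hd K y := by
  have hn0 : n ≠ 0 := norm_ne_zero_iff.1 (hn ▸ one_ne_zero)
  filter_upwards [𝒯.ae_mem_neighbors_of_mem_interface hd K,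
    𝒯.ae_forall_neighbors_eventually_mem_cell hd K, 𝒯.ae_outwardNormal_eq hd K,
    𝒯.ae_normal_eq_or_eq_neg hd K hn c] with y hneighbor hside hnormal hparallel hy hflat
  rw [← frontier_interior_cell] at hflat
  by_cases hinterface : ∃ L ∈ 𝒯.neighbors K, y ∈ interface (𝒯.cell K) (𝒯.cell L)
  · obtain ⟨L, hL, hyL⟩ := hinterface
    rw [hnormal L hL hyL]
    have hout : ∀ᶠ ε : ℝ in 𝓝[>] 0, y - ε • 𝒯.normal K L ∈ closure (interior (𝒯.cell K)) ∧
        y + ε • 𝒯.normal K L ∉ interior (interior (𝒯.cell K)) := by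
      filter_upwards [hside L hL hyL] with ε hε
      rw [closure_interior_cell, interior_interior]
      exact ⟨subset_closure hε.1, fun h =>
        Set.disjoint_left.1 (𝒯.disjoint hL.1) hε.2 (interior_subset h)⟩
    rcases hparallel L hL hyL hy.2 with heq | heq
    · rw [heq] at hout ⊢
      rw [jump_eq_one hn0 hflat hout, one_smul]
    · rw [heq] at hout ⊢
      rw [← neg_neg (jump _ n y), ← jump_neg, jump_eq_one (neg_ne_zero.2 hn0) (by simpa using hflat)
        hout, neg_smul, one_smul]
  · push Not at hinterface
    have hisolated : ∀ L, L ≠ K → y ∉ closure (𝒯.cell L) := fun L hL hyL =>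
      have hyI := ⟨frontier_subset_closure hy.1, hyL⟩
      hinterface L (hneighbor L hL hyI) hyI
    rw [𝒯.outwardNormal_eq_zero hd hinterface, jump_eq_zero_of_mem_interior_closure hn0 hflat
      (by rw [closure_interior_cell]; exact 𝒯.mem_interior_closure_cell hd hisolated), zero_smul]

theorem integrableOn_interface (hL : L ≠ K) {g : EuclideanSpace ℝ (Fin d) → ℝ}
    (hg : Continuous g) : IntegrableOn g (interface (𝒯.cell K) (𝒯.cell L)) (surface d) :=
  hg.continuousOn.integrableOn_of_subset_isCompact (𝒯.isCompact_interface K L)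
    (isClosed_interface _ _).measurableSet subset_rfl (𝒯.surface_interface_ne_top hL)

theorem mul_inner_outwardNormal (hd : 1 ≤ d) (K : ι) (g : EuclideanSpace ℝ (Fin d) → ℝ)
    (e y : EuclideanSpace ℝ (Fin d)) :
    g y * inner ℝ (𝒯.outwardNormal hd K y) e = ∑ L ∈ 𝒯.neighborFinset hd K,
      (interface (𝒯.cell K) (𝒯.cell L)).indicator (fun y => g y * inner ℝ (𝒯.normal K L) e) y := by
  rw [outwardNormal, sum_inner, Finset.mul_sum]
  refine Finset.sum_congr rfl fun L _ => ?_
  by_cases hy : y ∈ interface (𝒯.cell K) (𝒯.cell L) <;> simp [hy]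

theorem integrable_indicator_interface (hL : L ≠ K) {g : EuclideanSpace ℝ (Fin d) → ℝ}
    (hg : Continuous g) :
    Integrable ((interface (𝒯.cell K) (𝒯.cell L)).indicator g) (surface d) :=
  (integrable_indicator_iff (isClosed_interface _ _).measurableSet).2
    (𝒯.integrableOn_interface hL hg)

theorem integrable_mul_inner_outwardNormal (hd : 1 ≤ d) (K : ι)
    {g : EuclideanSpace ℝ (Fin d) → ℝ} (hg : Continuous g) (e : EuclideanSpace ℝ (Fin d)) :
    Integrable (fun y => g y * inner ℝ (𝒯.outwardNormal hd K y) e) (surface d) := by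
  simp only [mul_inner_outwardNormal]
  exact integrable_finsetSum _ fun L hL =>
    𝒯.integrable_indicator_interface ((𝒯.mem_neighborFinset hd).1 hL).1 (hg.mul continuous_const)

theorem setIntegral_mul_inner_outwardNormal (hd : 1 ≤ d) (K : ι)
    {g : EuclideanSpace ℝ (Fin d) → ℝ} (hg : Continuous g) (e : EuclideanSpace ℝ (Fin d)) :
    ∫ y in frontier (𝒯.cell K), g y * inner ℝ (𝒯.outwardNormal hd K y) e ∂(surface d) =
      ∑ L ∈ 𝒯.neighborFinset hd K,
        ∫ y in interface (𝒯.cell K) (𝒯.cell L), g y * inner ℝ (𝒯.normal K L) e ∂(surface d) := by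
  have hne : ∀ L ∈ 𝒯.neighborFinset hd K, L ≠ K := fun L hL => ((𝒯.mem_neighborFinset hd).1 hL).1
  simp only [mul_inner_outwardNormal]
  have hint : ∀ L ∈ 𝒯.neighborFinset hd K, Integrable ((interface (𝒯.cell K) (𝒯.cell L)).indicator
      fun y => g y * inner ℝ (𝒯.normal K L) e) ((surface d).restrict (frontier (𝒯.cell K))) :=
    fun L hL => (𝒯.integrable_indicator_interface (hne L hL) (hg.mul continuous_const)).restrict
  rw [integral_finsetSum _ hint]
  refine Finset.sum_congr rfl fun L hL => ?_
  rw [setIntegral_indicator (isClosed_interface _ _).measurableSet,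
    Set.inter_eq_right.2 (𝒯.interface_subset_frontier (hne L hL))]

theorem integral_fderiv_cell (hd : 1 ≤ d) (K : ι) {g : EuclideanSpace ℝ (Fin d) → ℝ}
    (hg : ContDiff ℝ 1 g) (e : EuclideanSpace ℝ (Fin d)) :
    ∫ x in interior (𝒯.cell K), fderiv ℝ g x e = ∑ L ∈ 𝒯.neighborFinset hd K,
        ∫ y in interface (𝒯.cell K) (𝒯.cell L), g y * inner ℝ (𝒯.normal K L) e ∂(surface d) := by
  obtain ⟨κ, _, n, c, hn, hdisj, hfr⟩ := (𝒯.polygonal K).exists_hyperplanes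
  have hmeas : ∀ i, MeasurableSet (frontier (𝒯.cell K) ∩ hyperplane (n i) (c i)) := fun i =>
    (isClosed_frontier.inter (isClosed_hyperplane _ _)).measurableSet
  have hjump : ∀ i, ∀ᵐ y ∂(surface d), y ∈ frontier (𝒯.cell K) ∩ hyperplane (n i) (c i) →
      g y * (inner ℝ (n i) e * jump (interior (𝒯.cell K)) (n i) y) =
        g y * inner ℝ (𝒯.outwardNormal hd K y) e := fun i => by
    filter_upwards [ae_notMem_hyperplane hdisj i, 𝒯.ae_jump_smul_eq_outwardNormal hd K (hn i) (c i)]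
      with y hother hnormal hy
    rw [← hnormal hy (eventually_frontier_inner_eq_zero hfr hy.2 (hother hy.2)), inner_smul_left,
      mul_comm (inner ℝ (n i) e)]
    rfl
  have hflux := integral_fderiv_eq_sum_integral_jump (O := interior (𝒯.cell K)) hn hdisj
    isOpen_interior.measurableSet ((𝒯.isBounded_cell K).subset interior_subset)
    (by rwa [frontier_interior_cell])
    (by rw [frontier_interior_cell]; exact 𝒯.surface_frontier_ne_top K) hg e
  rw [frontier_interior_cell] at hflux
  rw [hflux, Finset.sum_congr rfl fun i _ => setIntegral_congr_ae (hmeas i) (hjump i),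
    ← tsum_fintype (L := .unconditional _),
    ← integral_iUnion_ae (fun i => (hmeas i).nullMeasurableSet)
      (fun i j hij => (hdisj hij).mono Set.inter_subset_right Set.inter_subset_right)
    (𝒯.integrable_mul_inner_outwardNormal hd K hg.continuous e).integrableOn,
    ← Set.inter_iUnion, Set.inter_eq_left.2 hfr, setIntegral_mul_inner_outwardNormal _ _ _
    hg.continuous]

theorem integral_divergence_cell (hd : 1 ≤ d) (K : ι)
    {w : EuclideanSpace ℝ (Fin d) → EuclideanSpace ℝ (Fin d)} (hw : ContDiff ℝ 1 w) :
    ∑ L ∈ 𝒯.neighborFinset hd K, ∫ y in interface (𝒯.cell K) (𝒯.cell L),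
        inner ℝ (w y) (𝒯.normal K L) ∂(surface d) =
      ∫ x in interior (𝒯.cell K), divergence w x := by
  have hwi : ∀ i, ContDiff ℝ 1 fun x => w x i := (contDiff_piLp _).1 hw
  have hint : ∀ i, IntegrableOn (fun x => fderiv ℝ (fun x => w x i) x (EuclideanSpace.single i 1))
      (interior (𝒯.cell K)) := fun i =>
    ((((hwi i).continuous_fderiv one_ne_zero).clm_apply continuous_const).continuousOn
      |>.integrableOn_compact ((𝒯.isBounded_cell K).subset interior_subset).isCompact_closure
      |>.mono_set subset_closure)
  simp only [divergence_eq_sum_fderiv (hw.differentiable one_ne_zero _)]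
  rw [integral_finsetSum _ fun i _ => hint i]
  simp only [𝒯.integral_fderiv_cell hd K (hwi _)]
  rw [Finset.sum_comm]
  refine Finset.sum_congr rfl fun L hL => ?_
  have hint' : ∀ i ∈ Finset.univ, IntegrableOn
      (fun y => w y i * inner ℝ (𝒯.normal K L) (EuclideanSpace.single i 1))
      (interface (𝒯.cell K) (𝒯.cell L)) (surface d) := fun i _ =>
    𝒯.integrableOn_interface ((𝒯.mem_neighborFinset hd).1 hL).1
      ((hwi i).continuous.mul continuous_const)
  rw [← integral_finsetSum _ hint']
  simp [PiLp.inner_apply, mul_comm]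

end AdmissibleMesh

end CellDivergence

/-! ### Stability of the upwind scheme -/

section Potential

variable {f : ℝ → ℝ} {c : ℝ≥0}

/-- The entropy flux `Φ u = ∫₀ᵘ s f'(s) ds` of the energy `u ² / 2`, written in the form
`u f u - ∫₀ᵘ f`, which does not involve the derivative of `f`. -/
noncomputable def potential (f : ℝ → ℝ) (u : ℝ) : ℝ := u * f u - ∫ s in (0 : ℝ)..u, f s

theorem potential_zero (f : ℝ → ℝ) : potential f 0 = 0 := by simp [potential]

theorem mul_sub_sub_potential_sub (hf : Monotone f) (a b : ℝ) :
    a * (f a - f b) - (potential f a - potential f b) = ∫ s in b..a, (f s - f b) := by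
  have hint : ∀ x y, IntervalIntegrable f volume x y := fun _ _ => hf.intervalIntegrable
  rw [intervalIntegral.integral_sub (hint _ _) (by simp), intervalIntegral.integral_const,
    potential, potential, ← intervalIntegral.integral_interval_sub_left (hint 0 a) (hint 0 b),
    smul_eq_mul]
  ring

theorem integral_comp_sub_eq_integral_neg_comp_neg (f : ℝ → ℝ) (a b : ℝ) :
    ∫ s in b..a, (f s - f b) = ∫ s in (-b)..(-a), (-f (-s) - -f (- -b)) := by
  rw [intervalIntegral.integral_comp_neg (fun s => -f s - -f (- -b)),
    intervalIntegral.integral_symm, ← intervalIntegral.integral_neg]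
  simp [neg_add_eq_sub]

theorem sq_sub_le_integral_of_le (hmono : Monotone f) (hlip : LipschitzWith c f) {a b : ℝ}
    (hba : b ≤ a) : (f a - f b) ^ 2 ≤ 2 * c * ∫ s in b..a, (f s - f b) := by
  have hfab : 0 ≤ f a - f b := sub_nonneg.2 (hmono hba)
  have hlip' : ∀ s ≤ a, f a - f s ≤ c * (a - s) := fun s hs => by
    simpa [Real.dist_eq, abs_of_nonneg (sub_nonneg.2 hs)] using
      (le_abs_self _).trans (hlip.dist_le_mul a s)
  obtain hc | hc := eq_or_lt_of_le c.coe_nonneg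
  · have hconst : f a - f b = 0 := le_antisymm (by simpa [← hc] using hlip' b hba) hfab
    simp [hconst, ← hc]
  set δ := (f a - f b) / c
  have hδ : 0 ≤ δ := div_nonneg hfab hc.le
  have hcδ : c * δ = f a - f b := mul_div_cancel₀ _ hc.ne'
  have hbδ : b ≤ a - δ := le_sub_comm.1 ((div_le_iff₀' hc).2 (hlip' b hba))
  have hint : ∀ x y, IntervalIntegrable (fun s => f s - f b) volume x y := fun x y =>
    hmono.intervalIntegrable.sub (by simp)
  have hlower : ∫ s in (a - δ)..a, c * (s - (a - δ)) ≤ ∫ s in b..a, (f s - f b) := by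
    rw [← intervalIntegral.integral_add_adjacent_intervals (hint b (a - δ)) (hint _ a)]
    refine le_add_of_nonneg_of_le (intervalIntegral.integral_nonneg hbδ fun s hs =>
      sub_nonneg.2 (hmono hs.1)) (intervalIntegral.integral_mono_on (by linarith)
        (Continuous.intervalIntegrable (by fun_prop) _ _) (hint _ _) fun s hs => ?_)
    linarith [hlip' s hs.2]
  have htriangle : ∫ s in (a - δ)..a, c * (s - (a - δ)) = c * δ ^ 2 / 2 := by
    rw [intervalIntegral.integral_const_mul,
      intervalIntegral.integral_comp_sub_right (fun s => s) (a - δ), integral_id]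
    ring
  calc (f a - f b) ^ 2 = 2 * c * (c * δ ^ 2 / 2) := by rw [← hcδ]; ring
    _ ≤ 2 * c * ∫ s in b..a, (f s - f b) := by rw [← htriangle]; gcongr

theorem sq_sub_le_integral (hmono : Monotone f) (hlip : LipschitzWith c f) (a b : ℝ) :
    (f a - f b) ^ 2 ≤ 2 * c * ∫ s in b..a, (f s - f b) := by
  obtain hba | hab := le_total b a
  · exact sq_sub_le_integral_of_le hmono hlip hba
  · have hreflect := sq_sub_le_integral_of_le (f := fun s => -f (-s))
      (fun x y hxy => neg_le_neg (hmono (neg_le_neg hxy)))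
      (LipschitzWith.neg (by simpa using! hlip.comp (LipschitzWith.id.neg))) (neg_le_neg hab)
    rw [integral_comp_sub_eq_integral_neg_comp_neg]
    convert hreflect using 1
    simp only [neg_neg]
    ring

theorem integral_sub_nonneg (hmono : Monotone f) (a b : ℝ) : 0 ≤ ∫ s in b..a, (f s - f b) := by
  obtain hba | hab := le_total b a
  · exact intervalIntegral.integral_nonneg hba fun s hs => sub_nonneg.2 (hmono hs.1)
  · rw [intervalIntegral.integral_symm, ← intervalIntegral.integral_neg]
    exact intervalIntegral.integral_nonneg hab fun s hs =>
      neg_nonneg.2 (sub_nonpos.2 (hmono hs.2))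

theorem potential_nonneg (hmono : Monotone f) (u : ℝ) : 0 ≤ potential f u := by
  simpa [← mul_sub_sub_potential_sub hmono, potential_zero] using integral_sub_nonneg hmono 0 u

theorem potential_le (hmono : Monotone f) (hlip : LipschitzWith c f) (hf0 : f 0 = 0) (u : ℝ) :
    potential f u ≤ c * u ^ 2 :=
  calc potential f u ≤ u * f u := by
        have h := integral_sub_nonneg hmono u 0
        rwa [← mul_sub_sub_potential_sub hmono, potential_zero, hf0, sub_zero, sub_zero,
          sub_nonneg] at h
    _ ≤ |u| * |f u| := by rw [← abs_mul]; exact le_abs_self _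
    _ ≤ |u| * (c * |u|) := by
        gcongr
        simpa [Real.dist_eq, hf0] using hlip.dist_le_mul u 0
    _ = c * u ^ 2 := by rw [← sq_abs u]; ring

theorem sq_sum_mul_sub_le {κ : Type*} (hmono : Monotone f) (hlip : LipschitzWith c f)
    {s : Finset κ} {b : κ → ℝ} (hb : ∀ L ∈ s, 0 ≤ b L) (u : ℝ) (v : κ → ℝ) :
    (∑ L ∈ s, b L * (f u - f (v L))) ^ 2 ≤ (c * ∑ L ∈ s, b L) *
      (2 * ∑ L ∈ s, b L * (u * (f u - f (v L)) - (potential f u - potential f (v L)))) :=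
  calc (∑ L ∈ s, b L * (f u - f (v L))) ^ 2
      ≤ (∑ L ∈ s, b L) * ∑ L ∈ s, b L * (f u - f (v L)) ^ 2 :=
        Finset.sum_sq_le_sum_mul_sum_of_sq_le_mul s hb
          (fun L hL => mul_nonneg (hb L hL) (sq_nonneg _)) fun L _ => by ring_nf; rfl
    _ ≤ (∑ L ∈ s, b L) * ∑ L ∈ s, b L *
          (2 * c * (u * (f u - f (v L)) - (potential f u - potential f (v L)))) := by
        refine mul_le_mul_of_nonneg_left (Finset.sum_le_sum fun L hL =>
          mul_le_mul_of_nonneg_left ?_ (hb L hL)) (Finset.sum_nonneg hb)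
        rw [mul_sub_sub_potential_sub hmono]
        exact sq_sub_le_integral hmono hlip _ _
    _ = _ := by
        simp only [mul_left_comm (b _) (2 * (c : ℝ)), ← Finset.mul_sum]
        ring

theorem cell_energy_le {κ : Type*} (hmono : Monotone f) (hlip : LipschitzWith c f) {τ m : ℝ}
    (hτ : 0 ≤ τ) (hm : 0 < m) {s : Finset κ} {b : κ → ℝ} (hb : ∀ L ∈ s, 0 ≤ b L)
    (hcfl : τ * c * ∑ L ∈ s, b L ≤ m) (u : ℝ) (v : κ → ℝ) :
    m * (u - τ / m * ∑ L ∈ s, b L * (f u - f (v L))) ^ 2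
        + (∑ L ∈ s, b L) * (2 * τ * potential f u) ≤
      m * u ^ 2 + ∑ L ∈ s, b L * (2 * τ * potential f (v L)) := by
  set S := ∑ L ∈ s, b L * (f u - f (v L)) with hS
  set D := ∑ L ∈ s, b L * (u * (f u - f (v L)) - (potential f u - potential f (v L))) with hD
  have hD0 : 0 ≤ D := Finset.sum_nonneg fun L hL => mul_nonneg (hb L hL) (by
    rw [mul_sub_sub_potential_sub hmono]; exact integral_sub_nonneg hmono _ _)
  have hnumerical : (τ * S) ^ 2 / m ≤ 2 * τ * D := by
    rw [div_le_iff₀ hm]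
    calc (τ * S) ^ 2 = τ ^ 2 * S ^ 2 := mul_pow _ _ _
      _ ≤ τ ^ 2 * ((c * ∑ L ∈ s, b L) * (2 * D)) := by
          gcongr; exact sq_sum_mul_sub_le hmono hlip hb u v
      _ = 2 * τ * D * (τ * c * ∑ L ∈ s, b L) := by ring
      _ ≤ 2 * τ * D * m := by gcongr
  have hbalance : D = u * S - (∑ L ∈ s, b L) * potential f u
      + ∑ L ∈ s, b L * potential f (v L) := by
    rw [hD, hS, Finset.mul_sum, Finset.sum_mul, ← Finset.sum_sub_distrib, ← Finset.sum_add_distrib]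
    exact Finset.sum_congr rfl fun L _ => by ring
  have hexpand : m * (u - τ / m * S) ^ 2 = m * u ^ 2 - 2 * τ * (u * S) + (τ * S) ^ 2 / m := by
    field_simp
    ring
  simp only [mul_left_comm (b _), ← Finset.mul_sum]
  rw [hexpand]
  rw [hbalance] at hnumerical
  linarith

end Potential

section TotalEnergy

variable {ι : Type*} {s : ι → Finset ι}

theorem tsum_sum_comm_of_symm (hs : ∀ K L, L ∈ s K ↔ K ∈ s L) (B : ι → ι → ℝ≥0∞) :
    ∑' K, ∑ L ∈ s K, B K L = ∑' K, ∑ L ∈ s K, B L K := by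
  classical
  have hsum : ∀ (g : ι → ℝ≥0∞) K, ∑ L ∈ s K, g L = ∑' L, if L ∈ s K then g L else 0 :=
    fun g K => by
      rw [tsum_eq_sum (s := s K) fun L hL => if_neg hL]
      exact Finset.sum_congr rfl fun L hL => (if_pos hL).symm
  simp only [hsum]
  rw [ENNReal.tsum_comm]
  simp only [hs]

theorem tsum_inflow_eq_tsum_outflow (hs : ∀ K L, L ∈ s K ↔ K ∈ s L) {b : ι → ι → ℝ}
    (hb : ∀ K, ∀ L ∈ s K, 0 ≤ b K L) (hcons : ∀ K, ∑ L ∈ s K, b K L = ∑ L ∈ s K, b L K)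
    {g : ι → ℝ} (hg : ∀ K, 0 ≤ g K) :
    ∑' K, ENNReal.ofReal (∑ L ∈ s K, b K L * g L) =
      ∑' K, ENNReal.ofReal ((∑ L ∈ s K, b K L) * g K) :=
  calc ∑' K, ENNReal.ofReal (∑ L ∈ s K, b K L * g L)
      = ∑' K, ∑ L ∈ s K, ENNReal.ofReal (b K L * g L) := tsum_congr fun K =>
        ENNReal.ofReal_sum_of_nonneg fun L hL => mul_nonneg (hb K L hL) (hg L)
    _ = ∑' K, ∑ L ∈ s K, ENNReal.ofReal (b L K * g K) := tsum_sum_comm_of_symm hs _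
    _ = ∑' K, ENNReal.ofReal ((∑ L ∈ s K, b K L) * g K) := tsum_congr fun K => by
        rw [hcons, Finset.sum_mul, ENNReal.ofReal_sum_of_nonneg fun L hL =>
          mul_nonneg (hb L K ((hs K L).1 hL)) (hg K)]

theorem tsum_energy_le {f : ℝ → ℝ} {c : ℝ≥0} (hmono : Monotone f) (hlip : LipschitzWith c f)
    (hf0 : f 0 = 0) {τ : ℝ} (hτ : 0 ≤ τ) {m : ι → ℝ} (hm : ∀ K, 0 < m K)
    (hs : ∀ K L, L ∈ s K ↔ K ∈ s L) {b : ι → ι → ℝ} (hb : ∀ K, ∀ L ∈ s K, 0 ≤ b K L)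
    (hcons : ∀ K, ∑ L ∈ s K, b K L = ∑ L ∈ s K, b L K)
    (hcfl : ∀ K, τ * c * ∑ L ∈ s K, b K L ≤ m K) (u : ι → ℝ) :
    ∑' K, ENNReal.ofReal (m K *
        (u K - τ / m K * ∑ L ∈ s K, b K L * (f (u K) - f (u L))) ^ 2) ≤
      ∑' K, ENNReal.ofReal (m K * u K ^ 2) := by
  obtain htop | hfin := eq_or_ne (∑' K, ENNReal.ofReal (m K * u K ^ 2)) ∞
  · exact htop ▸ le_top
  have hΦ : ∀ K, 0 ≤ 2 * τ * potential f (u K) := fun K =>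
    mul_nonneg (by positivity) (potential_nonneg hmono _)
  have hb0 : ∀ K, 0 ≤ ∑ L ∈ s K, b K L := fun K => Finset.sum_nonneg (hb K)
  have houtflow : ∑' K, ENNReal.ofReal ((∑ L ∈ s K, b K L) * (2 * τ * potential f (u K))) ≠ ∞ := by
    refine ne_top_of_le_ne_top (ENNReal.mul_ne_top (ENNReal.ofReal_ne_top (r := 2)) hfin) ?_
    rw [← ENNReal.tsum_mul_left]
    refine ENNReal.tsum_le_tsum fun K => ?_
    rw [← ENNReal.ofReal_mul zero_le_two]
    refine ENNReal.ofReal_le_ofReal ?_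
    calc (∑ L ∈ s K, b K L) * (2 * τ * potential f (u K))
        ≤ (∑ L ∈ s K, b K L) * (2 * τ * (c * u K ^ 2)) := by
          have := hb0 K
          gcongr
          exact potential_le hmono hlip hf0 _
      _ = 2 * ((τ * c * ∑ L ∈ s K, b K L) * u K ^ 2) := by ring
      _ ≤ 2 * (m K * u K ^ 2) := by gcongr; exact hcfl K
  refine (ENNReal.add_le_add_iff_right houtflow).1 ?_
  nth_rw 2 [← tsum_inflow_eq_tsum_outflow hs hb hcons hΦ]
  rw [← ENNReal.tsum_add, ← ENNReal.tsum_add]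
  refine ENNReal.tsum_le_tsum fun K => ?_
  have hmK := (hm K).le
  rw [← ENNReal.ofReal_add (by positivity) (mul_nonneg (hb0 K) (hΦ K)),
    ← ENNReal.ofReal_add (by positivity)
      (Finset.sum_nonneg fun L hL => mul_nonneg (hb K L hL) (hΦ L))]
  exact ENNReal.ofReal_le_ofReal (cell_energy_le hmono hlip hτ (hm K) (hb K) (hcfl K) (u K) u)

end TotalEnergy

/-! ### Numerical fluxes -/

section Flux

variable {d : ℕ} {ι : Type*} (𝒯 : AdmissibleMesh d ι) {K L : ι}
  {v : ℝ → EuclideanSpace ℝ (Fin d) → EuclideanSpace ℝ (Fin d)} {T V τ : ℝ} {n : ℕ} {g : ℝ → ℝ}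

namespace AdmissibleMesh

theorem sum_area_le (hd : 1 ≤ d) (K : ι) :
    ∑ L ∈ 𝒯.neighborFinset hd K, 𝒯.area K L ≤ 1 / 𝒯.α * 𝒯.size ^ (d - 1) := by
  have hN : ∀ L ∈ 𝒯.neighborFinset hd K, L ∈ 𝒯.neighbors K := fun L hL =>
    (𝒯.mem_neighborFinset hd).1 hL
  have hnonneg : 0 ≤ 1 / 𝒯.α * 𝒯.size ^ (d - 1) :=
    mul_nonneg (one_div_nonneg.2 𝒯.α_pos.le) (pow_nonneg 𝒯.size_nonneg _)
  have hmeasure : ∑ L ∈ 𝒯.neighborFinset hd K, surface d (interface (𝒯.cell K) (𝒯.cell L)) ≤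
      ENNReal.ofReal (1 / 𝒯.α * 𝒯.size ^ (d - 1)) := by
    rw [← measure_biUnion_finset₀
      (fun L hL M hM => 𝒯.aedisjoint_interface (hN L hL) (hN M hM))
      fun L _ => (isClosed_interface _ _).measurableSet.nullMeasurableSet]
    exact (measure_mono <| Set.iUnion₂_subset fun L hL =>
      𝒯.interface_subset_frontier (hN L hL).1).trans (𝒯.boundary_le K)
  have hreal := ENNReal.toReal_mono ENNReal.ofReal_ne_top hmeasure
  rwa [ENNReal.toReal_ofReal hnonneg, ENNReal.toReal_sum fun L hL =>
    𝒯.surface_interface_ne_top (hN L hL).1] at hreal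

theorem mul_size_pow_le_vol (K : ι) : 𝒯.α * 𝒯.size ^ d ≤ 𝒯.vol K :=
  (ENNReal.ofReal_le_iff_le_toReal (𝒯.volume_cell_ne_top K)).1 (𝒯.volume_ge K)

theorem mul_sum_le_vol_of_cfl (hd : 1 ≤ d) {c : ℝ≥0} (hτ : 0 ≤ τ) (hV : 0 ≤ V)
    (hCFL : τ * (c * V) ≤ 𝒯.α ^ 2 * 𝒯.size) (K : ι) {b : ι → ℝ}
    (hb : ∀ L ∈ 𝒯.neighborFinset hd K, b L ≤ 𝒯.area K L * V) :
    τ * c * ∑ L ∈ 𝒯.neighborFinset hd K, b L ≤ 𝒯.vol K := by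
  have hα := 𝒯.α_pos
  have hsize := 𝒯.size_nonneg
  calc τ * c * ∑ L ∈ 𝒯.neighborFinset hd K, b L
      ≤ τ * c * ∑ L ∈ 𝒯.neighborFinset hd K, 𝒯.area K L * V := by gcongr with L hL; exact hb L hL
    _ = τ * (c * V) * ∑ L ∈ 𝒯.neighborFinset hd K, 𝒯.area K L := by
        rw [← Finset.sum_mul]; ring
    _ ≤ τ * (c * V) * (1 / 𝒯.α * 𝒯.size ^ (d - 1)) := by gcongr; exact 𝒯.sum_area_le hd K
    _ ≤ 𝒯.α ^ 2 * 𝒯.size * (1 / 𝒯.α * 𝒯.size ^ (d - 1)) := by gcongr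
    _ = 𝒯.α * 𝒯.size ^ d := by
        rw [← mul_pow_sub_one (Nat.ne_of_gt hd) 𝒯.size]
        field_simp
    _ ≤ 𝒯.vol K := 𝒯.mul_size_pow_le_vol K

/-- The surface integral of `g (v·n_{K,σ})` over the interface `σ = K|L` at time `t`. -/
noncomputable def interfaceIntegral
    (v : ℝ → EuclideanSpace ℝ (Fin d) → EuclideanSpace ℝ (Fin d)) (g : ℝ → ℝ) (K L : ι)
    (t : ℝ) : ℝ :=
  ∫ x in interface (𝒯.cell K) (𝒯.cell L), g (inner ℝ (v t x) (𝒯.normal K L)) ∂(surface d)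

theorem normalMean_eq (v : ℝ → EuclideanSpace ℝ (Fin d) → EuclideanSpace ℝ (Fin d)) (τ : ℝ)
    (g : ℝ → ℝ) (n : ℕ) (K L : ι) :
    𝒯.normalMean v τ g n K L = 1 / (τ * 𝒯.area K L) *
      ∫ t in (n * τ)..((n + 1) * τ), 𝒯.interfaceIntegral v g K L t :=
  rfl

theorem continuousOn_interfaceIntegral
    (hv : ContinuousOn (Function.uncurry v) (Set.Icc 0 T ×ˢ Set.univ)) (hg : Continuous g)
    (h : L ≠ K) : ContinuousOn (𝒯.interfaceIntegral v g K L) (Set.Icc 0 T) := by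
  obtain hT | hT := lt_or_ge T 0
  · simp [Set.Icc_eq_empty_of_lt hT]
  have : IsFiniteMeasure ((surface d).restrict (interface (𝒯.cell K) (𝒯.cell L))) :=
    ⟨by simpa using (𝒯.surface_interface_ne_top h).lt_top⟩
  have hproj : Continuous fun p : ℝ × EuclideanSpace ℝ (Fin d) =>
      ((Set.projIcc 0 T hT p.1 : ℝ), p.2) :=
    (continuous_subtype_val.comp (continuous_projIcc.comp continuous_fst)).prodMk continuous_snd
  have hextend : Continuous fun p : ℝ × EuclideanSpace ℝ (Fin d) =>
      v (Set.projIcc 0 T hT p.1) p.2 :=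
    hv.comp_continuous hproj fun p => ⟨(Set.projIcc 0 T hT p.1).2, trivial⟩
  have hcont := continuous_parametric_integral_of_continuous
    (f := fun t x => g (inner ℝ (v (Set.projIcc 0 T hT t) x) (𝒯.normal K L)))
    (μ := (surface d).restrict (interface (𝒯.cell K) (𝒯.cell L)))
    (hg.comp (hextend.inner (continuous_const (y := 𝒯.normal K L)))) (𝒯.isCompact_interface K L)
  refine hcont.continuousOn.congr fun t ht => ?_
  rw [interfaceIntegral, Measure.restrict_restrict (isClosed_interface _ _).measurableSet,
    Set.inter_self]
  simp only [Set.projIcc_of_mem hT ht]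

theorem interfaceIntegral_sub {t : ℝ} (hv : Continuous (v t)) {g' : ℝ → ℝ} (hg : Continuous g)
    (hg' : Continuous g') (h : L ≠ K) :
    𝒯.interfaceIntegral v (fun s => g s - g' s) K L t =
      𝒯.interfaceIntegral v g K L t - 𝒯.interfaceIntegral v g' K L t :=
  integral_sub (𝒯.integrableOn_interface h (hg.comp (hv.inner continuous_const)))
    (𝒯.integrableOn_interface h (hg'.comp (hv.inner continuous_const)))

theorem norm_interfaceIntegral_le (hg : ∀ s, |g s| ≤ |s|) {t : ℝ} (hv : ∀ x, ‖v t x‖ ≤ V)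
    (h : L ∈ 𝒯.neighbors K) : ‖𝒯.interfaceIntegral v g K L t‖ ≤ V * 𝒯.area K L :=
  norm_setIntegral_le_of_norm_le_const (𝒯.surface_interface_ne_top h.1).lt_top fun x _ =>
    calc ‖g (inner ℝ (v t x) (𝒯.normal K L))‖ ≤ |inner ℝ (v t x) (𝒯.normal K L)| := hg _
      _ ≤ ‖v t x‖ * ‖𝒯.normal K L‖ := abs_real_inner_le_norm _ _
      _ ≤ V := by rw [𝒯.norm_normal h, mul_one]; exact hv x

theorem contDiff_of_contDiffOn_uncurry
    (hv : ContDiffOn ℝ 1 (Function.uncurry v) (Set.Icc 0 T ×ˢ Set.univ)) {t : ℝ}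
    (ht : t ∈ Set.Icc 0 T) : ContDiff ℝ 1 (v t) :=
  hv.comp_contDiff (f := fun x => (t, x)) (by fun_prop) fun _ => ⟨ht, trivial⟩

theorem normalMean_symm (v : ℝ → EuclideanSpace ℝ (Fin d) → EuclideanSpace ℝ (Fin d)) (τ : ℝ)
    (g : ℝ → ℝ) (n : ℕ) (h : L ∈ 𝒯.neighbors K) :
    𝒯.normalMean v τ g n L K = 𝒯.normalMean v τ (fun s => g (-s)) n K L := by
  rw [normalMean, normalMean, interface_comm, 𝒯.normal_symm h, 𝒯.area_comm]
  simp only [inner_neg_right]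

theorem normalMean_id_symm (v : ℝ → EuclideanSpace ℝ (Fin d) → EuclideanSpace ℝ (Fin d)) (τ : ℝ)
    (n : ℕ) (h : L ∈ 𝒯.neighbors K) :
    𝒯.normalMean v τ id n L K = -𝒯.normalMean v τ id n K L := by
  rw [𝒯.normalMean_symm v τ id n h, normalMean, normalMean]
  simp only [id, integral_neg, intervalIntegral.integral_neg, mul_neg]

section TimeStep

variable (hτ : 0 ≤ τ)
include hτ

theorem natCast_mul_le_add_one_mul : n * τ ≤ (n + 1) * τ :=
  mul_le_mul_of_nonneg_right (by linarith) hτ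

theorem normalMean_nonneg (hg : ∀ s, 0 ≤ g s) : 0 ≤ 𝒯.normalMean v τ g n K L :=
  mul_nonneg (one_div_nonneg.2 (mul_nonneg hτ measureReal_nonneg))
    (intervalIntegral.integral_nonneg (natCast_mul_le_add_one_mul hτ) fun _ _ =>
      integral_nonneg fun _ => hg _)

variable (hnT : (n + 1) * τ ≤ T)
include hnT

theorem uIcc_subset_Icc_of_add_one_mul_le : Set.uIcc (n * τ) ((n + 1) * τ) ⊆ Set.Icc 0 T := by
  rw [Set.uIcc_of_le (natCast_mul_le_add_one_mul hτ)]
  exact Set.Icc_subset_Icc (by positivity) hnT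

theorem ae_mem_uIoc_imp_mem_Ico :
    ∀ᵐ t : ℝ, t ∈ Set.uIoc (n * τ) ((n + 1) * τ) → t ∈ Set.Ico 0 T := by
  filter_upwards [Measure.ae_ne volume T] with t htT ht
  have htI := uIcc_subset_Icc_of_add_one_mul_le hτ hnT (Set.uIoc_subset_uIcc ht)
  exact ⟨htI.1, lt_of_le_of_ne htI.2 htT⟩

theorem intervalIntegrable_interfaceIntegral
    (hv : ContinuousOn (Function.uncurry v) (Set.Icc 0 T ×ˢ Set.univ)) (hg : Continuous g)
    (h : L ≠ K) :
    IntervalIntegrable (𝒯.interfaceIntegral v g K L) volume (n * τ) ((n + 1) * τ) :=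
  ((𝒯.continuousOn_interfaceIntegral hv hg h).mono
    (uIcc_subset_Icc_of_add_one_mul_le hτ hnT)).intervalIntegrable

theorem normalMean_sub (hv : ContinuousOn (Function.uncurry v) (Set.Icc 0 T ×ˢ Set.univ))
    {g' : ℝ → ℝ} (hg : Continuous g) (hg' : Continuous g') (h : L ≠ K) :
    𝒯.normalMean v τ (fun s => g s - g' s) n K L =
      𝒯.normalMean v τ g n K L - 𝒯.normalMean v τ g' n K L := by
  have hvt : ∀ t ∈ Set.uIcc (n * τ) ((n + 1) * τ), Continuous (v t) := fun t ht =>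
    hv.comp_continuous (f := fun x => (t, x)) (by fun_prop)
      fun _ => ⟨uIcc_subset_Icc_of_add_one_mul_le hτ hnT ht, trivial⟩
  simp only [normalMean_eq]
  rw [← mul_sub, ← intervalIntegral.integral_sub
    (𝒯.intervalIntegrable_interfaceIntegral hτ hnT hv hg h)
    (𝒯.intervalIntegrable_interfaceIntegral hτ hnT hv hg' h)]
  congr 1
  exact intervalIntegral.integral_congr fun t ht =>
    𝒯.interfaceIntegral_sub (hvt t ht) hg hg' h

theorem abs_normalMean_le (hg : ∀ s, |g s| ≤ |s|) (hV : 0 ≤ V)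
    (hv : ∀ t ∈ Set.Ico 0 T, ∀ x, ‖v t x‖ ≤ V) (h : L ∈ 𝒯.neighbors K) :
    |𝒯.normalMean v τ g n K L| ≤ V := by
  have harea := 𝒯.area_pos h
  have hbound : ‖∫ t in (n * τ)..((n + 1) * τ), 𝒯.interfaceIntegral v g K L t‖ ≤
      V * 𝒯.area K L * |(n + 1) * τ - n * τ| :=
    intervalIntegral.norm_integral_le_of_norm_le_const_ae <| by
      filter_upwards [ae_mem_uIoc_imp_mem_Ico hτ hnT] with t ht htI
      exact 𝒯.norm_interfaceIntegral_le hg (hv t (ht htI)) h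
  rw [← sub_mul, add_sub_cancel_left, one_mul, abs_of_nonneg hτ, Real.norm_eq_abs] at hbound
  rw [normalMean_eq, abs_mul, abs_of_nonneg (one_div_nonneg.2 (by positivity)), one_div_mul_eq_div]
  exact div_le_of_le_mul₀ (by positivity) hV (hbound.trans_eq (by ring))

theorem sum_area_mul_normalMean_eq_zero (hd : 1 ≤ d)
    (hv : ContDiffOn ℝ 1 (Function.uncurry v) (Set.Icc 0 T ×ˢ Set.univ))
    (hdiv : ∀ t ∈ Set.Ico 0 T, ∀ x, divergence (v t) x = 0) (K : ι) :
    ∑ L ∈ 𝒯.neighborFinset hd K, 𝒯.area K L * 𝒯.normalMean v τ id n K L = 0 := by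
  have hN : ∀ L ∈ 𝒯.neighborFinset hd K, L ∈ 𝒯.neighbors K := fun L hL =>
    (𝒯.mem_neighborFinset hd).1 hL
  have hmul : ∀ L ∈ 𝒯.neighborFinset hd K, 𝒯.area K L * 𝒯.normalMean v τ id n K L =
      1 / τ * ∫ t in (n * τ)..((n + 1) * τ), 𝒯.interfaceIntegral v id K L t := fun L hL => by
    rw [normalMean_eq, ← mul_assoc, mul_one_div, mul_comm τ, div_mul_eq_div_div,
      div_self (𝒯.area_pos (hN L hL)).ne']
  rw [Finset.sum_congr rfl hmul, ← Finset.mul_sum,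
    ← intervalIntegral.integral_finsetSum fun L hL => 𝒯.intervalIntegrable_interfaceIntegral hτ hnT
      hv.continuousOn continuous_id (hN L hL).1, intervalIntegral.integral_zero_ae, mul_zero]
  filter_upwards [ae_mem_uIoc_imp_mem_Ico hτ hnT] with t ht htI
  refine (𝒯.integral_divergence_cell hd K
    (contDiff_of_contDiffOn_uncurry hv (Set.Ico_subset_Icc_self (ht htI)))).trans ?_
  simp only [hdiv t (ht htI), integral_zero]

end TimeStep

variable {f : ℝ → ℝ}

/-- The two-point flux `F n K L` is of upwind form for the velocity `v`: it is
`|σ| (q L K f(u_K) - q K L f(u_L))`, where `q K L ∈ [0, V]` is the speed at which `L` flows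
into `K` through `σ = K|L`, and the net outflow `q L K - q K L` is the mean normal velocity. -/
def IsUpwindForm (v : ℝ → EuclideanSpace ℝ (Fin d) → EuclideanSpace ℝ (Fin d)) (V τ : ℝ)
    (f : ℝ → ℝ) (n : ℕ) (F : ι → ι → ℝ → ℝ → ℝ) (q : ι → ι → ℝ) : Prop :=
  ∀ K, ∀ L ∈ 𝒯.neighbors K, 0 ≤ q K L ∧ q K L ≤ V ∧
    q L K - q K L = 𝒯.normalMean v τ id n K L ∧
    ∀ x y, F K L x y = 𝒯.area K L * (q L K * f x - q K L * f y)

theorem isUpwindForm_upwindFlux (hτ : 0 ≤ τ) (hnT : (n + 1) * τ ≤ T) (hV : 0 ≤ V)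
    (hv_bdd : ∀ t ∈ Set.Ico 0 T, ∀ x, ‖v t x‖ ≤ V) (f : ℝ → ℝ) :
    𝒯.IsUpwindForm v V τ f n (𝒯.upwindFlux v τ f n)
      fun K L => max (-𝒯.normalMean v τ id n K L) 0 := by
  intro K L hL
  have hle := 𝒯.abs_normalMean_le (g := id) hτ hnT (fun _ => le_rfl) hV hv_bdd hL
  simp only [𝒯.normalMean_id_symm v τ n hL, neg_neg]
  refine ⟨le_max_right _ _, max_le ((neg_le_abs _).trans hle) hV,
    max_zero_sub_max_neg_zero_eq_self _, fun x y => ?_⟩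
  rw [upwindFlux, mul_assoc]
  split_ifs with h
  · rw [max_eq_left h, max_eq_right (neg_nonpos.2 h), zero_mul, sub_zero]
  · rw [max_eq_right (not_le.1 h).le, max_eq_left (neg_nonneg.2 (not_le.1 h).le)]
    ring

theorem isUpwindForm_splitUpwindFlux (hτ : 0 ≤ τ) (hnT : (n + 1) * τ ≤ T) (hV : 0 ≤ V)
    (hv : ContinuousOn (Function.uncurry v) (Set.Icc 0 T ×ˢ Set.univ))
    (hv_bdd : ∀ t ∈ Set.Ico 0 T, ∀ x, ‖v t x‖ ≤ V) (f : ℝ → ℝ) :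
    𝒯.IsUpwindForm v V τ f n (𝒯.splitUpwindFlux v τ f n)
      (𝒯.normalMean v τ (fun s => max (-s) 0) n) := by
  intro K L hL
  have hle := 𝒯.abs_normalMean_le (g := fun s => max (-s) 0) hτ hnT
    (fun s => by rw [abs_of_nonneg (le_max_right _ _)]; exact max_le (neg_le_abs s) (abs_nonneg s))
    hV hv_bdd hL
  have hsymm := 𝒯.normalMean_symm v τ (fun s => max (-s) 0) n hL
  simp only [neg_neg] at hsymm
  refine ⟨𝒯.normalMean_nonneg hτ fun _ => le_max_right _ _, (le_abs_self _).trans hle, ?_,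
    fun x y => by rw [splitUpwindFlux, hsymm]⟩
  rw [hsymm, ← 𝒯.normalMean_sub hτ hnT hv (by fun_prop) (by fun_prop) hL.1]
  simp only [max_zero_sub_max_neg_zero_eq_self]
  rfl

theorem IsUpwindForm.tsum_energy_le {F : ι → ι → ℝ → ℝ → ℝ} {q : ι → ι → ℝ}
    (hF : 𝒯.IsUpwindForm v V τ f n F q) (hd : 1 ≤ d) {c : ℝ≥0} (hmono : Monotone f)
    (hlip : LipschitzWith c f) (hf0 : f 0 = 0) (hτ : 0 ≤ τ) (hnT : (n + 1) * τ ≤ T) (hV : 0 ≤ V)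
    (hv : ContDiffOn ℝ 1 (Function.uncurry v) (Set.Icc 0 T ×ˢ Set.univ))
    (hdiv : ∀ t ∈ Set.Ico 0 T, ∀ x, divergence (v t) x = 0)
    (hCFL : τ * (c * V) ≤ 𝒯.α ^ 2 * 𝒯.size) (u : ι → ℝ) :
    ∑' K, ENNReal.ofReal (𝒯.vol K *
        (u K - τ / 𝒯.vol K * ∑ L ∈ 𝒯.neighborFinset hd K, F K L (u K) (u L)) ^ 2) ≤
      ∑' K, ENNReal.ofReal (𝒯.vol K * u K ^ 2) := by
  have hN : ∀ K, ∀ L ∈ 𝒯.neighborFinset hd K, L ∈ 𝒯.neighbors K := fun K L hL =>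
    (𝒯.mem_neighborFinset hd).1 hL
  let b : ι → ι → ℝ := fun K L => 𝒯.area K L * q K L
  have hb_swap : ∀ K L, b L K = 𝒯.area K L * q L K := fun K L => by rw [𝒯.area_comm K L]
  have hcons : ∀ K, ∑ L ∈ 𝒯.neighborFinset hd K, b K L = ∑ L ∈ 𝒯.neighborFinset hd K, b L K :=
    fun K => by
      refine (sub_eq_zero.1 ?_).symm
      rw [← Finset.sum_sub_distrib, ← 𝒯.sum_area_mul_normalMean_eq_zero hτ hnT hd hv hdiv K]
      refine Finset.sum_congr rfl fun L hL => ?_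
      rw [← (hF K L (hN K L hL)).2.2.1, mul_sub, hb_swap]
  have hflux : ∀ K, ∑ L ∈ 𝒯.neighborFinset hd K, F K L (u K) (u L) =
      ∑ L ∈ 𝒯.neighborFinset hd K, b K L * (f (u K) - f (u L)) := fun K => by
    simp only [mul_sub, Finset.sum_sub_distrib, ← Finset.sum_mul]
    rw [hcons, Finset.sum_mul, ← Finset.sum_sub_distrib]
    refine Finset.sum_congr rfl fun L hL => ?_
    rw [(hF K L (hN K L hL)).2.2.2, hb_swap]
    ring
  simp only [hflux]
  refine UpwindFV.tsum_energy_le hmono hlip hf0 hτ (𝒯.vol_pos) (fun K L => ?_) (fun K L hL => ?_)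
    hcons (fun K => 𝒯.mul_sum_le_vol_of_cfl hd hτ hV hCFL K fun L hL => ?_) u
  · simp only [mem_neighborFinset]
    exact ⟨𝒯.mem_neighbors_symm, 𝒯.mem_neighbors_symm⟩
  · exact mul_nonneg measureReal_nonneg (hF K L (hN K L hL)).1
  · exact mul_le_mul_of_nonneg_left (hF K L (hN K L hL)).2.1 measureReal_nonneg

end AdmissibleMesh

end Flux

/-! ### The Itô isometry for compensated Poisson integrals -/

section SquareIntegrable

variable {X : Type*} {mX : MeasurableSpace X} {μ : Measure X}

theorem eLpNorm_two_sq (f : X → ℝ) : eLpNorm f 2 μ ^ 2 = ∫⁻ x, ENNReal.ofReal (f x ^ 2) ∂μ := by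
  have hpow := eLpNorm_nnreal_pow_eq_lintegral (μ := μ) (f := f) (p := 2) two_ne_zero
  simp only [NNReal.coe_ofNat, ENNReal.coe_ofNat, ENNReal.rpow_ofNat] at hpow
  rw [hpow]
  refine lintegral_congr fun x => ?_
  rw [← ofReal_norm, ← ENNReal.ofReal_pow (norm_nonneg _), Real.norm_eq_abs, sq_abs]

theorem eLpNorm_two_sq_eq_ofReal_integral {f : X → ℝ} (hf : MemLp f 2 μ) :
    eLpNorm f 2 μ ^ 2 = ENNReal.ofReal (∫ x, f x ^ 2 ∂μ) := by
  rw [eLpNorm_two_sq, ofReal_integral_eq_lintegral_ofReal hf.integrable_sq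
    (ae_of_all _ fun _ => sq_nonneg _)]

theorem integral_sum_sq_of_pairwise_orthogonal {κ : Type*} {s : Finset κ} {Z : κ → X → ℝ}
    (hZ : ∀ k ∈ s, MemLp (Z k) 2 μ)
    (horth : (s : Set κ).Pairwise fun k l => ∫ x, Z k x * Z l x ∂μ = 0) :
    ∫ x, (∑ k ∈ s, Z k x) ^ 2 ∂μ = ∑ k ∈ s, ∫ x, Z k x ^ 2 ∂μ := by
  have hint : ∀ k ∈ s, ∀ l ∈ s, Integrable (fun x => Z k x * Z l x) μ := fun k hk l hl =>
    (hZ k hk).integrable_mul (hZ l hl)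
  simp only [sq, Finset.sum_mul_sum]
  rw [integral_finsetSum _ fun k hk => integrable_finsetSum _ (hint k hk)]
  refine Finset.sum_congr rfl fun k hk => ?_
  rw [integral_finsetSum _ (hint k hk)]
  exact Finset.sum_eq_single_of_mem k hk fun l hl hlk => horth hk hl hlk.symm

theorem tendsto_eLpNorm_of_tendsto_eLpNorm_sub {F : Type*} [NormedAddCommGroup F] {p : ℝ≥0∞}
    (hp : 1 ≤ p) {f : ℕ → X → F} {g : X → F} (hf : ∀ k, AEStronglyMeasurable (f k) μ)
    (hg : AEStronglyMeasurable g μ)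
    (h : Tendsto (fun k => eLpNorm (fun x => f k x - g x) p μ) atTop (𝓝 0)) :
    Tendsto (fun k => eLpNorm (f k) p μ) atTop (𝓝 (eLpNorm g p μ)) := by
  have hlower : ∀ k, eLpNorm g p μ - eLpNorm (fun x => f k x - g x) p μ ≤ eLpNorm (f k) p μ :=
    fun k => tsub_le_iff_right.2 <| by
      have h := eLpNorm_sub_le (hf k) ((hf k).sub hg) hp
      rwa [sub_sub_cancel] at h
  have hupper : ∀ k, eLpNorm (f k) p μ ≤ eLpNorm g p μ + eLpNorm (fun x => f k x - g x) p μ :=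
    fun k => by
      have h := eLpNorm_add_le hg ((hf k).sub hg) hp
      rwa [add_sub_cancel] at h
  refine tendsto_of_tendsto_of_tendsto_of_le_of_le ?_ ?_ hlower hupper
  · simpa only [tsub_zero] using
      ENNReal.Tendsto.sub tendsto_const_nhds h (Or.inr ENNReal.zero_ne_top)
  · simpa only [add_zero] using h.const_add (eLpNorm g p μ)

theorem tendsto_integral_mul_of_tendsto_eLpNorm_sub {f : ℕ → X → ℝ} {g Y : X → ℝ}
    (hY : MemLp Y 2 μ) (hf : ∀ k, MemLp (f k) 2 μ) (hg : MemLp g 2 μ)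
    (h : Tendsto (fun k => eLpNorm (fun x => f k x - g x) 2 μ) atTop (𝓝 0)) :
    Tendsto (fun k => ∫ x, Y x * f k x ∂μ) atTop (𝓝 (∫ x, Y x * g x ∂μ)) := by
  have hbound : ∀ k, eLpNorm (Y * f k - Y * g) 1 μ ≤
      eLpNorm Y 2 μ * eLpNorm (fun x => f k x - g x) 2 μ := fun k => by
    rw [← mul_sub]
    have h := eLpNorm_smul_le_mul_eLpNorm (p := 2) (q := 2) (r := 1) ((hf k).sub hg).1 hY.1
    exact h
  have hlim := ENNReal.Tendsto.const_mul h (Or.inr hY.2.ne)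
  rw [mul_zero] at hlim
  exact tendsto_integral_of_L1' _ (hY.integrable_mul hg).aestronglyMeasurable
    (Eventually.of_forall fun k => hY.integrable_mul (hf k))
    (tendsto_of_tendsto_of_tendsto_of_le_of_le tendsto_const_nhds hlim (fun _ => zero_le) hbound)

theorem aestronglyMeasurable_of_tendsto_eLpNorm_sub {F : Type*} [NormedAddCommGroup F]
    [CompleteSpace F] {p : ℝ≥0∞} (hp : p ≠ 0) {m' : MeasurableSpace X} (hm : m' ≤ mX)
    {f : ℕ → X → F} {g : X → F} (hf : ∀ k, StronglyMeasurable[m'] (f k))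
    (hg : AEStronglyMeasurable[mX] g μ)
    (h : Tendsto (fun k => eLpNorm (fun x => f k x - g x) p μ) atTop (𝓝 0)) :
    AEStronglyMeasurable[m'] g μ := by
  obtain ⟨ns, -, hns⟩ := (tendstoInMeasure_of_tendsto_eLpNorm hp
    (fun k => ((hf k).mono hm).aestronglyMeasurable) hg h).exists_seq_tendsto_ae
  exact ⟨fun x => limUnder atTop fun i => f (ns i) x,
    StronglyMeasurable.limUnder fun i => hf (ns i), hns.mono fun _ hx => hx.limUnder_eq.symm⟩

end SquareIntegrable

section PoissonMoments

variable (r : ℝ≥0)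

theorem hasSum_poisson_natCast_mul {φ : ℕ → ℝ} {a : ℝ}
    (h : HasSum (fun n : ℕ => Real.exp (-r) * r ^ n / n.factorial * φ (n + 1)) a) :
    HasSum (fun n : ℕ => Real.exp (-r) * r ^ n / n.factorial * (n * φ n)) (r * a) := by
  rw [← hasSum_nat_add_iff' 1]
  simp only [Finset.range_one, Finset.sum_singleton, Nat.cast_zero, zero_mul, mul_zero, sub_zero]
  refine (h.mul_left (r : ℝ)).congr_fun fun n => ?_
  rw [Nat.factorial_succ]
  push_cast
  field_simp
  ring

theorem hasSum_poisson_natCast :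
    HasSum (fun n : ℕ => Real.exp (-r) * r ^ n / n.factorial * (n : ℝ)) r := by
  have h := hasSum_poisson_natCast_mul r (φ := fun _ => 1) (a := 1)
    (by simpa only [mul_one] using hasSum_one_poissonMeasure r)
  simpa only [mul_one] using h

theorem hasSum_poisson_natCast_sq :
    HasSum (fun n : ℕ => Real.exp (-r) * r ^ n / n.factorial * (n : ℝ) ^ 2) (r * (r + 1)) := by
  simp only [sq]
  refine hasSum_poisson_natCast_mul r
    (((hasSum_poisson_natCast r).add (hasSum_one_poissonMeasure r)).congr_fun fun n => ?_)
  push_cast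
  ring

theorem memLp_sub_poissonMeasure : MemLp (fun k : ℕ => (k : ℝ) - r) 2 (poissonMeasure r) := by
  have hcast : MemLp (fun k : ℕ => (k : ℝ)) 2 (poissonMeasure r) := by
    rw [memLp_two_iff_integrable_sq .of_discrete, integrable_poissonMeasure_iff]
    refine (hasSum_poisson_natCast_sq r).summable.congr fun n => ?_
    rw [Real.norm_of_nonneg (sq_nonneg _)]
  exact hcast.sub (memLp_const _)

theorem integral_sub_poissonMeasure : ∫ k : ℕ, ((k : ℝ) - r) ∂(poissonMeasure r) = 0 := by
  have hsum := (hasSum_poisson_natCast r).sub ((hasSum_one_poissonMeasure r).mul_right (r : ℝ))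
  rw [one_mul, sub_self] at hsum
  rw [integral_poissonMeasure, ← hsum.tsum_eq]
  simp only [smul_eq_mul, mul_sub]

theorem integral_sub_sq_poissonMeasure :
    ∫ k : ℕ, ((k : ℝ) - r) ^ 2 ∂(poissonMeasure r) = r := by
  have hsum := ((hasSum_poisson_natCast_sq r).sub
    ((hasSum_poisson_natCast r).mul_right (2 * (r : ℝ)))).add
    ((hasSum_one_poissonMeasure r).mul_right ((r : ℝ) ^ 2))
  rw [show (r : ℝ) * (r + 1) - r * (2 * r) + 1 * r ^ 2 = r by ring] at hsum
  rw [integral_poissonMeasure]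
  refine Eq.trans (tsum_congr fun n => ?_) hsum.tsum_eq
  rw [smul_eq_mul]
  ring

end PoissonMoments

section ItoIsometry

variable {Ω E : Type*} {mΩ : MeasurableSpace Ω} [MeasurableSpace E] {P : Measure Ω}
  {ℱ : Filtration ℝ≥0 mΩ} {m : Measure E} {Nm : Ω → Measure (ℝ × E)}

/-- The compensated random measure `Ñ((s,t] × A)`. -/
noncomputable def increment (m : Measure E) (Nm : Ω → Measure (ℝ × E)) (s t : ℝ≥0) (A : Set E)
    (ω : Ω) : ℝ :=
  (Nm ω (Set.Ioc (s : ℝ) t ×ˢ A)).toReal - ((t : ℝ) - s) * (m A).toReal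

/-- The σ-algebra generated by the random measure of the sets lying after time `s`. -/
@[reducible] def future (Nm : Ω → Measure (ℝ × E)) (s : ℝ≥0) : MeasurableSpace Ω :=
  ⨆ B : {B : Set (ℝ × E) // MeasurableSet B ∧ B ⊆ Set.Ioi (s : ℝ) ×ˢ Set.univ},
    MeasurableSpace.comap (fun ω => Nm ω B.1) inferInstance

/-- The measure `dP ⊗ dt ⊗ dm` on `Ω × (a,b] × E`, with respect to which integrands of stochastic
integrals over `(a,b]` are square integrable. -/
noncomputable abbrev integrandMeasure (P : Measure Ω) (m : Measure E) (a b : ℝ≥0) :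
    Measure (Ω × (ℝ × E)) :=
  P.prod ((volume.restrict (Set.Ioc (a : ℝ) b)).prod m)

theorem intensity_Ioc_prod [SFinite m] (s t : ℝ≥0) (A : Set E) :
    ((volume.restrict (Set.Ici (0 : ℝ))).prod m) (Set.Ioc (s : ℝ) t ×ˢ A) =
      ENNReal.ofReal ((t : ℝ) - s) * m A := by
  have hsub : Set.Ioc (s : ℝ) t ⊆ Set.Ici 0 := fun x hx => s.2.trans hx.1.le
  rw [Measure.prod_prod, Measure.restrict_apply measurableSet_Ioc, Set.inter_eq_left.2 hsub,
    Real.volume_Ioc]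

theorem measurable_increment_future (s t : ℝ≥0) {A : Set E} (hA : MeasurableSet A) :
    Measurable[future Nm s] (increment m Nm s t A) := by
  have h : Measurable[future Nm s] fun ω => Nm ω (Set.Ioc (s : ℝ) t ×ˢ A) :=
    measurable_iff_comap_le.2 <| le_iSup (fun B : {B : Set (ℝ × E) // MeasurableSet B ∧
      B ⊆ Set.Ioi (s : ℝ) ×ˢ Set.univ} => MeasurableSpace.comap (fun ω => Nm ω B.1) inferInstance)
      ⟨Set.Ioc (s : ℝ) t ×ˢ A, measurableSet_Ioc.prod hA, fun _ hx => ⟨hx.1.1, trivial⟩⟩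
  exact h.ennreal_toReal.sub_const _

namespace IsFiltrationPoisson

variable (hNm : IsFiltrationPoisson P ℱ m Nm)
include hNm

theorem measurable_increment (s t : ℝ≥0) {A : Set E} (hA : MeasurableSet A) :
    Measurable (increment m Nm s t A) :=
  ((hNm.poisson.measurable _ (measurableSet_Ioc.prod hA)).ennreal_toReal).sub_const _

theorem measurable_increment_filtration (s t : ℝ≥0) {A : Set E} (hA : MeasurableSet A) :
    Measurable[ℱ t] (increment m Nm s t A) := by
  refine ((hNm.adapted t _ (measurableSet_Ioc.prod hA) ?_).ennreal_toReal).sub_const _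
  exact fun x hx => ⟨⟨s.2.trans hx.1.1.le, hx.1.2⟩, trivial⟩

theorem map_increment [SFinite m] {s t : ℝ≥0} (hst : s ≤ t) {A : Set E}
    (hA : MeasurableSet A) (hAm : m A ≠ ∞) :
    ∃ r : ℝ≥0, (r : ℝ) = ((t : ℝ) - s) * (m A).toReal ∧
      P.map (increment m Nm s t A) = (poissonMeasure r).map fun k : ℕ => (k : ℝ) - r := by
  have hB : MeasurableSet (Set.Ioc (s : ℝ) t ×ˢ A) := measurableSet_Ioc.prod hA
  have hlaw := hNm.poisson.law _ hB
  rw [intensity_Ioc_prod] at hlaw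
  set r : ℝ≥0 := (ENNReal.ofReal ((t : ℝ) - s) * m A).toNNReal
  have hr : (r : ℝ) = ((t : ℝ) - s) * (m A).toReal := by
    rw [ENNReal.coe_toNNReal_eq_toReal, ENNReal.toReal_mul,
      ENNReal.toReal_ofReal (sub_nonneg.2 (NNReal.coe_le_coe.2 hst))]
  have hcenter : Measurable fun x : ℝ≥0∞ => x.toReal - (r : ℝ) := by fun_prop
  have hincr : increment m Nm s t A =
      (fun x : ℝ≥0∞ => x.toReal - (r : ℝ)) ∘ fun ω => Nm ω (Set.Ioc (s : ℝ) t ×ˢ A) := by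
    ext ω
    simp only [increment, hr, Function.comp_apply]
  refine ⟨r, hr, ?_⟩
  rw [hincr, ← Measure.map_map hcenter (hNm.poisson.measurable _ hB),
    hlaw (ENNReal.mul_ne_top ENNReal.ofReal_ne_top hAm), Measure.map_map hcenter .of_discrete]
  rfl

theorem memLp_increment [SFinite m] {s t : ℝ≥0} (hst : s ≤ t) {A : Set E}
    (hA : MeasurableSet A) (hAm : m A ≠ ∞) : MemLp (increment m Nm s t A) 2 P := by
  obtain ⟨r, -, hlaw⟩ := hNm.map_increment hst hA hAm
  have hid : MemLp id 2 (P.map (increment m Nm s t A)) := by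
    rw [hlaw, memLp_map_measure_iff measurable_id.aestronglyMeasurable
      Measurable.of_discrete.aemeasurable]
    exact memLp_sub_poissonMeasure r
  exact (memLp_map_measure_iff measurable_id.aestronglyMeasurable
    (hNm.measurable_increment s t hA).aemeasurable).1 hid

theorem integral_increment [SFinite m] {s t : ℝ≥0} (hst : s ≤ t) {A : Set E}
    (hA : MeasurableSet A) (hAm : m A ≠ ∞) : ∫ ω, increment m Nm s t A ω ∂P = 0 := by
  obtain ⟨r, -, hlaw⟩ := hNm.map_increment hst hA hAm
  rw [← integral_map (f := fun x : ℝ => x) (hNm.measurable_increment s t hA).aemeasurable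
      measurable_id.aestronglyMeasurable, hlaw,
    integral_map (f := fun x : ℝ => x) Measurable.of_discrete.aemeasurable
      measurable_id.aestronglyMeasurable, integral_sub_poissonMeasure]

theorem integral_increment_sq [SFinite m] {s t : ℝ≥0} (hst : s ≤ t) {A : Set E}
    (hA : MeasurableSet A) (hAm : m A ≠ ∞) :
    ∫ ω, increment m Nm s t A ω ^ 2 ∂P = ((t : ℝ) - s) * (m A).toReal := by
  obtain ⟨r, hr, hlaw⟩ := hNm.map_increment hst hA hAm
  have hsq : Measurable fun x : ℝ => x ^ 2 := by fun_prop
  rw [← integral_map (f := fun x : ℝ => x ^ 2) (hNm.measurable_increment s t hA).aemeasurable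
      hsq.aestronglyMeasurable, hlaw,
    integral_map Measurable.of_discrete.aemeasurable hsq.aestronglyMeasurable,
    integral_sub_sq_poissonMeasure, hr]

theorem integral_mul_future {s : ℝ≥0} {Y Z : Ω → ℝ} (hY : Measurable[ℱ s] Y)
    (hZ : Measurable[future Nm s] Z) (hZ' : Measurable Z) :
    ∫ ω, Y ω * Z ω ∂P = (∫ ω, Y ω ∂P) * ∫ ω, Z ω ∂P := by
  have hind : IndepFun Z Y P := by
    rw [IndepFun_iff_Indep]
    exact indep_of_indep_of_le (hNm.indep_future s) hZ.comap_le hY.comap_le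
  exact hind.symm.integral_fun_mul_eq_mul_integral (hY.mono (ℱ.le s) le_rfl).aestronglyMeasurable
    hZ'.aestronglyMeasurable

theorem integral_mul_increment [SFinite m] {s t : ℝ≥0} (hst : s ≤ t) {A : Set E}
    (hA : MeasurableSet A) (hAm : m A ≠ ∞) {Y : Ω → ℝ} (hY : Measurable[ℱ s] Y) :
    ∫ ω, Y ω * increment m Nm s t A ω ∂P = 0 := by
  rw [hNm.integral_mul_future hY (measurable_increment_future s t hA)
    (hNm.measurable_increment s t hA), hNm.integral_increment hst hA hAm, mul_zero]

theorem indepFun_increment (s t : ℝ≥0) {A A' : Set E} (hA : MeasurableSet A)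
    (hA' : MeasurableSet A') (hAA' : Disjoint A A') :
    IndepFun (increment m Nm s t A) (increment m Nm s t A') P := by
  have hdisj : Disjoint (Set.Ioc (s : ℝ) t ×ˢ A) (Set.Ioc (s : ℝ) t ×ˢ A') :=
    Set.Disjoint.set_prod_right hAA' _ _
  have hindep := hNm.poisson.indep 2 ![Set.Ioc (s : ℝ) t ×ˢ A, Set.Ioc (s : ℝ) t ×ˢ A']
    (Fin.forall_fin_two.2 ⟨measurableSet_Ioc.prod hA, measurableSet_Ioc.prod hA'⟩)
    (by
      intro i j hij
      fin_cases i <;> fin_cases j <;>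
        first | exact absurd rfl hij | exact hdisj | exact hdisj.symm)
  exact (hindep.indepFun (i := 0) (j := 1) (by decide)).comp
    (φ := fun x : ℝ≥0∞ => x.toReal - ((t : ℝ) - s) * (m A).toReal)
    (ψ := fun x : ℝ≥0∞ => x.toReal - ((t : ℝ) - s) * (m A').toReal) (by fun_prop) (by fun_prop)

theorem integral_increment_mul_increment [SFinite m] {s t : ℝ≥0} (hst : s ≤ t) {A A' : Set E}
    (hA : MeasurableSet A) (hAm : m A ≠ ∞) (hA' : MeasurableSet A') (hAA' : Disjoint A A') :
    ∫ ω, increment m Nm s t A ω * increment m Nm s t A' ω ∂P = 0 := by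
  rw [(hNm.indepFun_increment s t hA hA' hAA').integral_fun_mul_eq_mul_integral
    (hNm.measurable_increment s t hA).aestronglyMeasurable
    (hNm.measurable_increment s t hA').aestronglyMeasurable, hNm.integral_increment hst hA hAm,
    zero_mul]

end IsFiltrationPoisson

namespace SimplePredictable

variable {a b : ℝ≥0} (S : SimplePredictable ℱ m a b)

/-- The set `(τ i, τ (i+1)] × A j` on which a simple predictable function equals `ξ i j`. -/
def block (k : Fin S.p × Fin S.q) : Set (ℝ × E) :=
  Set.Ioc (S.τ k.1 : ℝ) (S.τ (k.1 + 1)) ×ˢ S.A k.2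

/-- The contribution of one block to a simple predictable function. -/
noncomputable def summand (k : Fin S.p × Fin S.q) (y : Ω × (ℝ × E)) : ℝ :=
  S.ξ k.1 k.2 y.1 * (S.block k).indicator 1 y.2

/-- The contribution of one block to the integral of a simple predictable function. -/
noncomputable def term (Nm : Ω → Measure (ℝ × E)) (k : Fin S.p × Fin S.q) (ω : Ω) : ℝ :=
  S.ξ k.1 k.2 ω * increment m Nm (S.τ k.1) (S.τ (k.1 + 1)) (S.A k.2) ω

theorem toFun_eq_sum_summand (y : Ω × (ℝ × E)) :
    S.toFun y.1 y.2.1 y.2.2 = ∑ k, S.summand k y := by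
  rw [Fintype.sum_prod_type]
  refine Finset.sum_congr rfl fun i _ => Finset.sum_congr rfl fun j _ => ?_
  rw [summand, mul_assoc]
  congr 1
  by_cases ht : y.2.1 ∈ Set.Ioc (S.τ i : ℝ) (S.τ (i + 1)) <;> by_cases hz : y.2.2 ∈ S.A j <;>
    simp [block, Set.indicator, Set.mem_prod, ht, hz]

theorem integral_eq_sum_term (ω : Ω) : S.integral Nm ω = ∑ k, S.term Nm k ω := by
  rw [Fintype.sum_prod_type]
  rfl

theorem τ_le_succ (i : ℕ) : S.τ i ≤ S.τ (i + 1) := S.τ_mono (Nat.le_succ i)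

theorem τ_succ_le (i : Fin S.p) : S.τ (i + 1) ≤ b := (S.τ_mono i.2).trans_eq S.τ_last

theorem le_τ (i : ℕ) : a ≤ S.τ i := S.τ_zero.symm.trans_le (S.τ_mono (Nat.zero_le i))

theorem measurable_ξ (i : Fin S.p) (j : Fin S.q) : Measurable (S.ξ i j) :=
  (S.ξ_meas i j).mono (ℱ.le _) le_rfl

theorem memLp_ξ [IsFiniteMeasure P] (i : Fin S.p) (j : Fin S.q) : MemLp (S.ξ i j) 2 P := by
  obtain ⟨C, hC⟩ := S.ξ_bdd
  exact MemLp.of_bound (S.measurable_ξ i j).aestronglyMeasurable C (ae_of_all _ fun ω => hC i j ω)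

theorem measurableSet_block (k : Fin S.p × Fin S.q) : MeasurableSet (S.block k) :=
  measurableSet_Ioc.prod (S.A_meas k.2)

theorem measurable_summand (k : Fin S.p × Fin S.q) : Measurable (S.summand k) :=
  ((S.measurable_ξ k.1 k.2).comp measurable_fst).mul
    ((measurable_one.indicator (S.measurableSet_block k)).comp measurable_snd)

theorem measurable_toFun : Measurable fun y : Ω × (ℝ × E) => S.toFun y.1 y.2.1 y.2.2 := by
  simp_rw [S.toFun_eq_sum_summand]
  exact Finset.measurable_sum _ fun k _ => S.measurable_summand k

theorem disjoint_block_of_lt {k l : Fin S.p × Fin S.q} (h : k.1 < l.1) :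
    Disjoint (S.block k) (S.block l) := by
  refine Set.disjoint_left.2 fun y hk hl => ?_
  have hτ : (S.τ (k.1 + 1) : ℝ) ≤ S.τ l.1 := NNReal.coe_le_coe.2 (S.τ_mono h)
  exact (hk.1.2.trans hτ).not_gt hl.1.1

theorem pairwise_disjoint_block : Pairwise (Function.onFun Disjoint S.block) := by
  intro k l hkl
  rcases lt_trichotomy k.1 l.1 with hlt | heq | hgt
  · exact S.disjoint_block_of_lt hlt
  · exact Set.Disjoint.set_prod_right (S.A_disj fun h => hkl (Prod.ext heq h)) _ _
  · exact (S.disjoint_block_of_lt hgt).symm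

theorem toFun_sq_eq_sum_summand_sq (y : Ω × (ℝ × E)) :
    S.toFun y.1 y.2.1 y.2.2 ^ 2 = ∑ k, S.summand k y ^ 2 := by
  rw [S.toFun_eq_sum_summand, sq, Finset.sum_mul_sum]
  refine Finset.sum_congr rfl fun k _ => ?_
  rw [Finset.sum_eq_single_of_mem k (Finset.mem_univ k), sq]
  intro l _ hl
  by_cases hk : y.2 ∈ S.block k
  · rw [summand, summand, Set.indicator_of_notMem
      (Set.disjoint_left.1 (S.pairwise_disjoint_block hl.symm) hk), mul_zero, mul_zero]
  · rw [summand, summand, Set.indicator_of_notMem hk, mul_zero, zero_mul]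

theorem lintegral_summand_sq [SFinite m] (k : Fin S.p × Fin S.q) :
    ∫⁻ y, ENNReal.ofReal (S.summand k y ^ 2) ∂(integrandMeasure P m a b) =
      (∫⁻ ω, ENNReal.ofReal (S.ξ k.1 k.2 ω ^ 2) ∂P) *
        (ENNReal.ofReal ((S.τ (k.1 + 1) : ℝ) - S.τ k.1) * m (S.A k.2)) := by
  have hsq : ∀ y : Ω × (ℝ × E), ENNReal.ofReal (S.summand k y ^ 2) =
      ENNReal.ofReal (S.ξ k.1 k.2 y.1 ^ 2) * (S.block k).indicator 1 y.2 := by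
    intro y
    by_cases h : y.2 ∈ S.block k <;> simp [summand, h]
  have hIoc : Set.Ioc (S.τ k.1 : ℝ) (S.τ (k.1 + 1)) ⊆ Set.Ioc (a : ℝ) b :=
    Set.Ioc_subset_Ioc (NNReal.coe_le_coe.2 (S.le_τ _)) (NNReal.coe_le_coe.2 (S.τ_succ_le _))
  simp_rw [hsq]
  rw [lintegral_prod_mul ((S.measurable_ξ k.1 k.2).pow_const 2).ennreal_ofReal.aemeasurable
    (measurable_one.indicator (S.measurableSet_block k)).aemeasurable,
    lintegral_indicator_one (S.measurableSet_block k), block, Measure.prod_prod,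
    Measure.restrict_apply measurableSet_Ioc, Set.inter_eq_left.2 hIoc, Real.volume_Ioc]

variable (hNm : IsFiltrationPoisson P ℱ m Nm)
include hNm

theorem measurable_term (k : Fin S.p × Fin S.q) : Measurable[ℱ (S.τ (k.1 + 1))] (S.term Nm k) :=
  ((S.ξ_meas k.1 k.2).mono (ℱ.mono (S.τ_le_succ _)) le_rfl).mul
    (hNm.measurable_increment_filtration _ _ (S.A_meas _))

theorem memLp_term [SFinite m] (k : Fin S.p × Fin S.q) : MemLp (S.term Nm k) 2 P := by
  obtain ⟨C, hC⟩ := S.ξ_bdd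
  refine (hNm.memLp_increment (S.τ_le_succ k.1) (S.A_meas k.2) (S.A_fin k.2)).of_le_mul (c := C)
    ((S.measurable_term hNm k).mono (ℱ.le _) le_rfl).aestronglyMeasurable
    (ae_of_all _ fun ω => ?_)
  rw [term, norm_mul]
  exact mul_le_mul_of_nonneg_right (hC _ _ _) (norm_nonneg _)

theorem integral_term_mul_term_of_lt [SFinite m] {k l : Fin S.p × Fin S.q} (h : k.1 < l.1) :
    ∫ ω, S.term Nm k ω * S.term Nm l ω ∂P = 0 := by
  have hY : Measurable[ℱ (S.τ l.1)] fun ω => S.term Nm k ω * S.ξ l.1 l.2 ω :=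
    ((S.measurable_term hNm k).mono (ℱ.mono (S.τ_mono h)) le_rfl).mul (S.ξ_meas l.1 l.2)
  rw [← hNm.integral_mul_increment (S.τ_le_succ l.1) (S.A_meas l.2) (S.A_fin l.2) hY]
  simp only [term, mul_assoc]

theorem integral_term_mul_term_same_time [SFinite m] (i : Fin S.p) {j j' : Fin S.q} (h : j ≠ j') :
    ∫ ω, S.term Nm (i, j) ω * S.term Nm (i, j') ω ∂P = 0 := by
  have hfactor := hNm.integral_mul_future (Y := fun ω => S.ξ i j ω * S.ξ i j' ω)
    (Z := fun ω => increment m Nm (S.τ i) (S.τ (i + 1)) (S.A j) ω *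
      increment m Nm (S.τ i) (S.τ (i + 1)) (S.A j') ω)
    ((S.ξ_meas i j).mul (S.ξ_meas i j'))
    ((measurable_increment_future _ _ (S.A_meas j)).mul
      (measurable_increment_future _ _ (S.A_meas j')))
    ((hNm.measurable_increment _ _ (S.A_meas j)).mul (hNm.measurable_increment _ _ (S.A_meas j')))
  rw [hNm.integral_increment_mul_increment (S.τ_le_succ i) (S.A_meas j) (S.A_fin j) (S.A_meas j')
    (S.A_disj h), mul_zero] at hfactor
  rw [← hfactor]
  exact integral_congr_ae (ae_of_all _ fun ω => mul_mul_mul_comm _ _ _ _)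

theorem integral_term_mul_term [SFinite m] {k l : Fin S.p × Fin S.q} (h : k ≠ l) :
    ∫ ω, S.term Nm k ω * S.term Nm l ω ∂P = 0 := by
  rcases lt_trichotomy k.1 l.1 with hlt | heq | hgt
  · exact S.integral_term_mul_term_of_lt hNm hlt
  · obtain ⟨i, j⟩ := k
    obtain ⟨i', j'⟩ := l
    obtain rfl : i = i' := heq
    exact S.integral_term_mul_term_same_time hNm i fun hj => h (by rw [hj])
  · simp_rw [mul_comm (S.term Nm k _)]
    exact S.integral_term_mul_term_of_lt hNm hgt

theorem integral_term_sq [SFinite m] (k : Fin S.p × Fin S.q) :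
    ∫ ω, S.term Nm k ω ^ 2 ∂P = (∫ ω, S.ξ k.1 k.2 ω ^ 2 ∂P) *
      (((S.τ (k.1 + 1) : ℝ) - S.τ k.1) * (m (S.A k.2)).toReal) := by
  simp_rw [term, mul_pow]
  rw [hNm.integral_mul_future ((S.ξ_meas k.1 k.2).pow_const 2)
    ((measurable_increment_future _ _ (S.A_meas k.2)).pow_const 2)
    ((hNm.measurable_increment _ _ (S.A_meas k.2)).pow_const 2),
    hNm.integral_increment_sq (S.τ_le_succ k.1) (S.A_meas k.2) (S.A_fin k.2)]

theorem memLp_integral [SFinite m] : MemLp (S.integral Nm) 2 P := by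
  rw [funext S.integral_eq_sum_term]
  exact memLp_finsetSum _ fun k _ => S.memLp_term hNm k

theorem stronglyMeasurable_integral : StronglyMeasurable[ℱ b] (S.integral Nm) := by
  rw [funext S.integral_eq_sum_term]
  refine Measurable.stronglyMeasurable (Finset.measurable_sum _ fun k _ => ?_)
  exact (S.measurable_term hNm k).mono (ℱ.mono (S.τ_succ_le k.1)) le_rfl

theorem integral_mul_eq_zero [SFinite m] {Y : Ω → ℝ} (hY : MemLp Y 2 P)
    (hYm : Measurable[ℱ a] Y) : ∫ ω, Y ω * S.integral Nm ω ∂P = 0 := by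
  simp_rw [S.integral_eq_sum_term, Finset.mul_sum]
  have hint : ∀ k, Integrable (fun ω => Y ω * S.term Nm k ω) P := fun k =>
    hY.integrable_mul (S.memLp_term hNm k)
  rw [integral_finsetSum _ fun k _ => hint k]
  refine Finset.sum_eq_zero fun k _ => ?_
  have hYξ : Measurable[ℱ (S.τ k.1)] fun ω => Y ω * S.ξ k.1 k.2 ω :=
    (hYm.mono (ℱ.mono (S.le_τ _)) le_rfl).mul (S.ξ_meas k.1 k.2)
  rw [← hNm.integral_mul_increment (S.τ_le_succ k.1) (S.A_meas k.2) (S.A_fin k.2) hYξ]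
  simp only [term, mul_assoc]

theorem ofReal_integral_term_sq [SFinite m] [IsFiniteMeasure P] (k : Fin S.p × Fin S.q) :
    ENNReal.ofReal (∫ ω, S.term Nm k ω ^ 2 ∂P) =
      ∫⁻ y, ENNReal.ofReal (S.summand k y ^ 2) ∂(integrandMeasure P m a b) := by
  have hτ : 0 ≤ (S.τ (k.1 + 1) : ℝ) - S.τ k.1 :=
    sub_nonneg.2 (NNReal.coe_le_coe.2 (S.τ_le_succ _))
  rw [S.integral_term_sq hNm, S.lintegral_summand_sq,
    ENNReal.ofReal_mul (integral_nonneg fun _ => sq_nonneg _), ENNReal.ofReal_mul hτ,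
    ENNReal.ofReal_toReal (S.A_fin k.2),
    ofReal_integral_eq_lintegral_ofReal (S.memLp_ξ k.1 k.2).integrable_sq
      (ae_of_all _ fun _ => sq_nonneg _)]

theorem eLpNorm_integral [SFinite m] [IsFiniteMeasure P] :
    eLpNorm (S.integral Nm) 2 P = eLpNorm (fun y : Ω × (ℝ × E) => S.toFun y.1 y.2.1 y.2.2) 2
      (integrandMeasure P m a b) := by
  refine (ENNReal.pow_right_strictMono two_ne_zero).injective ?_
  rw [eLpNorm_two_sq_eq_ofReal_integral (S.memLp_integral hNm), eLpNorm_two_sq]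
  simp_rw [S.integral_eq_sum_term, S.toFun_sq_eq_sum_summand_sq]
  rw [integral_sum_sq_of_pairwise_orthogonal (fun k _ => S.memLp_term hNm k)
      fun k _ l _ => S.integral_term_mul_term hNm,
    ENNReal.ofReal_sum_of_nonneg fun k _ => integral_nonneg fun _ => sq_nonneg _]
  simp_rw [S.ofReal_integral_term_sq hNm]
  rw [← lintegral_finsetSum _ fun k _ => ((S.measurable_summand k).pow_const 2).ennreal_ofReal]
  simp_rw [ENNReal.ofReal_sum_of_nonneg fun _ _ => sq_nonneg (S.summand _ _)]

end SimplePredictable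

namespace IsStochIntegral

variable {a b : ℝ≥0} {ζ : Ω → ℝ → E → ℝ} {I : Ω → ℝ}
  (hNm : IsFiltrationPoisson P ℱ m Nm) (hI : IsStochIntegral P ℱ m Nm a b ζ I)
include hNm hI

theorem eLpNorm_eq [SFinite m] [IsFiniteMeasure P]
    (hζ : AEStronglyMeasurable (fun y : Ω × (ℝ × E) => ζ y.1 y.2.1 y.2.2)
      (integrandMeasure P m a b)) :
    eLpNorm I 2 P =
      eLpNorm (fun y : Ω × (ℝ × E) => ζ y.1 y.2.1 y.2.2) 2 (integrandMeasure P m a b) := by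
  obtain ⟨hI2, S, hSζ, hSI⟩ := hI
  have hlim := tendsto_eLpNorm_of_tendsto_eLpNorm_sub one_le_two
    (fun k => (S k).measurable_toFun.aestronglyMeasurable) hζ hSζ
  simp_rw [← (S _).eLpNorm_integral hNm] at hlim
  exact tendsto_nhds_unique (tendsto_eLpNorm_of_tendsto_eLpNorm_sub one_le_two
    (fun k => ((S k).memLp_integral hNm).1) hI2.1 hSI) hlim

theorem aestronglyMeasurable : AEStronglyMeasurable[ℱ b] I P := by
  obtain ⟨hI2, S, -, hSI⟩ := hI
  exact aestronglyMeasurable_of_tendsto_eLpNorm_sub two_ne_zero (ℱ.le b)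
    (fun k => (S k).stronglyMeasurable_integral hNm) hI2.1 hSI

theorem integral_mul_eq_zero [SFinite m] {Y : Ω → ℝ} (hY : MemLp Y 2 P)
    (hYm : AEStronglyMeasurable[ℱ a] Y P) : ∫ ω, Y ω * I ω ∂P = 0 := by
  obtain ⟨hI2, S, -, hSI⟩ := hI
  have hmk := hYm.ae_eq_mk
  have hzero : ∀ k, ∫ ω, Y ω * (S k).integral Nm ω ∂P = 0 := fun k => by
    rw [← (S k).integral_mul_eq_zero hNm (hY.ae_eq hmk) hYm.stronglyMeasurable_mk.measurable]
    exact integral_congr_ae (hmk.mono fun ω hω => congrArg (· * (S k).integral Nm ω) hω)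
  have hlim := tendsto_integral_mul_of_tendsto_eLpNorm_sub hY
    (fun k => (S k).memLp_integral hNm) hI2 hSI
  simp_rw [hzero] at hlim
  exact tendsto_nhds_unique hlim tendsto_const_nhds

end IsStochIntegral

end ItoIsometry

/-! ### One step of the scheme -/

section Energy

variable {Ω E : Type*} {mΩ : MeasurableSpace Ω} [MeasurableSpace E] {P : Measure Ω}

theorem ofReal_measureReal_mul_sq_mean_le {X : Type*} [MeasurableSpace X] {μ : Measure X}
    {s : Set X} (hs : μ s ≠ ∞) {g : X → ℝ} (hg : AEStronglyMeasurable g μ) :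
    ENNReal.ofReal (μ.real s * (1 / μ.real s * ∫ x in s, g x ∂μ) ^ 2) ≤
      ∫⁻ x in s, ENNReal.ofReal (g x ^ 2) ∂μ := by
  rcases (measureReal_nonneg (μ := μ) (s := s)).eq_or_lt with h0 | hpos
  · rw [← h0, zero_mul, ENNReal.ofReal_zero]
    exact zero_le
  have hCS : ‖∫ x in s, g x ∂μ‖ₑ ≤
      eLpNorm g 2 (μ.restrict s) * (μ s) ^ (1 / 2 : ℝ) := by
    refine (enorm_integral_le_lintegral_enorm _).trans ?_
    rw [← eLpNorm_one_eq_lintegral_enorm]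
    refine (eLpNorm_le_eLpNorm_mul_rpow_measure_univ one_le_two hg.restrict).trans_eq ?_
    rw [Measure.restrict_apply_univ]
    norm_num
  have hsq : ENNReal.ofReal ((∫ x in s, g x ∂μ) ^ 2) ≤
      (∫⁻ x in s, ENNReal.ofReal (g x ^ 2) ∂μ) * ENNReal.ofReal (μ.real s) := by
    rw [← sq_abs, ENNReal.ofReal_pow (abs_nonneg _), ← Real.norm_eq_abs, ofReal_norm]
    refine (pow_le_pow_left₀ zero_le hCS 2).trans_eq ?_
    rw [mul_pow, eLpNorm_two_sq, ← ENNReal.rpow_natCast, ← ENNReal.rpow_mul, ofReal_measureReal hs]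
    norm_num
  have hmean : μ.real s * (1 / μ.real s * ∫ x in s, g x ∂μ) ^ 2 =
      (∫ x in s, g x ∂μ) ^ 2 / μ.real s := by field_simp
  rw [hmean, ENNReal.ofReal_div_of_pos hpos]
  exact ENNReal.div_le_of_le_mul hsq

theorem lintegral_prod_mul_integrandMeasure {m : Measure E} [SFinite m]
    {h : E → ℝ} (hh : MemLp h 2 m) {w : Ω → ℝ} (hw : AEMeasurable w P) (a b : ℝ≥0) :
    ∫⁻ y, ENNReal.ofReal (w y.1 ^ 2) * ENNReal.ofReal (h y.2.2 ^ 2) ∂(integrandMeasure P m a b) =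
      ENNReal.ofReal (((b : ℝ) - a) * ∫ z, h z ^ 2 ∂m) * ∫⁻ ω, ENNReal.ofReal (w ω ^ 2) ∂P := by
  have hhm : AEMeasurable (fun z => ENNReal.ofReal (h z ^ 2)) m :=
    (hh.1.aemeasurable.pow_const 2).ennreal_ofReal
  have hmark : ∫⁻ q : ℝ × E, ENNReal.ofReal (h q.2 ^ 2)
      ∂((volume.restrict (Set.Ioc (a : ℝ) b)).prod m) =
        ENNReal.ofReal (((b : ℝ) - a) * ∫ z, h z ^ 2 ∂m) := by
    have hprod := lintegral_prod_mul (μ := volume.restrict (Set.Ioc (a : ℝ) b))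
      (f := fun _ => 1) aemeasurable_const hhm
    simp only [one_mul, lintegral_one, Measure.restrict_apply_univ, Real.volume_Ioc] at hprod
    rw [hprod, ENNReal.ofReal_mul' (integral_nonneg fun _ => sq_nonneg _),
      ofReal_integral_eq_lintegral_ofReal hh.integrable_sq (ae_of_all _ fun _ => sq_nonneg _)]
  have hhm' : AEMeasurable (fun q : ℝ × E => ENNReal.ofReal (h q.2 ^ 2))
      ((volume.restrict (Set.Ioc (a : ℝ) b)).prod m) :=
    hhm.comp_quasiMeasurePreserving Measure.quasiMeasurePreserving_snd
  rw [lintegral_prod_mul (hw.pow_const 2).ennreal_ofReal hhm', hmark, mul_comm]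

theorem IsStochIntegral.eLpNorm_sq_le [IsFiniteMeasure P] {ℱ : Filtration ℝ≥0 mΩ} {m : Measure E}
    [SFinite m] {Nm : Ω → Measure (ℝ × E)} (hNm : IsFiltrationPoisson P ℱ m Nm)
    {η : ℝ → E → ℝ} (hη : Measurable (Function.uncurry η)) {h₁ : E → ℝ} (hh₁ : MemLp h₁ 2 m)
    (hη_le : ∀ a z, |η a z| ≤ |a| * h₁ z) {w I : Ω → ℝ} (hw : AEMeasurable w P) {a b : ℝ≥0}
    (hI : IsStochIntegral P ℱ m Nm a b (fun ω _ z => η (w ω) z) I) :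
    eLpNorm I 2 P ^ 2 ≤ ENNReal.ofReal (((b : ℝ) - a) * ∫ z, h₁ z ^ 2 ∂m) *
      ∫⁻ ω, ENNReal.ofReal (w ω ^ 2) ∂P := by
  have hwz : AEMeasurable (fun y : Ω × (ℝ × E) => (w y.1, y.2.2)) (integrandMeasure P m a b) :=
    (hw.comp_quasiMeasurePreserving Measure.quasiMeasurePreserving_fst).prodMk (by fun_prop)
  rw [hI.eLpNorm_eq hNm (hη.comp_aemeasurable hwz).aestronglyMeasurable, eLpNorm_two_sq,
    ← lintegral_prod_mul_integrandMeasure hh₁ hw]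
  refine lintegral_mono fun y => ?_
  rw [← ENNReal.ofReal_mul (sq_nonneg _), ← mul_pow]
  refine ENNReal.ofReal_le_ofReal (sq_le_sq.2 ((hη_le _ _).trans ?_))
  rw [abs_mul]
  exact mul_le_mul_of_nonneg_left (le_abs_self _) (abs_nonneg _)

theorem eLpNorm_add_sq_of_integral_mul_eq_zero {X Y : Ω → ℝ} (hX : MemLp X 2 P)
    (hY : MemLp Y 2 P) (horth : ∫ ω, X ω * Y ω ∂P = 0) :
    eLpNorm (X + Y) 2 P ^ 2 = eLpNorm X 2 P ^ 2 + eLpNorm Y 2 P ^ 2 := by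
  have hXY : Integrable (fun ω => X ω * Y ω) P := hX.integrable_mul hY
  rw [eLpNorm_two_sq_eq_ofReal_integral (hX.add hY), eLpNorm_two_sq_eq_ofReal_integral hX,
    eLpNorm_two_sq_eq_ofReal_integral hY, ← ENNReal.ofReal_add
      (integral_nonneg fun _ => sq_nonneg _) (integral_nonneg fun _ => sq_nonneg _)]
  congr 1
  simp only [Pi.add_apply, add_sq, mul_assoc]
  have hcross : Integrable (fun ω => X ω ^ 2 + 2 * (X ω * Y ω)) P :=
    hX.integrable_sq.add (hXY.const_mul 2)
  rw [integral_add hcross hY.integrable_sq, integral_add hX.integrable_sq (hXY.const_mul 2),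
    integral_const_mul, horth, mul_zero, add_zero]

theorem IsStochIntegral.eLpNorm_add_sq_le [IsFiniteMeasure P] {ℱ : Filtration ℝ≥0 mΩ}
    {m : Measure E} [SFinite m] {Nm : Ω → Measure (ℝ × E)} (hNm : IsFiltrationPoisson P ℱ m Nm)
    {η : ℝ → E → ℝ} (hη : Measurable (Function.uncurry η)) {h₁ : E → ℝ} (hh₁ : MemLp h₁ 2 m)
    (hη_le : ∀ a z, |η a z| ≤ |a| * h₁ z) {w X I : Ω → ℝ} (hw : AEMeasurable w P)
    (hX : MemLp X 2 P) {a b : ℝ≥0} (hXm : AEStronglyMeasurable[ℱ a] X P)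
    (hI : IsStochIntegral P ℱ m Nm a b (fun ω _ z => η (w ω) z) I) :
    eLpNorm (X + I) 2 P ^ 2 ≤ eLpNorm X 2 P ^ 2 +
      ENNReal.ofReal (((b : ℝ) - a) * ∫ z, h₁ z ^ 2 ∂m) * ∫⁻ ω, ENNReal.ofReal (w ω ^ 2) ∂P := by
  rw [eLpNorm_add_sq_of_integral_mul_eq_zero hX hI.1 (hI.integral_mul_eq_zero hNm hX hXm)]
  exact add_le_add le_rfl (hI.eLpNorm_sq_le hNm hη hh₁ hη_le hw)

theorem aestronglyMeasurable_sum_of_sub {κ : Type*} {m' : MeasurableSpace Ω} (s : Finset κ)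
    {g : κ → Ω → ℝ} (hg : ∀ k ∈ s, AEStronglyMeasurable[m'] (g k) P) :
    AEStronglyMeasurable[m'] (fun ω => ∑ k ∈ s, g k ω) P := by
  induction s using Finset.cons_induction with
  | empty => exact aestronglyMeasurable_const
  | cons k s hk ih =>
    simp only [Finset.sum_cons]
    exact (hg k (s.mem_cons_self k)).add (ih fun l hl => hg l (Finset.mem_cons_of_mem hl))

namespace AdmissibleMesh

variable {d : ℕ} {ι : Type*} (𝒯 : AdmissibleMesh d ι)

theorem ofReal_vol (K : ι) : ENNReal.ofReal (𝒯.vol K) = volume (𝒯.cell K) :=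
  ENNReal.ofReal_toReal (𝒯.volume_cell_ne_top K)

/-- The squared `L²(Ω × ℝ^d)` norm `∑ |K| E[(w_K)²]` of the piecewise constant random function with
values `w K`. -/
noncomputable def energy (P : Measure Ω) (w : ι → Ω → ℝ) : ℝ≥0∞ :=
  ∑' K, ENNReal.ofReal (𝒯.vol K) * ∫⁻ ω, ENNReal.ofReal (w K ω ^ 2) ∂P

theorem energy_eq_lintegral_tsum (hd : 1 ≤ d) {w : ι → Ω → ℝ} (hw : ∀ K, AEMeasurable (w K) P) :
    𝒯.energy P w = ∫⁻ ω, ∑' K, ENNReal.ofReal (𝒯.vol K * w K ω ^ 2) ∂P := by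
  have := 𝒯.countable_index hd
  have hsq : ∀ K, AEMeasurable (fun ω => ENNReal.ofReal (w K ω ^ 2)) P := fun K =>
    ((hw K).pow_const 2).ennreal_ofReal
  simp_rw [ENNReal.ofReal_mul (𝒯.vol_pos _).le]
  rw [lintegral_tsum fun K => (hsq K).const_mul _, energy]
  exact tsum_congr fun K => (lintegral_const_mul'' _ (hsq K)).symm

theorem energy_congr_ae {w w' : ι → Ω → ℝ} (h : ∀ K, w K =ᵐ[P] w' K) :
    𝒯.energy P w = 𝒯.energy P w' :=
  tsum_congr fun K => congrArg _ <| lintegral_congr_ae <|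
    (h K).mono fun _ hω => congrArg (fun x => ENNReal.ofReal (x ^ 2)) hω

theorem energy_add_le [IsFiniteMeasure P] {ℱ : Filtration ℝ≥0 mΩ} {m : Measure E} [SFinite m]
    {Nm : Ω → Measure (ℝ × E)} (hNm : IsFiltrationPoisson P ℱ m Nm) {η : ℝ → E → ℝ}
    (hη : Measurable (Function.uncurry η)) {h₁ : E → ℝ} (hh₁ : MemLp h₁ 2 m)
    (hη_le : ∀ a z, |η a z| ≤ |a| * h₁ z) {w X I : ι → Ω → ℝ} (hw : ∀ K, AEMeasurable (w K) P)
    (hX : ∀ K, MemLp (X K) 2 P) {a b : ℝ≥0} (hXm : ∀ K, AEStronglyMeasurable[ℱ a] (X K) P)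
    (hI : ∀ K, IsStochIntegral P ℱ m Nm a b (fun ω _ z => η (w K ω) z) (I K)) :
    𝒯.energy P (fun K => X K + I K) ≤
      𝒯.energy P X + ENNReal.ofReal (((b : ℝ) - a) * ∫ z, h₁ z ^ 2 ∂m) * 𝒯.energy P w := by
  rw [energy, energy, energy, ← ENNReal.tsum_mul_left, ← ENNReal.tsum_add]
  refine ENNReal.tsum_le_tsum fun K => ?_
  rw [mul_left_comm, ← mul_add]
  simp_rw [← eLpNorm_two_sq]
  have hK := (hI K).eLpNorm_add_sq_le hNm hη hh₁ hη_le (hw K) (hX K) (hXm K)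
  rw [← eLpNorm_two_sq] at hK
  exact mul_le_mul_right hK _

section InitialValue

/-- The mean value of `g` over the control volume `K`. -/
noncomputable def cellMean (K : ι) (g : EuclideanSpace ℝ (Fin d) → ℝ) : ℝ :=
  1 / 𝒯.vol K * ∫ x in 𝒯.cell K, g x

theorem exists_cellMean_eq_inner (K : ι) :
    ∃ φ : Lp ℝ 2 (volume : Measure (EuclideanSpace ℝ (Fin d))),
      ∀ g : Lp ℝ 2 (volume : Measure (EuclideanSpace ℝ (Fin d))),
        𝒯.cellMean K g = inner ℝ φ g := by
  have hfin : volume (interior (𝒯.cell K)) ≠ ∞ :=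
    measure_ne_top_of_subset interior_subset (𝒯.volume_cell_ne_top K)
  refine ⟨(1 / 𝒯.vol K) • indicatorConstLp 2 isOpen_interior.measurableSet hfin (1 : ℝ),
    fun g => ?_⟩
  rw [real_inner_smul_left, L2.inner_indicatorConstLp_one, cellMean,
    setIntegral_congr_set (𝒯.interior_cell_ae_eq K)]

theorem tsum_vol_mul_cellMean_sq_le (hd : 1 ≤ d)
    (g : Lp ℝ 2 (volume : Measure (EuclideanSpace ℝ (Fin d)))) :
    ∑' K, ENNReal.ofReal (𝒯.vol K * 𝒯.cellMean K g ^ 2) ≤ ENNReal.ofReal (‖g‖ ^ 2) := by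
  have := 𝒯.countable_index hd
  calc ∑' K, ENNReal.ofReal (𝒯.vol K * 𝒯.cellMean K g ^ 2)
      ≤ ∑' K, ∫⁻ x in 𝒯.cell K, ENNReal.ofReal (g x ^ 2) := ENNReal.tsum_le_tsum fun K =>
        ofReal_measureReal_mul_sq_mean_le (𝒯.volume_cell_ne_top K) (Lp.aestronglyMeasurable g)
    _ = ∫⁻ x in ⋃ K, 𝒯.cell K, ENNReal.ofReal (g x ^ 2) :=
        (lintegral_iUnion₀ 𝒯.nullMeasurableSet_cell
          (fun _ _ h => (𝒯.disjoint h).aedisjoint) _).symm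
    _ ≤ ∫⁻ x, ENNReal.ofReal (g x ^ 2) := setLIntegral_le_lintegral _ _
    _ = ENNReal.ofReal (‖g‖ ^ 2) := by
        rw [← eLpNorm_two_sq, ENNReal.ofReal_pow (norm_nonneg _), Lp.norm_def,
          ENNReal.ofReal_toReal (Lp.eLpNorm_ne_top g)]

variable {u₀ : Ω → Lp ℝ 2 (volume : Measure (EuclideanSpace ℝ (Fin d)))}

theorem stronglyMeasurable_cellMean {m' : MeasurableSpace Ω} (h : StronglyMeasurable[m'] u₀)
    (K : ι) : StronglyMeasurable[m'] fun ω => 𝒯.cellMean K (u₀ ω) := by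
  obtain ⟨φ, hφ⟩ := 𝒯.exists_cellMean_eq_inner K
  simp_rw [hφ]
  exact (continuous_const.inner continuous_id).comp_stronglyMeasurable h

theorem memLp_cellMean (h : MemLp u₀ 2 P) (K : ι) :
    MemLp (fun ω => 𝒯.cellMean K (u₀ ω)) 2 P := by
  obtain ⟨φ, hφ⟩ := 𝒯.exists_cellMean_eq_inner K
  simp_rw [hφ]
  exact h.const_inner φ

theorem energy_cellMean_le (hd : 1 ≤ d) (h : MemLp u₀ 2 P) :
    𝒯.energy P (fun K ω => 𝒯.cellMean K (u₀ ω)) ≤ ENNReal.ofReal (∫ ω, ‖u₀ ω‖ ^ 2 ∂P) := by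
  rw [𝒯.energy_eq_lintegral_tsum hd fun K => (𝒯.memLp_cellMean h K).1.aemeasurable,
    ofReal_integral_eq_lintegral_ofReal ((memLp_two_iff_integrable_sq_norm h.1).1 h)
      (ae_of_all _ fun _ => sq_nonneg _)]
  exact lintegral_mono fun ω => 𝒯.tsum_vol_mul_cellMean_sq_le hd (u₀ ω)

end InitialValue

section Step

/-- The deterministic part of one time step of the scheme with numerical flux `F`, applied to the
cell values `a`. -/
noncomputable def transport (τ : ℝ) (F : ι → ι → ℝ → ℝ → ℝ) (a : ι → ℝ) (K : ι) : ℝ :=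
  a K - τ / 𝒯.vol K * ∑ᶠ L ∈ 𝒯.neighbors K, F K L (a K) (a L)

theorem transport_eq_sum (hd : 1 ≤ d) (τ : ℝ) (F : ι → ι → ℝ → ℝ → ℝ) (a : ι → ℝ) (K : ι) :
    𝒯.transport τ F a K =
      a K - τ / 𝒯.vol K * ∑ L ∈ 𝒯.neighborFinset hd K, F K L (a K) (a L) := by
  rw [transport, finsum_mem_eq_finite_toFinset_sum _ (𝒯.finite_neighbors hd K), neighborFinset]

theorem eq_transport_add {τ : ℝ} (hτ : 0 < τ) {F : ι → ι → ℝ → ℝ → ℝ} {a : ι → ℝ} {K : ι}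
    {a' I : ℝ} (h : 𝒯.vol K / τ * (a' - a K) + ∑ᶠ L ∈ 𝒯.neighbors K, F K L (a K) (a L) =
      𝒯.vol K / τ * I) : a' = 𝒯.transport τ F a K + I := by
  have hvol := 𝒯.vol_pos K
  rw [transport]
  field_simp at h ⊢
  linarith

variable {v : ℝ → EuclideanSpace ℝ (Fin d) → EuclideanSpace ℝ (Fin d)} {V τ : ℝ} {f : ℝ → ℝ}
  {n : ℕ} {F : ι → ι → ℝ → ℝ → ℝ} {q : ι → ι → ℝ} {c : ℝ≥0} {w : ι → Ω → ℝ}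

theorem IsUpwindForm.aestronglyMeasurable_transport {m' : MeasurableSpace Ω}
    (hF : 𝒯.IsUpwindForm v V τ f n F q) (hd : 1 ≤ d) (hf : Continuous f)
    (hw : ∀ K, AEStronglyMeasurable[m'] (w K) P) (K : ι) :
    AEStronglyMeasurable[m'] (fun ω => 𝒯.transport τ F (fun L => w L ω) K) P := by
  have hfw : ∀ L, AEStronglyMeasurable[m'] (fun ω => f (w L ω)) P := fun L =>
    hf.comp_aestronglyMeasurable (hw L)
  have hflux : ∀ L ∈ 𝒯.neighborFinset hd K,
      AEStronglyMeasurable[m'] (fun ω => F K L (w K ω) (w L ω)) P := fun L hL => by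
    simp_rw [(hF K L ((𝒯.mem_neighborFinset hd).1 hL)).2.2.2]
    exact (((hfw K).const_mul _).sub ((hfw L).const_mul _)).const_mul _
  simp_rw [𝒯.transport_eq_sum hd]
  exact (hw K).sub ((aestronglyMeasurable_sum_of_sub _ hflux).const_mul _)

theorem IsUpwindForm.memLp_transport (hF : 𝒯.IsUpwindForm v V τ f n F q) (hd : 1 ≤ d)
    (hlip : LipschitzWith c f) (hf0 : f 0 = 0) (hw : ∀ K, MemLp (w K) 2 P) (K : ι) :
    MemLp (fun ω => 𝒯.transport τ F (fun L => w L ω) K) 2 P := by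
  have hfw : ∀ L, MemLp (fun ω => f (w L ω)) 2 P := fun L => hlip.comp_memLp hf0 (hw L)
  have hflux : ∀ L ∈ 𝒯.neighborFinset hd K, MemLp (fun ω => F K L (w K ω) (w L ω)) 2 P :=
    fun L hL => by
      simp_rw [(hF K L ((𝒯.mem_neighborFinset hd).1 hL)).2.2.2]
      exact (((hfw K).const_mul _).sub ((hfw L).const_mul _)).const_mul _
  simp_rw [𝒯.transport_eq_sum hd]
  exact (hw K).sub ((memLp_finsetSum _ hflux).const_mul _)

theorem IsUpwindForm.energy_transport_le (hF : 𝒯.IsUpwindForm v V τ f n F q) (hd : 1 ≤ d)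
    (hmono : Monotone f) (hlip : LipschitzWith c f) (hf0 : f 0 = 0) (hτ : 0 ≤ τ) {T : ℝ}
    (hnT : (n + 1) * τ ≤ T) (hV : 0 ≤ V)
    (hv : ContDiffOn ℝ 1 (Function.uncurry v) (Set.Icc 0 T ×ˢ Set.univ))
    (hdiv : ∀ t ∈ Set.Ico 0 T, ∀ x, divergence (v t) x = 0)
    (hCFL : τ * (c * V) ≤ 𝒯.α ^ 2 * 𝒯.size) (hw : ∀ K, AEStronglyMeasurable (w K) P) :
    𝒯.energy P (fun K ω => 𝒯.transport τ F (fun L => w L ω) K) ≤ 𝒯.energy P w := by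
  rw [𝒯.energy_eq_lintegral_tsum hd fun K => (hw K).aemeasurable,
    𝒯.energy_eq_lintegral_tsum hd fun K =>
      (hF.aestronglyMeasurable_transport 𝒯 hd hlip.continuous hw K).aemeasurable]
  refine lintegral_mono fun ω => ?_
  simp_rw [𝒯.transport_eq_sum hd]
  exact hF.tsum_energy_le 𝒯 hd hmono hlip hf0 hτ hnT hV hv hdiv hCFL fun L => w L ω

end Step

end AdmissibleMesh

end Energy

/-! ### The approximate solution -/

section PiecewiseConstant

variable {X ι : Type*} {s : ι → Set X}

theorem apply_finsum_indicator {R : Type*} [AddCommMonoid R]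
    (hs : Pairwise (Function.onFun Disjoint s)) {φ : R → ℝ≥0∞} (hφ : φ 0 = 0) (g : ι → X → R)
    (y : X) : φ (∑ᶠ k, (s k).indicator (g k) y) = ∑' k, (s k).indicator (fun z => φ (g k z)) y := by
  by_cases h : ∃ k, y ∈ s k
  · obtain ⟨k, hk⟩ := h
    have hne : ∀ l, l ≠ k → y ∉ s l := fun l hl hy => Set.disjoint_left.1 (hs hl) hy hk
    rw [finsum_eq_single _ k fun l hl => Set.indicator_of_notMem (hne l hl) _,
      tsum_eq_single k fun l hl => Set.indicator_of_notMem (hne l hl) _,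
      Set.indicator_of_mem hk, Set.indicator_of_mem hk]
  · push Not at h
    simp only [Set.indicator_of_notMem (h _), finsum_zero, tsum_zero, hφ]

variable [MeasurableSpace X] {μ : Measure X} {g : ι → X → ℝ}

theorem aemeasurable_finsum_indicator [Countable ι] (hs : Pairwise (Function.onFun Disjoint s))
    (hsm : ∀ k, NullMeasurableSet (s k) μ) (hg : ∀ k, AEMeasurable (g k) μ) :
    AEMeasurable (fun y => ∑ᶠ k, (s k).indicator (g k) y) μ := by
  have hpos : AEMeasurable (fun y => ENNReal.ofReal (∑ᶠ k, (s k).indicator (g k) y)) μ := by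
    simp_rw [apply_finsum_indicator hs ENNReal.ofReal_zero g]
    exact AEMeasurable.tsum fun k => (hg k).ennreal_ofReal.indicator₀ (hsm k)
  have hneg : AEMeasurable (fun y => ENNReal.ofReal (-∑ᶠ k, (s k).indicator (g k) y)) μ := by
    simp_rw [apply_finsum_indicator hs (φ := fun r => ENNReal.ofReal (-r)) (by simp) g]
    exact AEMeasurable.tsum fun k => (hg k).neg.ennreal_ofReal.indicator₀ (hsm k)
  refine (hpos.ennreal_toReal.sub hneg.ennreal_toReal).congr (ae_of_all _ fun y => ?_)
  simp only [Pi.sub_apply, ENNReal.toReal_ofReal', max_zero_sub_max_neg_zero_eq_self]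

theorem eLpNorm_sq_finsum_indicator [Countable ι] (hs : Pairwise (Function.onFun Disjoint s))
    (hsm : ∀ k, NullMeasurableSet (s k) μ) (hg : ∀ k, AEMeasurable (g k) μ) :
    eLpNorm (fun y => ∑ᶠ k, (s k).indicator (g k) y) 2 μ ^ 2 =
      ∑' k, ∫⁻ y in s k, ENNReal.ofReal (g k y ^ 2) ∂μ := by
  rw [eLpNorm_two_sq]
  simp_rw [apply_finsum_indicator hs (φ := fun r => ENNReal.ofReal (r ^ 2)) (by simp) g]
  rw [lintegral_tsum fun k => ((hg k).pow_const 2).ennreal_ofReal.indicator₀ (hsm k)]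
  exact tsum_congr fun k => lintegral_indicator₀ (hsm k) _

theorem aemeasurable_apply_of_measurable_index {N : ℕ} {φ : X → ℕ} (hφ : Measurable φ)
    (hφN : ∀ᵐ y ∂μ, φ y < N) {g : ℕ → X → ℝ} (hg : ∀ n < N, AEMeasurable (g n) μ) :
    AEMeasurable (fun y => g (φ y) y) μ := by
  have hlevel : ∀ n, MeasurableSet (φ ⁻¹' {n}) := fun n => hφ (measurableSet_singleton n)
  have hunion : ⋃ n, φ ⁻¹' {n} = Set.univ :=
    Set.eq_univ_of_forall fun y => Set.mem_iUnion.2 ⟨φ y, rfl⟩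
  rw [← Measure.restrict_univ (μ := μ), ← hunion, aemeasurable_iUnion_iff]
  intro n
  by_cases hn : n < N
  · refine (hg n hn).restrict.congr ?_
    filter_upwards [ae_restrict_mem (hlevel n)] with y hy
    rw [Set.mem_preimage, Set.mem_singleton_iff] at hy
    rw [hy]
  · rw [Measure.restrict_eq_zero.2 (measure_mono_null (fun y hy => ?_) (ae_iff.1 hφN))]
    · exact aemeasurable_zero_measure
    · rw [Set.mem_preimage, Set.mem_singleton_iff] at hy
      simpa [hy] using hn

theorem lintegral_prod_prod_left_comm {Ω R : Type*} [MeasurableSpace Ω] [MeasurableSpace R]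
    {P : Measure Ω} [SFinite P] {ν : Measure R} [SFinite ν] [SFinite μ] {f : Ω × R × X → ℝ≥0∞}
    (hf : AEMeasurable f (P.prod (ν.prod μ))) :
    ∫⁻ y, f y ∂(P.prod (ν.prod μ)) = ∫⁻ t, ∫⁻ p, f (p.1, t, p.2) ∂(P.prod μ) ∂ν := by
  let e : R × Ω × X ≃ᵐ Ω × R × X :=
    MeasurableEquiv.prodAssoc.symm.trans
      ((MeasurableEquiv.prodComm.prodCongr (.refl X)).trans MeasurableEquiv.prodAssoc)
  have he : MeasurePreserving e (ν.prod (P.prod μ)) (P.prod (ν.prod μ)) :=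
    (measurePreserving_prodAssoc P ν μ).comp
      ((Measure.measurePreserving_swap.prod (.id μ)).comp
        (measurePreserving_prodAssoc ν P μ).symm)
  rw [← he.lintegral_comp_emb e.measurableEmbedding]
  exact lintegral_prod _ (hf.comp_quasiMeasurePreserving he.quasiMeasurePreserving)

theorem eLpNorm_sq_prod_prod_le {Ω R : Type*} [MeasurableSpace Ω] [MeasurableSpace R]
    {P : Measure Ω} [SFinite P] {ν : Measure R} [SFinite ν] [SFinite μ] {f : Ω × R × X → ℝ}
    (hf : AEMeasurable f (P.prod (ν.prod μ))) {M : ℝ≥0∞}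
    (hM : ∀ᵐ t ∂ν, eLpNorm (fun p : Ω × X => f (p.1, t, p.2)) 2 (P.prod μ) ^ 2 ≤ M) :
    eLpNorm f 2 (P.prod (ν.prod μ)) ^ 2 ≤ M * ν Set.univ := by
  rw [eLpNorm_two_sq, lintegral_prod_prod_left_comm (hf.pow_const 2).ennreal_ofReal,
    ← lintegral_const]
  refine lintegral_mono_ae (hM.mono fun t ht => ?_)
  rwa [← eLpNorm_two_sq]

end PiecewiseConstant

section ApproximateSolution

variable {Ω ι : Type*} {mΩ : MeasurableSpace Ω} {d : ℕ} {P : Measure Ω} {T Δt : ℝ} {N : ℕ}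
  {u : ℕ → ι → Ω → ℝ}

theorem floor_div_lt (hΔt : 0 < Δt) (hT : T = N * Δt) {t : ℝ} (ht : t ∈ Set.Ico 0 T) :
    ⌊t / Δt⌋₊ < N := by
  rw [Nat.floor_lt (div_nonneg ht.1 hΔt.le), div_lt_iff₀ hΔt, ← hT]
  exact ht.2

theorem memLp_two_of_eLpNorm_sq_le {X : Type*} [MeasurableSpace X] {μ : Measure X} {g : X → ℝ}
    (hg : AEMeasurable g μ) {r : ℝ} (hr : eLpNorm g 2 μ ^ 2 ≤ ENNReal.ofReal r) : MemLp g 2 μ :=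
  ⟨hg.aestronglyMeasurable, (ENNReal.pow_lt_top_iff.1
    (hr.trans_lt ENNReal.ofReal_lt_top)).resolve_right two_ne_zero⟩

theorem normLinftyL2_sq_le {w : ℝ → EuclideanSpace ℝ (Fin d) → Ω → ℝ} {M : ℝ≥0∞}
    (hM : ∀ t ∈ Set.Ioo 0 T, eLpNorm (fun y : Ω × EuclideanSpace ℝ (Fin d) => w t y.2 y.1) 2
      (P.prod volume) ^ 2 ≤ M) : normLinftyL2 P T w ^ 2 ≤ M := by
  rw [← ENNReal.rpow_two, ← ENNReal.le_rpow_inv_iff two_pos]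
  refine essSup_le_of_ae_le _ ?_
  filter_upwards [ae_restrict_mem measurableSet_Ioo] with t ht
  rw [ENNReal.le_rpow_inv_iff two_pos, ENNReal.rpow_two]
  exact hM t ht

namespace AdmissibleMesh

variable (𝒯 : AdmissibleMesh d ι)

section Slice

theorem disjoint_preimage_cell {Y : Type*} (p : Y → EuclideanSpace ℝ (Fin d)) :
    Pairwise (Function.onFun Disjoint fun K => p ⁻¹' 𝒯.cell K) :=
  fun _ _ h => (𝒯.disjoint h).preimage p

theorem nullMeasurableSet_snd_preimage_cell (K : ι) :
    NullMeasurableSet (Prod.snd ⁻¹' 𝒯.cell K : Set (Ω × EuclideanSpace ℝ (Fin d)))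
      (P.prod volume) :=
  (𝒯.nullMeasurableSet_cell K).preimage Measure.quasiMeasurePreserving_snd

theorem aemeasurable_approx_slice (hd : 1 ≤ d) {t : ℝ}
    (hu : ∀ K, AEMeasurable (u ⌊t / Δt⌋₊ K) P) :
    AEMeasurable (fun y : Ω × EuclideanSpace ℝ (Fin d) => 𝒯.approx Δt u t y.2 y.1)
      (P.prod volume) :=
  have := 𝒯.countable_index hd
  aemeasurable_finsum_indicator (𝒯.disjoint_preimage_cell Prod.snd)
    𝒯.nullMeasurableSet_snd_preimage_cell fun K =>
      (hu K).comp_quasiMeasurePreserving Measure.quasiMeasurePreserving_fst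

theorem eLpNorm_sq_approx_slice [SFinite P] (hd : 1 ≤ d) {t : ℝ}
    (hu : ∀ K, AEMeasurable (u ⌊t / Δt⌋₊ K) P) :
    eLpNorm (fun y : Ω × EuclideanSpace ℝ (Fin d) => 𝒯.approx Δt u t y.2 y.1) 2
      (P.prod volume) ^ 2 = 𝒯.energy P (u ⌊t / Δt⌋₊) := by
  have := 𝒯.countable_index hd
  refine (eLpNorm_sq_finsum_indicator (𝒯.disjoint_preimage_cell Prod.snd)
    𝒯.nullMeasurableSet_snd_preimage_cell fun K =>
      (hu K).comp_quasiMeasurePreserving Measure.quasiMeasurePreserving_fst).trans ?_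
  refine tsum_congr fun K => ?_
  have hsq : AEMeasurable (fun ω => ENNReal.ofReal (u ⌊t / Δt⌋₊ K ω ^ 2)) P :=
    ((hu K).pow_const 2).ennreal_ofReal
  have hprod := lintegral_prod_mul (ν := volume.restrict (𝒯.cell K)) (g := fun _ => 1) hsq
    aemeasurable_const
  rw [← Set.univ_prod, ← Measure.prod_restrict, Measure.restrict_univ, ofReal_vol, mul_comm]
  simpa only [Function.comp_apply, mul_one, lintegral_one, Measure.restrict_apply_univ] using hprod

end Slice

theorem aemeasurable_approx (hd : 1 ≤ d) (hΔt : 0 < Δt) (hT : T = N * Δt)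
    (hu : ∀ n < N, ∀ K, AEMeasurable (u n K) P) :
    AEMeasurable (fun y : Ω × ℝ × EuclideanSpace ℝ (Fin d) => 𝒯.approx Δt u y.2.1 y.2.2 y.1)
      (P.prod ((volume.restrict (Set.Ico 0 T)).prod volume)) := by
  have := 𝒯.countable_index hd
  have htime : ∀ᵐ y : Ω × ℝ × EuclideanSpace ℝ (Fin d)
      ∂(P.prod ((volume.restrict (Set.Ico 0 T)).prod volume)), ⌊y.2.1 / Δt⌋₊ < N :=
    (Measure.quasiMeasurePreserving_fst.comp Measure.quasiMeasurePreserving_snd).ae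
      ((ae_restrict_mem measurableSet_Ico).mono fun _ ht => floor_div_lt hΔt hT ht)
  have hfloor : Measurable fun y : Ω × ℝ × EuclideanSpace ℝ (Fin d) => ⌊y.2.1 / Δt⌋₊ :=
    Nat.measurable_floor.comp (by fun_prop)
  refine aemeasurable_finsum_indicator
    (s := fun K => (fun y : Ω × ℝ × EuclideanSpace ℝ (Fin d) => y.2.2) ⁻¹' 𝒯.cell K)
    (𝒯.disjoint_preimage_cell _) (fun K => ?_) fun K => ?_
  · exact (𝒯.nullMeasurableSet_cell K).preimage
      (Measure.quasiMeasurePreserving_snd.comp Measure.quasiMeasurePreserving_snd)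
  · exact aemeasurable_apply_of_measurable_index hfloor htime fun n hn =>
      (hu n hn K).comp_quasiMeasurePreserving Measure.quasiMeasurePreserving_fst

theorem eLpNorm_sq_approx_le [SFinite P] (hd : 1 ≤ d) (hΔt : 0 < Δt) (hT : T = N * Δt)
    (hu : ∀ n < N, ∀ K, AEMeasurable (u n K) P) {M : ℝ≥0∞} (hM : ∀ n < N, 𝒯.energy P (u n) ≤ M) :
    eLpNorm (fun y : Ω × ℝ × EuclideanSpace ℝ (Fin d) => 𝒯.approx Δt u y.2.1 y.2.2 y.1) 2
      (P.prod ((volume.restrict (Set.Ico 0 T)).prod volume)) ^ 2 ≤ M * ENNReal.ofReal T := by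
  refine (eLpNorm_sq_prod_prod_le (𝒯.aemeasurable_approx hd hΔt hT hu) (M := M) ?_).trans_eq ?_
  · filter_upwards [ae_restrict_mem measurableSet_Ico] with t ht
    have hn := floor_div_lt hΔt hT ht
    exact (𝒯.eLpNorm_sq_approx_slice hd (hu _ hn)).trans_le (hM _ hn)
  · rw [Measure.restrict_apply_univ, Real.volume_Ico, sub_zero]

theorem memLp_approx_slice [SFinite P] (hd : 1 ≤ d) (hΔt : 0 < Δt) (hT : T = N * Δt)
    (hu : ∀ n < N, ∀ K, AEMeasurable (u n K) P) {r : ℝ}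
    (hr : ∀ n < N, 𝒯.energy P (u n) ≤ ENNReal.ofReal r) {t : ℝ} (ht : t ∈ Set.Ico 0 T) :
    MemLp (fun y : Ω × EuclideanSpace ℝ (Fin d) => 𝒯.approx Δt u t y.2 y.1) 2 (P.prod volume) :=
  have hn := floor_div_lt hΔt hT ht
  memLp_two_of_eLpNorm_sq_le (𝒯.aemeasurable_approx_slice hd (hu _ hn))
    ((𝒯.eLpNorm_sq_approx_slice hd (hu _ hn)).trans_le (hr _ hn))

theorem normLinftyL2_approx_sq_le [SFinite P] (hd : 1 ≤ d) (hΔt : 0 < Δt) (hT : T = N * Δt)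
    (hu : ∀ n < N, ∀ K, AEMeasurable (u n K) P) {M : ℝ≥0∞} (hM : ∀ n < N, 𝒯.energy P (u n) ≤ M) :
    normLinftyL2 P T (𝒯.approx Δt u) ^ 2 ≤ M :=
  normLinftyL2_sq_le fun _ ht =>
    have hn := floor_div_lt hΔt hT (Set.Ioo_subset_Ico_self ht)
    (𝒯.eLpNorm_sq_approx_slice hd (hu _ hn)).trans_le (hM _ hn)

end AdmissibleMesh

end ApproximateSolution

section Scheme

theorem measurable_uncurry_of_abs_sub_le {E : Type*} [MeasurableSpace E] {η : ℝ → E → ℝ}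
    (hη : ∀ a, Measurable (η a)) {h : E → ℝ} (hη_lip : ∀ a b z, |η a z - η b z| ≤ |a - b| * h z) :
    Measurable (Function.uncurry η) := by
  refine measurable_uncurry_of_continuous_of_measurable (fun z => ?_) hη
  refine continuous_iff_continuousAt.2 fun a => tendsto_iff_dist_tendsto_zero.2 ?_
  have hlim : Tendsto (fun b => |b - a| * h z) (𝓝 a) (𝓝 0) := by
    have hcont : Continuous fun b => |b - a| * h z := by fun_prop
    simpa using hcont.tendsto a
  exact squeeze_zero (fun _ => dist_nonneg) (fun b => hη_lip b a z) hlim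

theorem one_add_mul_pow_le_exp {q Δt T : ℝ} (hq : 0 ≤ q) (hΔt : 0 ≤ Δt) {N n : ℕ} (hn : n ≤ N)
    (hT : T = N * Δt) : (1 + Δt * q) ^ n ≤ Real.exp (q * T) := by
  have hnN : (n : ℝ) ≤ N := Nat.cast_le.2 hn
  calc (1 + Δt * q) ^ n ≤ Real.exp (Δt * q) ^ n := by
        refine pow_le_pow_left₀ (by positivity) ?_ n
        rw [add_comm]
        exact Real.add_one_le_exp _
    _ = Real.exp (n * (Δt * q)) := (Real.exp_nat_mul _ _).symm
    _ ≤ Real.exp (N * (Δt * q)) := by gcongr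
    _ = Real.exp (q * T) := by rw [hT]; ring_nf

theorem AdmissibleMesh.exists_isUpwindForm {d : ℕ} {ι : Type*} (𝒯 : AdmissibleMesh d ι)
    {v : ℝ → EuclideanSpace ℝ (Fin d) → EuclideanSpace ℝ (Fin d)} {V τ T : ℝ} {f : ℝ → ℝ}
    {F : ℕ → ι → ι → ℝ → ℝ → ℝ} (hF : F = 𝒯.upwindFlux v τ f ∨ F = 𝒯.splitUpwindFlux v τ f)
    (hτ : 0 ≤ τ) {n : ℕ} (hnT : (n + 1) * τ ≤ T) (hV : 0 ≤ V)
    (hv : ContinuousOn (Function.uncurry v) (Set.Icc 0 T ×ˢ Set.univ))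
    (hv_bdd : ∀ t ∈ Set.Ico 0 T, ∀ x, ‖v t x‖ ≤ V) :
    ∃ q, 𝒯.IsUpwindForm v V τ f n (F n) q := by
  rcases hF with rfl | rfl
  · exact ⟨_, 𝒯.isUpwindForm_upwindFlux hτ hnT hV hv_bdd f⟩
  · exact ⟨_, 𝒯.isUpwindForm_splitUpwindFlux hτ hnT hV hv hv_bdd f⟩

namespace IsSchemeSolution

variable {Ω E ι : Type*} {mΩ : MeasurableSpace Ω} [MeasurableSpace E] {d : ℕ} {P : Measure Ω}
  {ℱ : Filtration ℝ≥0 mΩ} {m : Measure E} {Nm : Ω → Measure (ℝ × E)} {𝒯 : AdmissibleMesh d ι}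
  {Δt : ℝ≥0} {N : ℕ} {F : ℕ → ι → ι → ℝ → ℝ → ℝ} {η : ℝ → E → ℝ}
  {u₀ : Ω → Lp ℝ 2 (volume : Measure (EuclideanSpace ℝ (Fin d)))} {u : ℕ → ι → Ω → ℝ}
  (hu : IsSchemeSolution P ℱ m Nm 𝒯 Δt N F η u₀ u)
include hu

theorem ae_eq_cellMean (K : ι) : u 0 K =ᵐ[P] fun ω => 𝒯.cellMean K (u₀ ω) := hu.initial K

theorem exists_ae_eq_transport_add (hΔt : 0 < Δt) {n : ℕ} (hn : n < N) (K : ι) :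
    ∃ I : Ω → ℝ, IsStochIntegral P ℱ m Nm (n * Δt) ((n + 1) * Δt) (fun ω _ z => η (u n K ω) z) I ∧
      u (n + 1) K =ᵐ[P] (fun ω => 𝒯.transport Δt (F n) (fun L => u n L ω) K) + I := by
  obtain ⟨I, hI, hstep⟩ := hu.step n hn K
  exact ⟨I, hI, hstep.mono fun ω =>
    𝒯.eq_transport_add (a := fun L => u n L ω) (NNReal.coe_pos.2 hΔt)⟩

variable {v : ℝ → EuclideanSpace ℝ (Fin d) → EuclideanSpace ℝ (Fin d)} {V : ℝ} {f : ℝ → ℝ}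
  {c : ℝ≥0}

theorem memLp (hd : 1 ≤ d) (hΔt : 0 < Δt) (hlip : LipschitzWith c f) (hf0 : f 0 = 0)
    (hF : ∀ n < N, ∃ q, 𝒯.IsUpwindForm v V Δt f n (F n) q) (hu₀ : MemLp u₀ 2 P) {n : ℕ}
    (hn : n ≤ N) (K : ι) : MemLp (u n K) 2 P := by
  induction n generalizing K with
  | zero => exact (𝒯.memLp_cellMean hu₀ K).ae_eq (hu.ae_eq_cellMean K).symm
  | succ n ih =>
    obtain ⟨I, hI, heq⟩ := hu.exists_ae_eq_transport_add hΔt hn K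
    obtain ⟨q, hq⟩ := hF n hn
    exact ((hq.memLp_transport 𝒯 hd hlip hf0 (ih (Nat.le_of_succ_le hn)) K).add hI.1).ae_eq heq.symm

theorem aestronglyMeasurable (hd : 1 ≤ d) (hNm : IsFiltrationPoisson P ℱ m Nm) (hΔt : 0 < Δt)
    (hf : Continuous f) (hF : ∀ n < N, ∃ q, 𝒯.IsUpwindForm v V Δt f n (F n) q)
    (hu₀ : StronglyMeasurable[ℱ 0] u₀) {n : ℕ} (hn : n ≤ N) (K : ι) :
    AEStronglyMeasurable[ℱ (n * Δt)] (u n K) P := by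
  induction n generalizing K with
  | zero =>
    rw [Nat.cast_zero, zero_mul]
    exact (𝒯.stronglyMeasurable_cellMean hu₀ K).aestronglyMeasurable.congr
      (hu.ae_eq_cellMean K).symm
  | succ n ih =>
    obtain ⟨I, hI, heq⟩ := hu.exists_ae_eq_transport_add hΔt hn K
    obtain ⟨q, hq⟩ := hF n hn
    have hle : (n : ℝ≥0) * Δt ≤ (n + 1 : ℝ≥0) * Δt := mul_le_mul_left le_self_add _
    have hX := hq.aestronglyMeasurable_transport 𝒯 hd hf (ih (Nat.le_of_succ_le hn)) K
    rw [Nat.cast_succ]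
    exact ((hX.mono (ℱ.mono hle)).add (hI.aestronglyMeasurable hNm)).congr heq.symm

variable [IsFiniteMeasure P] [SFinite m] (hd : 1 ≤ d) (hNm : IsFiltrationPoisson P ℱ m Nm)
  (hΔt : 0 < Δt) (hmono : Monotone f) (hlip : LipschitzWith c f) (hf0 : f 0 = 0)
  (hF : ∀ n < N, ∃ q, 𝒯.IsUpwindForm v V Δt f n (F n) q) (hV : 0 ≤ V) {T : ℝ} (hT : T = N * Δt)
  (hv : ContDiffOn ℝ 1 (Function.uncurry v) (Set.Icc 0 T ×ˢ Set.univ))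
  (hdiv : ∀ t ∈ Set.Ico 0 T, ∀ x, divergence (v t) x = 0)
  (hCFL : Δt * (c * V) ≤ 𝒯.α ^ 2 * 𝒯.size) (hη : Measurable (Function.uncurry η)) {h₁ : E → ℝ}
  (hh₁ : MemLp h₁ 2 m) (hη_le : ∀ a z, |η a z| ≤ |a| * h₁ z)
  (hu₀_meas : StronglyMeasurable[ℱ 0] u₀) (hu₀ : MemLp u₀ 2 P)
include hd hNm hΔt hmono hlip hf0 hF hV hT hv hdiv hCFL hη hh₁ hη_le hu₀_meas hu₀

theorem energy_succ_le {n : ℕ} (hn : n < N) :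
    𝒯.energy P (u (n + 1)) ≤ ENNReal.ofReal (1 + Δt * ∫ z, h₁ z ^ 2 ∂m) * 𝒯.energy P (u n) := by
  have hL2 : ∀ K, MemLp (u n K) 2 P := hu.memLp hd hΔt hlip hf0 hF hu₀ hn.le
  have hadapted : ∀ K, AEStronglyMeasurable[ℱ (n * Δt)] (u n K) P :=
    hu.aestronglyMeasurable hd hNm hΔt hlip.continuous hF hu₀_meas hn.le
  have hnT : (n + 1) * (Δt : ℝ) ≤ T := by
    rw [hT]
    exact mul_le_mul_of_nonneg_right (mod_cast hn) Δt.2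
  have hstep : (((n + 1) * Δt : ℝ≥0) : ℝ) - ((n * Δt : ℝ≥0) : ℝ) = Δt := by
    push_cast
    ring
  have hnoise : 0 ≤ Δt * ∫ z, h₁ z ^ 2 ∂m :=
    mul_nonneg Δt.2 (integral_nonneg fun _ => sq_nonneg _)
  obtain ⟨q, hq⟩ := hF n hn
  choose I hI heq using hu.exists_ae_eq_transport_add hΔt hn
  set X : ι → Ω → ℝ := fun K ω => 𝒯.transport Δt (F n) (fun L => u n L ω) K
  calc 𝒯.energy P (u (n + 1)) = 𝒯.energy P (fun K => X K + I K) := 𝒯.energy_congr_ae heq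
    _ ≤ 𝒯.energy P X + ENNReal.ofReal (Δt * ∫ z, h₁ z ^ 2 ∂m) * 𝒯.energy P (u n) := by
        rw [← hstep]
        exact 𝒯.energy_add_le hNm hη hh₁ hη_le (fun K => (hL2 K).1.aemeasurable)
          (hq.memLp_transport 𝒯 hd hlip hf0 hL2)
          (hq.aestronglyMeasurable_transport 𝒯 hd hlip.continuous hadapted) hI
    _ ≤ 𝒯.energy P (u n) + ENNReal.ofReal (Δt * ∫ z, h₁ z ^ 2 ∂m) * 𝒯.energy P (u n) :=
        add_le_add (hq.energy_transport_le 𝒯 hd hmono hlip hf0 Δt.2 hnT hV hv hdiv hCFL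
          fun K => (hL2 K).1) le_rfl
    _ = ENNReal.ofReal (1 + Δt * ∫ z, h₁ z ^ 2 ∂m) * 𝒯.energy P (u n) := by
        rw [ENNReal.ofReal_add zero_le_one hnoise, ENNReal.ofReal_one, add_mul, one_mul]

theorem energy_le {n : ℕ} (hn : n ≤ N) :
    𝒯.energy P (u n) ≤
      ENNReal.ofReal ((1 + Δt * ∫ z, h₁ z ^ 2 ∂m) ^ n * ∫ ω, ‖u₀ ω‖ ^ 2 ∂P) := by
  have hgrowth : 0 ≤ 1 + Δt * ∫ z, h₁ z ^ 2 ∂m :=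
    add_nonneg zero_le_one (mul_nonneg Δt.2 (integral_nonneg fun _ => sq_nonneg _))
  induction n with
  | zero =>
    rw [pow_zero, one_mul, 𝒯.energy_congr_ae hu.ae_eq_cellMean]
    exact 𝒯.energy_cellMean_le hd hu₀
  | succ n ih =>
    have hstep := hu.energy_succ_le hd hNm hΔt hmono hlip hf0 hF hV hT hv hdiv hCFL hη hh₁ hη_le
      hu₀_meas hu₀ hn
    refine hstep.trans ((mul_le_mul_right (ih (Nat.le_of_succ_le hn)) _).trans_eq ?_)
    rw [← ENNReal.ofReal_mul hgrowth, pow_succ', mul_assoc]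

theorem energy_le_exp {n : ℕ} (hn : n ≤ N) :
    𝒯.energy P (u n) ≤
      ENNReal.ofReal (Real.exp ((∫ z, h₁ z ^ 2 ∂m) * T) * ∫ ω, ‖u₀ ω‖ ^ 2 ∂P) :=
  (hu.energy_le hd hNm hΔt hmono hlip hf0 hF hV hT hv hdiv hCFL hη hh₁ hη_le hu₀_meas hu₀
    hn).trans <| ENNReal.ofReal_le_ofReal <| mul_le_mul_of_nonneg_right
      (one_add_mul_pow_le_exp (integral_nonneg fun _ => sq_nonneg _) Δt.2 hn hT)
      (integral_nonneg fun _ => sq_nonneg _)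

end IsSchemeSolution

end Scheme

end UpwindFV

theorem mainTheorem6_general
    {Ω E ι : Type*} {mΩ : MeasurableSpace Ω} [MeasurableSpace E] {d : ℕ} (hd : 1 ≤ d)
    (P : Measure Ω) [IsFiniteMeasure P] (ℱ : Filtration ℝ≥0 mΩ)
    (m : Measure E) [SFinite m] (Nm : Ω → Measure (ℝ × E))
    (hNm : UpwindFV.IsFiltrationPoisson P ℱ m Nm)
    (T : ℝ≥0) (hT : 0 < T)
    (f : ℝ → ℝ) (c_f : ℝ≥0) (hf_lip : LipschitzWith c_f f) (hf0 : f 0 = 0) (hf_mono : Monotone f)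
    (v : ℝ → EuclideanSpace ℝ (Fin d) → EuclideanSpace ℝ (Fin d)) (V : ℝ)
    (hv : ContDiffOn ℝ 1 (Function.uncurry v) (Set.Icc 0 (T : ℝ) ×ˢ Set.univ))
    (hv_div : ∀ t ∈ Set.Ico 0 (T : ℝ), ∀ x, UpwindFV.divergence (v t) x = 0)
    (hv_bdd : ∀ t ∈ Set.Ico 0 (T : ℝ), ∀ x, ‖v t x‖ ≤ V)
    (η : ℝ → E → ℝ) (hη : Measurable (Function.uncurry η)) (h₁ : E → ℝ) (hh₁ : MemLp h₁ 2 m)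
    (hη_le : ∀ a z, |η a z| ≤ |a| * h₁ z)
    (u₀ : Ω → Lp ℝ 2 (volume : Measure (EuclideanSpace ℝ (Fin d))))
    (hu₀_meas : StronglyMeasurable[ℱ 0] u₀) (hu₀ : MemLp u₀ 2 P)
    (𝒯 : UpwindFV.AdmissibleMesh d ι) (N : ℕ) (hN : 0 < N) (Δt : ℝ≥0) (hΔt : Δt = T / N)
    (hCFL : (Δt : ℝ) * (c_f * V) ≤ 𝒯.α ^ 2 * 𝒯.size)
    (F : ℕ → ι → ι → ℝ → ℝ → ℝ) (hF : F = 𝒯.upwindFlux v Δt f ∨ F = 𝒯.splitUpwindFlux v Δt f)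
    (u : ℕ → ι → Ω → ℝ)
    (hu : UpwindFV.IsSchemeSolution P ℱ m Nm 𝒯 Δt N F η u₀ u) :
    ((∀ t ∈ Set.Ico 0 (T : ℝ),
        MemLp (fun y : Ω × EuclideanSpace ℝ (Fin d) => 𝒯.approx Δt u t y.2 y.1) 2
          (P.prod volume)) ∧
      UpwindFV.normLinftyL2 P T (𝒯.approx Δt u) ^ 2 ≤
        ENNReal.ofReal (Real.exp ((∫ z, h₁ z ^ 2 ∂m) * T) * ∫ ω, ‖u₀ ω‖ ^ 2 ∂P)) ∧
    (MemLp (fun y : Ω × (ℝ × EuclideanSpace ℝ (Fin d)) => 𝒯.approx Δt u y.2.1 y.2.2 y.1) 2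
        (P.prod ((volume.restrict (Set.Ico 0 (T : ℝ))).prod volume)) ∧
      eLpNorm (fun y : Ω × (ℝ × EuclideanSpace ℝ (Fin d)) => 𝒯.approx Δt u y.2.1 y.2.2 y.1) 2
        (P.prod ((volume.restrict (Set.Ico 0 (T : ℝ))).prod volume)) ^ 2 ≤
        ENNReal.ofReal (T * Real.exp ((∫ z, h₁ z ^ 2 ∂m) * T) * ∫ ω, ‖u₀ ω‖ ^ 2 ∂P)) := by
  have hN0 : (N : ℝ≥0) ≠ 0 := Nat.cast_ne_zero.2 hN.ne'
  have hΔt0 : 0 < Δt := hΔt ▸ div_pos hT (Nat.cast_pos.2 hN)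
  have hTN : (T : ℝ) = N * Δt := by exact_mod_cast (hΔt ▸ mul_div_cancel₀ T hN0).symm
  have hV : 0 ≤ V := (norm_nonneg _).trans (hv_bdd 0 ⟨le_rfl, hT⟩ 0)
  have hform : ∀ n < N, ∃ q, 𝒯.IsUpwindForm v V Δt f n (F n) q := fun n hn =>
    𝒯.exists_isUpwindForm hF Δt.2
      (hTN ▸ mul_le_mul_of_nonneg_right (mod_cast hn) Δt.2) hV hv.continuousOn hv_bdd
  have hmeas : ∀ n < N, ∀ K, AEMeasurable (u n K) P := fun n hn K =>
    (hu.memLp hd hΔt0 hf_lip hf0 hform hu₀ hn.le K).1.aemeasurable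
  have henergy : ∀ n < N, 𝒯.energy P (u n) ≤
      ENNReal.ofReal (Real.exp ((∫ z, h₁ z ^ 2 ∂m) * T) * ∫ ω, ‖u₀ ω‖ ^ 2 ∂P) := fun n hn =>
    hu.energy_le_exp hd hNm hΔt0 hf_mono hf_lip hf0 hform hV hTN hv hv_div hCFL hη hh₁ hη_le
      hu₀_meas hu₀ hn.le
  have hsq : eLpNorm (fun y : Ω × (ℝ × EuclideanSpace ℝ (Fin d)) => 𝒯.approx Δt u y.2.1 y.2.2 y.1) 2
      (P.prod ((volume.restrict (Set.Ico 0 (T : ℝ))).prod volume)) ^ 2 ≤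
      ENNReal.ofReal (T * Real.exp ((∫ z, h₁ z ^ 2 ∂m) * T) * ∫ ω, ‖u₀ ω‖ ^ 2 ∂P) := by
    rw [mul_assoc, ENNReal.ofReal_mul T.coe_nonneg, mul_comm]
    exact 𝒯.eLpNorm_sq_approx_le hd hΔt0 hTN hmeas henergy
  exact ⟨⟨fun t => 𝒯.memLp_approx_slice hd hΔt0 hTN hmeas henergy,
    𝒯.normLinftyL2_approx_sq_le hd hΔt0 hTN hmeas henergy⟩,
    UpwindFV.memLp_two_of_eLpNorm_sq_le (𝒯.aemeasurable_approx hd hΔt0 hTN hmeas) hsq, hsq⟩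

theorem mainTheorem6
    {Ω E ι : Type*} {mΩ : MeasurableSpace Ω} [MeasurableSpace E] {d : ℕ} (hd : 1 ≤ d)
    -- filtered probability space and Poisson random measure
    (P : Measure Ω) [IsProbabilityMeasure P] (ℱ : Filtration ℝ≥0 mΩ)
    (hℱ : UpwindFV.UsualHypotheses P ℱ)
    (m : Measure E) [SigmaFinite m] (Nm : Ω → Measure (ℝ × E))
    (hNm : UpwindFV.IsFiltrationPoisson P ℱ m Nm)
    (T : ℝ≥0) (hT : 0 < T)
    -- the flux function
    (f : ℝ → ℝ) (c_f : ℝ≥0) (hf : ContDiff ℝ 2 f) (hf_lip : LipschitzWith c_f f) (hf0 : f 0 = 0)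
    (hf_mono : Monotone f)
    -- the velocity field
    (v : ℝ → EuclideanSpace ℝ (Fin d) → EuclideanSpace ℝ (Fin d)) (V : ℝ)
    (hv : ContDiffOn ℝ 1 (Function.uncurry v) (Set.Icc 0 (T : ℝ) ×ˢ Set.univ))
    (hv_div : ∀ t ∈ Set.Ico 0 (T : ℝ), ∀ x, UpwindFV.divergence (v t) x = 0)
    (hv_bdd : ∀ t ∈ Set.Ico 0 (T : ℝ), ∀ x, ‖v t x‖ ≤ V)
    -- the noise coefficient
    (η : ℝ → E → ℝ) (hη_meas : ∀ a, Measurable (η a))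
    (lam C : ℝ) (h₁ : E → ℝ) (hlam : 0 < lam) (hlam' : lam < 1) (hC : 0 < C)
    (hh₁ : MemLp h₁ 2 m) (hh₁_bdd : ∀ z, 0 ≤ h₁ z ∧ h₁ z ≤ 1)
    (hη_lip : ∀ a b z, |η a z - η b z| ≤ lam * |a - b| * h₁ z)
    (hη_bdd : ∀ a z, |η a z| ≤ C * h₁ z) (hη0 : ∀ z, η 0 z = 0)
    -- the initial value
    (u₀ : Ω → Lp ℝ 2 (volume : Measure (EuclideanSpace ℝ (Fin d))))
    (hu₀_meas : StronglyMeasurable[ℱ 0] u₀) (hu₀ : MemLp u₀ 2 P)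
    -- the mesh, the time step and the CFL condition `Δt ≤ α² h / (c_f V)`
    (𝒯 : UpwindFV.AdmissibleMesh d ι) (N : ℕ) (hN : 0 < N) (Δt : ℝ≥0) (hΔt : Δt = T / N)
    (hCFL : (Δt : ℝ) * (c_f * V) ≤ 𝒯.α ^ 2 * 𝒯.size)
    -- the upwind finite volume scheme
    (F : ℕ → ι → ι → ℝ → ℝ → ℝ) (hF : F = 𝒯.upwindFlux v Δt f ∨ F = 𝒯.splitUpwindFlux v Δt f)
    (u : ℕ → ι → Ω → ℝ)
    (hu : UpwindFV.IsSchemeSolution P ℱ m Nm 𝒯 Δt N F η u₀ u) :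
    ((∀ t ∈ Set.Ico 0 (T : ℝ),
        MemLp (fun y : Ω × EuclideanSpace ℝ (Fin d) => 𝒯.approx Δt u t y.2 y.1) 2
          (P.prod volume)) ∧
      UpwindFV.normLinftyL2 P T (𝒯.approx Δt u) ^ 2 ≤
        ENNReal.ofReal (Real.exp ((∫ z, h₁ z ^ 2 ∂m) * T) * ∫ ω, ‖u₀ ω‖ ^ 2 ∂P)) ∧
    (MemLp (fun y : Ω × (ℝ × EuclideanSpace ℝ (Fin d)) => 𝒯.approx Δt u y.2.1 y.2.2 y.1) 2
        (P.prod ((volume.restrict (Set.Ico 0 (T : ℝ))).prod volume)) ∧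
      eLpNorm (fun y : Ω × (ℝ × EuclideanSpace ℝ (Fin d)) => 𝒯.approx Δt u y.2.1 y.2.2 y.1) 2
        (P.prod ((volume.restrict (Set.Ico 0 (T : ℝ))).prod volume)) ^ 2 ≤
        ENNReal.ofReal (T * Real.exp ((∫ z, h₁ z ^ 2 ∂m) * T) * ∫ ω, ‖u₀ ω‖ ^ 2 ∂P)) := by
  have hη_abs_sub : ∀ a b z, |η a z - η b z| ≤ |a - b| * h₁ z := fun a b z =>
    (hη_lip a b z).trans <| mul_le_mul_of_nonneg_right
      (mul_le_of_le_one_left (abs_nonneg _) hlam'.le) (hh₁_bdd z).1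
  exact mainTheorem6_general hd P ℱ m Nm hNm T hT f c_f hf_lip hf0 hf_mono v V hv hv_div hv_bdd η
    (UpwindFV.measurable_uncurry_of_abs_sub_le hη_meas hη_abs_sub) h₁ hh₁
    (fun a z => by simpa only [hη0, sub_zero] using hη_abs_sub a 0 z) u₀ hu₀_meas hu₀ 𝒯 N hN Δt hΔt
    hCFL F hF u hu
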